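/- **Setting.** Let $(X,Y)$ be a random pair with values in $\mathbb R^d\times\mathbb R$, $X=(x_1,\dots,x_d)$, $x_j\in L_2$, and let $(X_i,Y_i)_{i=1}^N$ be independent copies of $(X,Y)$. Write $R(t)=\mathbb E(Y-\langle X,t\rangle)^2$, let $t^*$ be a minimizer of $R$ over $\mathbb R^d$, and set $\xi=Y-\langle X,t^*\rangle$, $\sigma_q=\|\xi\|_{L_q}$, $M=\max_{j}\|x_j\|_{L_2}$. For $\lambda>0$ the LASSO produces any $$\hat t\in\operatorname*{argmin}_{t\in\mathbb R^d}\Big(\frac1N\sum_{i=1}^N(Y_i-\langle X_i,t\rangle)^2+\lambda\|t\|_1\Big).$$ For $q>2$ put $r_0=\min\{1/2+q/4,2\}$ and $r_0'=r_0/(r_0-1)$. For $\kappa_0,\kappa>0$ and $0<\varepsilon\le1$ put $$\Lambda(\rho)=\frac{\kappa_0\rho M}{\kappa^2\varepsilon}\sqrt{\frac{\log d}{N}}.$$ **Theorem.** There are absolute constants $a_0,a_1>0$ such that for every $C>0$ there are positive constants $c_0,c_2,c_5,c_6$ depending only on $C$, for every $q>2$ a constant $c_1>0$ depending only on $C,q$,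 and for every $a_2\ge4$ a constant $c_4>0$ depending only on $C,q,a_2$, for which the following holds. Let $N\le d$, $p_0=a_2\log d$, and assume $2\le p_0\le CN$ and $4r_0'\max\{2,1+a_0/a_1\}\le a_2\log N$. Assume that * $\|x_j\|_{L_p}\le\kappa_0\sqrt p\,\|x_j\|_{L_2}$ for every $1\le j\le d$ and $2\le p\le p_0$; * $\Pr\big(|\langle X,t\rangle|\ge\kappa\|\langle X,t\rangle\|_{L_2}\big)\ge\varepsilon$ for every $t\in\mathbb R^d$; * $\xi\in L_q$. Let $u>2$, $v>0$, $w\ge2$, $p=(a_2/2)\log d$, $m=p/\log(eN/p)$, $$\delta=\frac{e^{-p/2}}{u^{2p}}+\frac{4e^{-p/2}}{u^{c_0m}}+\frac{c_1\log^qN}{w^qN^{q/2-1}}+2\exp(-v^2a_2\log d),$$ $$r^2(\rho)=c_2\begin{cases}(uw+u^2v)\,\sigma_q\Lambda(\rho)&\text{if }N\ge(32/(\kappa\varepsilon))^2d,\\ \max\{(uw+u^2v)\,\sigma_q\Lambda(\rho),\ \kappa^2\Lambda^2(\rho)\}&\text{otherwise.}\end{cases}$$ If $$\lambda>c_4(uw+u^2v)\,\kappa_0\,\|\xi\|_{L_q}M\sqrt{\frac{\log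 d}{N}},$$ then with probability at least $1-5\delta-2\exp(-\varepsilon^2N/2)$ every LASSO output $\hat t$ with parameter $\lambda$ satisfies $$R(\hat t)-R(t^*)=\|\langle X,\hat t-t^*\rangle\|_{L_2}^2\le c_5\max\Big\{r^2(c_6\|t^*\|_1),\ \frac{\lambda}{\kappa^2\varepsilon}\|t^*\|_1\Big\},$$ where $\|\langle X,\hat t-t^*\rangle\|_{L_2}^2=\mathbb E\langle X,\hat t-t^*\rangle^2$ is taken over $X$ with the data held fixed. -/

import Mathlib

open MeasureTheory ProbabilityTheory

noncomputable section

/-- The `ℓ₁` norm on `ℝ^d`. -/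
def ell1 {d : ℕ} (t : Fin d → ℝ) : ℝ := ∑ j, |t j|

/-- The `L_p` norm of a real random variable, as a real number
(used only for variables in `L_p`). -/
def normL {Ω : Type*} [MeasurableSpace Ω] (P : Measure Ω) (p : ℝ) (Z : Ω → ℝ) : ℝ :=
  (eLpNorm Z (ENNReal.ofReal p) P).toReal

/-- The risk `R(t) = E (Y - ⟨X, t⟩)²`. -/
def risk {Ω : Type*} [MeasurableSpace Ω] {d : ℕ} (P : Measure Ω)
    (X : Ω → Fin d → ℝ) (Y : Ω → ℝ) (t : Fin d → ℝ) : ℝ :=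
  ∫ ω, (Y ω - X ω ⬝ᵥ t) ^ 2 ∂P

/-- The penalized empirical risk `N⁻¹ ∑ (y_i - ⟨x_i, t⟩)² + lam ‖t‖₁` of the data `(x_i, y_i)`. -/
def lassoObjective {N d : ℕ} (x : Fin N → Fin d → ℝ) (y : Fin N → ℝ) (lam : ℝ)
    (t : Fin d → ℝ) : ℝ :=
  (1 / (N : ℝ)) * ∑ i, (y i - x i ⬝ᵥ t) ^ 2 + lam * ell1 t

/-- `t` is an output of the LASSO with regularization parameter `lam` on the data `(x_i, y_i)`. -/
def IsLasso {N d : ℕ} (x : Fin N → Fin d → ℝ) (y : Fin N → ℝ) (lam : ℝ)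
    (t : Fin d → ℝ) : Prop :=
  ∀ s : Fin d → ℝ, lassoObjective x y lam t ≤ lassoObjective x y lam s

/-- `M = max_j ‖x_j‖_{L_2}`. -/
def maxCoordNorm {Ω : Type*} [MeasurableSpace Ω] {d : ℕ} (P : Measure Ω)
    (X : Ω → Fin d → ℝ) : ℝ :=
  ⨆ j, normL P 2 (fun ω => X ω j)

/-- The noise `ξ = Y - ⟨X, tstar⟩`. -/
def noise {Ω : Type*} {d : ℕ} (X : Ω → Fin d → ℝ) (Y : Ω → ℝ) (tstar : Fin d → ℝ) (ω : Ω) : ℝ :=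
  Y ω - X ω ⬝ᵥ tstar

/-- The conditions on the design `X` and on the noise `ξ`: the coordinates of `X` are square
integrable with subgaussian moment growth (constant `κ₀`) up to order `p₀`, linear functionals of
`X` satisfy a small-ball condition with constants `κ` and `ε`, and `ξ ∈ L_q`. -/
structure DesignNoise {Ω : Type*} [MeasurableSpace Ω] {d : ℕ} (P : Measure Ω)
    (X : Ω → Fin d → ℝ) (ξ : Ω → ℝ) (p₀ q κ₀ κ ε : ℝ) : Prop where
  memLp_coord : ∀ j, MemLp (fun ω => X ω j) 2 P
  moments : ∀ j, ∀ p : ℝ, 2 ≤ p → p ≤ p₀ →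
    eLpNorm (fun ω => X ω j) (ENNReal.ofReal p) P
      ≤ ENNReal.ofReal (κ₀ * √p) * eLpNorm (fun ω => X ω j) 2 P
  small_ball : ∀ t : Fin d → ℝ,
    ε ≤ P.real {ω | κ * normL P 2 (fun ω' => X ω' ⬝ᵥ t) ≤ |X ω ⬝ᵥ t|}
  noise_memLp : MemLp ξ (ENNReal.ofReal q) P

/-- The exponent `r = min {1/2 + q/4, 2}`. -/
def rExp (q : ℝ) : ℝ := min (1 / 2 + q / 4) 2

/-- The conjugate exponent `r' = r / (r - 1)` of `r`. -/
def rConj (q : ℝ) : ℝ := rExp q / (rExp q - 1)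

/-- The confidence level `δ`, with `p = (a₂ / 2) log d` and `m = p / log (e N / p)`. -/
def confLevel (c₀ c₁ a₂ q u v w : ℝ) (N d : ℕ) : ℝ :=
  let p : ℝ := a₂ / 2 * Real.log d
  let m : ℝ := p / Real.log (Real.exp 1 * N / p)
  Real.exp (-p / 2) / u ^ (2 * p)
    + 4 * Real.exp (-p / 2) / u ^ (c₀ * m)
    + c₁ * Real.log N ^ q / (w ^ q * (N : ℝ) ^ (q / 2 - 1))
    + 2 * Real.exp (-(v ^ 2 * a₂ * Real.log d))

/-- `Λ(ρ) = (κ₀ ρ M / (κ² ε)) √(log d / N)`. -/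
def Lam (κ₀ κ ε M : ℝ) (N d : ℕ) (ρ : ℝ) : ℝ :=
  κ₀ * ρ * M / (κ ^ 2 * ε) * √(Real.log d / N)

open Classical in
/-- The squared rate `r²(ρ)`; `σ` stands for `‖ξ‖_{L_q}`. -/
def rateSq (c₂ u v w κ₀ κ ε M σ : ℝ) (N d : ℕ) (ρ : ℝ) : ℝ :=
  c₂ * if (32 / (κ * ε)) ^ 2 * (d : ℝ) ≤ N then
      (u * w + u ^ 2 * v) * σ * Lam κ₀ κ ε M N d ρ
    else
      max ((u * w + u ^ 2 * v) * σ * Lam κ₀ κ ε M N d ρ) (κ ^ 2 * Lam κ₀ κ ε M N d ρ ^ 2)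

end

/-! ### Chernoff-type bounds for sums of independent variables -/

section

open scoped Nat

/-! Write h = t̂ - t*, R = √(log d / N) and a = ‖t*‖₁. The argument is deterministic on an event
described by two random conditions.

The first condition controls the multiplier process: |∑ᵢ ξᵢ xᵢⱼ| ≤ λN/4 for every coordinate j.
Comparing the LASSO objective at t̂ and t* then gives ‖h‖₁ ≤ 4a and ∑ᵢ ⟨Xᵢ, h⟩² ≤ (3/2) λ a N
(`IsLasso.basic_inequality`). The second is a uniform small-ball bound: every direction of unit L₂
norm with ℓ₁ norm at most ρ = κε / (128 κ₀ M R) satisfies ∑ᵢ ⟨Xᵢ, ·⟩² ≥ κ² ε N / 4. Apply it to h/τ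
with τ = ‖⟨X, h⟩‖_{L₂}. Either ‖h/τ‖₁ > ρ, so that τ < 4a/ρ = 512 κ Λ(a), or the quadratic lower
bound gives τ² ≤ 6 λ a / (κ² ε) (`sq_le_max_of_clippedSq`). The first alternative is covered by r²,
because N ≤ d and κ² ε ≤ 1 exclude the case in which r² lacks the term κ² Λ²
(`max_le_mul_max_rateSq`).

The multiplier condition (`measureReal_multiplier_le`) must hold with ξ only in L_q and the
coordinates having moments only up to order 2p = a₂ log d. The products ξ xⱼ are centred because t*
minimizes the risk. If N ≤ p, the Cauchy–Schwarz inequality and bounds on ∑ ξᵢ² and ∑ xᵢⱼ² suffice.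
If p < N, put L = log(eN/p), and truncate xⱼ at a multiple of √L and ξ at √u e^{(1/4 + 1/(2q))L}.
The bounded part obeys a Bernstein inequality, and the large parts are handled by the Cauchy–Schwarz
inequality, using the sum of the large xᵢⱼ² and the number of large ξᵢ. Each event depending on j is
rare enough for a union bound over d ≤ e^{p/2} coordinates. Where exponential moments are missing,
the truncated series `expPoly` replaces the exponential.

The small-ball condition (`measure_smallBall_le`) replaces the indicator of {|s| ≥ κ} by the
Lipschitz function `clippedSq`. The supremum of its empirical deviation concentrates by McDiarmid's
inequality; symmetrization and contraction bound its mean by the expected sup norm of a symmetrized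
sum of the Xᵢ. Comparison with Gaussian moments of order about log d bounds the latter by a multiple
of κ₀ M √(N log d). -/

/-- Markov's inequality for a product, whose expectation factorizes by independence. All the
one-sided tail bounds below are instances, with g an exponential or a substitute for it. -/
theorem measureReal_pi_le_of_le_prod {E : Type*} [MeasurableSpace E] {μ : Measure E}
    [IsProbabilityMeasure μ] {N : ℕ} {g : E → ℝ} (hg0 : ∀ e, 0 ≤ g e) (hg : Integrable g μ)
    {a : ℝ} (ha : 0 < a) {S : Set (Fin N → E)} (hS : ∀ ω ∈ S, a ≤ ∏ i, g (ω i)) :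
    (Measure.pi fun _ : Fin N => μ).real S ≤ (∫ e, g e ∂μ) ^ N / a := by
  have h1 : Integrable (fun ω : Fin N → E => ∏ i, g (ω i)) (Measure.pi fun _ => μ) :=
    Integrable.fintype_prod (fun _ => hg)
  have h2 := mul_meas_ge_le_integral_of_nonneg (μ := Measure.pi fun _ : Fin N => μ)
    (Filter.Eventually.of_forall fun ω => Finset.prod_nonneg fun i _ => hg0 (ω i)) h1 a
  rw [integral_fintype_prod_eq_pow, Fintype.card_fin] at h2
  rw [le_div_iff₀ ha, mul_comm]
  exact (mul_le_mul_of_nonneg_left (measureReal_mono (fun ω hω => hS ω hω)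
    (measure_ne_top _ _)) ha.le).trans h2

/-- The truncated exponential series. -/
noncomputable def expPoly (n : ℕ) (x : ℝ) : ℝ := ∑ l ∈ Finset.range (n + 1), x ^ l / l !

theorem expPoly_nonneg (n : ℕ) {x : ℝ} (hx : 0 ≤ x) : 0 ≤ expPoly n x :=
  Finset.sum_nonneg fun _ _ => by positivity

theorem pow_div_factorial_le_expPoly (n : ℕ) {x : ℝ} (hx : 0 ≤ x) : x ^ n / n ! ≤ expPoly n x :=
  Finset.single_le_sum (f := fun l : ℕ => x ^ l / (l ! : ℝ)) (fun _ _ => by positivity)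
    (Finset.self_mem_range_succ n)

theorem expPoly_zero (n : ℕ) : expPoly n 0 = 1 := by
  simp [expPoly, Finset.sum_range_succ']

/-- The product of the two truncated series contains every term of the binomial expansions of degree
at most n; its other terms are nonnegative. This submultiplicativity is what makes the truncated
series usable in place of the exponential when only finitely many moments exist. -/
theorem expPoly_add_le (n : ℕ) {x y : ℝ} (hx : 0 ≤ x) (hy : 0 ≤ y) :
    expPoly n (x + y) ≤ expPoly n x * expPoly n y := by
  unfold expPoly
  rw [Finset.sum_mul_sum, ← Finset.sum_product']
  have key : ∀ k ∈ Finset.range (n + 1), (x + y) ^ k / (k ! : ℝ)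
      = ∑ z ∈ (Finset.range (n + 1) ×ˢ Finset.range (n + 1)) with z.1 + z.2 = k,
        x ^ z.1 / (z.1 ! : ℝ) * (y ^ z.2 / (z.2 ! : ℝ)) := by
    intro k hk
    have hk' : k ≤ n := Nat.lt_succ_iff.1 (Finset.mem_range.1 hk)
    have : ((Finset.range (n + 1) ×ˢ Finset.range (n + 1)).filter fun z => z.1 + z.2 = k)
        = Finset.HasAntidiagonal.antidiagonal k := by
      ext z
      simp only [Finset.mem_filter, Finset.mem_product, Finset.mem_range, Finset.HasAntidiagonal.mem_antidiagonal]
      omega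
    rw [this, (Commute.all x y).add_pow', Finset.sum_div]
    refine Finset.sum_congr rfl fun z hz => ?_
    rw [Finset.HasAntidiagonal.mem_antidiagonal] at hz
    have h : ((k.choose z.1 : ℕ) : ℝ) * (z.1 ! : ℝ) * (z.2 ! : ℝ) = (k ! : ℝ) := by
      rw [← hz, Nat.choose_symm_add]
      exact_mod_cast Nat.add_choose_mul_factorial_mul_factorial z.1 z.2
    have h1 : (z.1 ! : ℝ) ≠ 0 := by positivity
    have h2 : (z.2 ! : ℝ) ≠ 0 := by positivity
    have h3 : (k ! : ℝ) ≠ 0 := by positivity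
    rw [nsmul_eq_mul]
    field_simp
    rw [← h]; ring
  rw [Finset.sum_congr rfl key]
  exact Finset.sum_fiberwise_le_sum_of_sum_fiber_nonneg fun k _ =>
    Finset.sum_nonneg fun z _ => by positivity

theorem le_prod_of_submultiplicative {G : ℝ → ℝ} (hG0 : ∀ x, 0 ≤ x → 0 ≤ G x) (h0 : G 0 ≤ 1)
    (hadd : ∀ x y, 0 ≤ x → 0 ≤ y → G (x + y) ≤ G x * G y)
    {ι : Type*} (s : Finset ι) (Z : ι → ℝ) (hZ : ∀ i, 0 ≤ Z i) :
    G (∑ i ∈ s, Z i) ≤ ∏ i ∈ s, G (Z i) := by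
  classical
  induction s using Finset.induction_on with
  | empty => simpa using h0
  | insert a s ha ih =>
    rw [Finset.sum_insert ha, Finset.prod_insert ha]
    exact (hadd _ _ (hZ a) (Finset.sum_nonneg fun i _ => hZ i)).trans
      (mul_le_mul_of_nonneg_left ih (hG0 _ (hZ a)))

/-- On the event, submultiplicativity bounds the product of the `expPoly n (Z (ω i))` from below by
the top term s ^ n / n! of the series at the sum. -/
theorem measureReal_sum_ge_le_of_expPoly {E : Type*} [MeasurableSpace E] {μ : Measure E}
    [IsProbabilityMeasure μ] {N n : ℕ} {Z : E → ℝ} (hZ : ∀ e, 0 ≤ Z e)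
    (hint : Integrable (fun e => expPoly n (Z e)) μ) {τ s : ℝ}
    (hτ : ∫ e, expPoly n (Z e) ∂μ ≤ 1 + τ) (hs : 0 < s) :
    (Measure.pi fun _ : Fin N => μ).real {ω | s ≤ ∑ i, Z (ω i)}
      ≤ Real.exp (N * τ) * (n ! / s ^ n) := by
  have h := measureReal_pi_le_of_le_prod (N := N) (g := fun e => expPoly n (Z e))
    (fun e => expPoly_nonneg n (hZ e)) hint (a := s ^ n / n !) (by positivity)
    (S := {ω | s ≤ ∑ i, Z (ω i)}) (fun ω hω => by
      have hω' : s ≤ ∑ i, Z (ω i) := hω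
      calc s ^ n / n ! ≤ (∑ i, Z (ω i)) ^ n / n ! := by gcongr
        _ ≤ expPoly n (∑ i, Z (ω i)) := pow_div_factorial_le_expPoly n (hs.le.trans hω')
        _ ≤ _ := le_prod_of_submultiplicative (fun x => expPoly_nonneg n) (expPoly_zero n).le
            (fun x y => expPoly_add_le n) _ _ fun i => hZ _)
  refine h.trans ?_
  rw [div_div_eq_mul_div, mul_div_assoc, Real.exp_nat_mul]
  gcongr
  · exact integral_nonneg fun e => expPoly_nonneg n (hZ e)
  · exact hτ.trans (by rw [add_comm]; exact Real.add_one_le_exp τ)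

/-- A Poisson-type Chernoff bound for sums of independent variables with values in `[0, 1]`. -/
theorem measureReal_sum_ge_le_of_mem_Icc {E : Type*} [MeasurableSpace E] {μ : Measure E}
    [IsProbabilityMeasure μ] {N : ℕ} {Z : E → ℝ} (hZm : Measurable Z)
    (hZ : ∀ e, Z e ∈ Set.Icc (0 : ℝ) 1) {l η : ℝ} (hl : 0 ≤ l) (hη : ∫ e, Z e ∂μ ≤ η) (s : ℝ) :
    (Measure.pi fun _ : Fin N => μ).real {ω | s ≤ ∑ i, Z (ω i)}
      ≤ Real.exp (-(l * s) + N * (η * Real.exp l)) := by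
  have hZi : Integrable Z μ := Integrable.of_mem_Icc 0 1 hZm.aemeasurable (.of_forall hZ)
  have hint : Integrable (fun e => Real.exp (l * Z e)) μ :=
    Integrable.of_mem_Icc 0 (Real.exp l) (by fun_prop) (.of_forall fun e =>
      ⟨(Real.exp_pos _).le, Real.exp_le_exp.2 (by nlinarith [(hZ e).2])⟩)
  have h := measureReal_pi_le_of_le_prod (N := N) (g := fun e => Real.exp (l * Z e))
    (fun e => (Real.exp_pos _).le) hint (Real.exp_pos (l * s))
    (S := {ω | s ≤ ∑ i, Z (ω i)}) (fun ω hω => by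
      rw [← Real.exp_sum, ← Finset.mul_sum]
      exact Real.exp_le_exp.2 (mul_le_mul_of_nonneg_left hω hl))
  refine h.trans ?_
  have hb : ∫ e, Real.exp (l * Z e) ∂μ ≤ Real.exp (η * Real.exp l) := by
    have h1 : ∀ e, Real.exp (l * Z e) ≤ 1 + Z e * Real.exp l := fun e => by
      have hc := convexOn_exp.2 (Set.mem_univ 0) (Set.mem_univ l)
        (show 0 ≤ 1 - Z e by linarith [(hZ e).2]) (hZ e).1 (by ring)
      simp only [smul_eq_mul, mul_zero, zero_add, Real.exp_zero, mul_one] at hc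
      rw [mul_comm]; linarith [(hZ e).1]
    calc ∫ e, Real.exp (l * Z e) ∂μ ≤ ∫ e, (1 + Z e * Real.exp l) ∂μ :=
          integral_mono hint ((integrable_const _).add (hZi.mul_const _)) h1
      _ = 1 + (∫ e, Z e ∂μ) * Real.exp l := by
          rw [integral_add (integrable_const _) (hZi.mul_const _), integral_mul_const]; simp
      _ ≤ 1 + η * Real.exp l := by gcongr
      _ ≤ _ := by rw [add_comm]; exact Real.add_one_le_exp _
  rw [div_eq_mul_inv, ← Real.exp_neg, Real.exp_add, Real.exp_nat_mul, mul_comm]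
  gcongr

/-- A Bernstein-type Chernoff bound for sums of independent variables with values in `[-1, 1]`. -/
theorem measureReal_sum_ge_le_of_abs_le_one {E : Type*} [MeasurableSpace E] {μ : Measure E}
    [IsProbabilityMeasure μ] {N : ℕ} {Z : E → ℝ} (hZm : Measurable Z) (hZ : ∀ e, |Z e| ≤ 1)
    (s : ℝ) :
    (Measure.pi fun _ : Fin N => μ).real {ω | s ≤ ∑ i, Z (ω i)}
      ≤ Real.exp (-s + N * (∫ e, Z e ∂μ + ∫ e, Z e ^ 2 ∂μ)) := by
  have hZi : Integrable Z μ := Integrable.of_mem_Icc (-1) 1 hZm.aemeasurable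
    (.of_forall fun e => abs_le.1 (hZ e))
  have hZ2 : Integrable (fun e => Z e ^ 2) μ := Integrable.of_mem_Icc 0 1 (by fun_prop)
    (.of_forall fun e => ⟨sq_nonneg _, (sq_le_one_iff_abs_le_one _).2 (hZ e)⟩)
  have hint : Integrable (fun e => Real.exp (Z e)) μ :=
    Integrable.of_mem_Icc 0 (Real.exp 1) (by fun_prop) (.of_forall fun e =>
      ⟨(Real.exp_pos _).le, Real.exp_le_exp.2 (abs_le.1 (hZ e)).2⟩)
  have h := measureReal_pi_le_of_le_prod (N := N) (g := fun e => Real.exp (Z e))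
    (fun e => (Real.exp_pos _).le) hint (Real.exp_pos s)
    (S := {ω | s ≤ ∑ i, Z (ω i)}) (fun ω hω => by
      rw [← Real.exp_sum]
      exact Real.exp_le_exp.2 hω)
  refine h.trans ?_
  have hb : ∫ e, Real.exp (Z e) ∂μ ≤ Real.exp (∫ e, Z e ∂μ + ∫ e, Z e ^ 2 ∂μ) := by
    have h1 : ∀ e, Real.exp (Z e) ≤ 1 + (Z e + Z e ^ 2) := fun e => by
      have := (abs_le.1 (Real.abs_exp_sub_one_sub_id_le (hZ e))).2
      linarith
    calc ∫ e, Real.exp (Z e) ∂μ ≤ ∫ e, (1 + (Z e + Z e ^ 2)) ∂μ :=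
          integral_mono hint ((integrable_const _).add (hZi.add hZ2)) h1
      _ = 1 + (∫ e, Z e ∂μ + ∫ e, Z e ^ 2 ∂μ) := by
          rw [← integral_add hZi hZ2, integral_add (integrable_const _) (by exact hZi.add hZ2)]; simp
      _ ≤ _ := by rw [add_comm]; exact Real.add_one_le_exp _
  rw [div_eq_mul_inv, ← Real.exp_neg, Real.exp_add, Real.exp_nat_mul, mul_comm]
  gcongr

theorem integrable_rpow_and_integral_le_of_eLpNorm_le {E : Type*} [MeasurableSpace E]
    {μ : Measure E} {Z : E → ℝ} (hZ : AEStronglyMeasurable Z μ) {r c : ℝ} (hr : 0 < r)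
    (hc : 0 ≤ c) (h : eLpNorm Z (ENNReal.ofReal r) μ ≤ ENNReal.ofReal c) :
    Integrable (fun e => |Z e| ^ r) μ ∧ ∫ e, |Z e| ^ r ∂μ ≤ c ^ r := by
  have hmem : MemLp Z (ENNReal.ofReal r) μ := ⟨hZ, h.trans_lt ENNReal.ofReal_lt_top⟩
  have hr0 : ENNReal.ofReal r ≠ 0 := by simpa using hr
  have hi := hmem.integrable_norm_rpow hr0 ENNReal.ofReal_ne_top
  rw [ENNReal.toReal_ofReal hr.le] at hi
  refine ⟨hi, ?_⟩
  rw [hmem.eLpNorm_eq_integral_rpow_norm hr0 ENNReal.ofReal_ne_top, ENNReal.toReal_ofReal hr.le,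
    ENNReal.ofReal_le_ofReal_iff hc] at h
  have h0 : 0 ≤ ∫ e, |Z e| ^ r ∂μ := integral_nonneg fun e => by positivity
  calc ∫ e, |Z e| ^ r ∂μ = ((∫ e, |Z e| ^ r ∂μ) ^ r⁻¹) ^ r := by
        rw [← Real.rpow_mul h0, inv_mul_cancel₀ hr.ne', Real.rpow_one]
    _ ≤ c ^ r := Real.rpow_le_rpow (by positivity) h hr.le

theorem measureReal_abs_gt_le {E : Type*} [MeasurableSpace E] {μ : Measure E}
    [IsFiniteMeasure μ] {Z : E → ℝ} {r a b : ℝ} (hr : 0 ≤ r) (ha : 0 < a)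
    (hi : Integrable (fun e => |Z e| ^ r) μ) (hb : ∫ e, |Z e| ^ r ∂μ ≤ b) :
    μ.real {e | a < |Z e|} ≤ b / a ^ r := by
  have h := mul_meas_ge_le_integral_of_nonneg (μ := μ) (f := fun e => |Z e| ^ r)
    (.of_forall fun e => by positivity) hi (a ^ r)
  rw [le_div_iff₀ (by positivity), mul_comm]
  exact (mul_le_mul_of_nonneg_left (measureReal_mono
    (fun e (he : a < |Z e|) => Real.rpow_le_rpow ha.le he.le hr) (measure_ne_top _ _))
    (by positivity)).trans (h.trans hb)

theorem integral_mul_sq_le {E : Type*} [MeasurableSpace E] {μ : Measure E} {f g : E → ℝ}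
    (hf : MemLp f 2 μ) (hg : MemLp g 2 μ) :
    ∫ e, |f e * g e| ∂μ ≤ √(∫ e, f e ^ 2 ∂μ) * √(∫ e, g e ^ 2 ∂μ) := by
  have h := integral_mul_le_Lp_mul_Lq_of_nonneg (μ := μ) (p := 2) (q := 2)
    Real.HolderConjugate.two_two (f := fun e => |f e|) (g := fun e => |g e|)
    (.of_forall fun e => abs_nonneg _) (.of_forall fun e => abs_nonneg _)
    (by rw [ENNReal.ofReal_ofNat]; exact hf.abs) (by rw [ENNReal.ofReal_ofNat]; exact hg.abs)
  simp only [Real.rpow_ofNat, sq_abs, ← abs_mul] at h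
  rwa [← Real.sqrt_eq_rpow, ← Real.sqrt_eq_rpow] at h

/-! ### Sums of squares and counts of large values under limited moments -/

/-- The absolute moments of `x` of orders between `2` and `p₀` are bounded by those of a
standard subgaussian variable. -/
def SubgaussianMoments {E : Type*} [MeasurableSpace E] (μ : Measure E) (x : E → ℝ) (p₀ : ℝ) :
    Prop :=
  ∀ r : ℝ, 2 ≤ r → r ≤ p₀ → Integrable (fun e => |x e| ^ r) μ ∧ ∫ e, |x e| ^ r ∂μ ≤ r ^ (r / 2)

theorem measureReal_pi_exists_le {E : Type*} [MeasurableSpace E] {μ : Measure E}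
    [IsProbabilityMeasure μ] {N : ℕ} {S : Set E} (hS : MeasurableSet S) :
    (Measure.pi fun _ : Fin N => μ).real {ω | ∃ i, ω i ∈ S} ≤ N * μ.real S := by
  have h1 : {ω : Fin N → E | ∃ i, ω i ∈ S} = ⋃ i, (Function.eval i) ⁻¹' S := by
    ext ω; simp
  rw [h1]
  refine (measureReal_iUnion_fintype_le _).trans ?_
  have h2 : ∀ i : Fin N, (Measure.pi fun _ : Fin N => μ).real ((Function.eval i) ⁻¹' S)
      = μ.real S := fun i =>
    (measurePreserving_eval (fun _ : Fin N => μ) i).measureReal_preimage hS.nullMeasurableSet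
  simp [h2]

theorem half_lt_log_two : (1 / 2 : ℝ) < Real.log 2 := by
  have := Real.log_two_gt_d9; linarith

theorem half_lt_log_of_two_le {x : ℝ} (hx : 2 ≤ x) : 1 / 2 < Real.log x :=
  half_lt_log_two.trans_le (Real.log_le_log (by norm_num) hx)

/-- Truncation at b = w√N / log N. The chance that some |ξᵢ| exceeds b is at most N b^(-q), which is
exactly the polynomial term with log^q N. Below b the variables ξ²/b² lie in [0, 1] and have mean of
order log² N / (w² N), so a Poisson-type bound gives a smaller probability. -/
theorem measureReal_sum_sq_gt_le_of_weak_moment {E : Type*} [MeasurableSpace E] {μ : Measure E}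
    [IsProbabilityMeasure μ] {ξ : E → ℝ} (hξm : Measurable ξ) {q : ℝ} (hq : 2 < q)
    (hξq : Integrable (fun e => |ξ e| ^ q) μ) (hξq1 : ∫ e, |ξ e| ^ q ∂μ ≤ 1)
    (hξ2 : Integrable (fun e => ξ e ^ 2) μ) (hξ21 : ∫ e, ξ e ^ 2 ∂μ ≤ 1)
    {N : ℕ} (hN : 2 ≤ N) {w : ℝ} (hw : 2 ≤ w) :
    (Measure.pi fun _ : Fin N => μ).real {ω | (1 + 3 * q) * (w ^ 2 * N) < ∑ i, ξ (ω i) ^ 2}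
      ≤ (1 + 2 ^ q) * Real.log N ^ q / (w ^ q * (N : ℝ) ^ (q / 2 - 1)) := by
  have hN' : (2 : ℝ) ≤ N := by exact_mod_cast hN
  have hN0 : (0 : ℝ) < N := by linarith
  have ht := half_lt_log_of_two_le hN'
  have ha := half_lt_log_of_two_le hw
  set t := Real.log N with htdef
  set a := Real.log w with hadef
  set b : ℝ := w * √N / t with hb
  have hb0 : 0 < b := by positivity
  have hb2 : b ^ 2 = w ^ 2 * N / t ^ 2 := by
    rw [hb, div_pow, mul_pow, Real.sq_sqrt hN0.le]
  set Z : E → ℝ := fun e => {e | |ξ e| ≤ b}.indicator (fun e => ξ e ^ 2 / b ^ 2) e with hZ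
  have hSm : MeasurableSet {e | |ξ e| ≤ b} := measurableSet_le hξm.abs measurable_const
  have hZm : Measurable Z := Measurable.indicator (by fun_prop) hSm
  have hZle : ∀ e, Z e ≤ ξ e ^ 2 / b ^ 2 := fun e =>
    Set.indicator_le_self' (fun _ _ => by positivity) e
  have hZI : ∀ e, Z e ∈ Set.Icc (0 : ℝ) 1 := fun e => by
    refine ⟨Set.indicator_nonneg (fun _ _ => by positivity) e, ?_⟩
    by_cases he : |ξ e| ≤ b
    · refine (hZle e).trans ?_
      rw [div_le_one (by positivity)]
      exact sq_le_sq' (by linarith [(abs_le.1 he).1]) (abs_le.1 he).2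
    · simp [hZ, Set.indicator, he]
  have hη : ∫ e, Z e ∂μ ≤ t ^ 2 / (w ^ 2 * N) := by
    calc ∫ e, Z e ∂μ ≤ ∫ e, ξ e ^ 2 / b ^ 2 ∂μ :=
          integral_mono (Integrable.of_mem_Icc 0 1 hZm.aemeasurable (.of_forall hZI))
            (hξ2.div_const _) hZle
      _ ≤ 1 / b ^ 2 := by rw [integral_div]; gcongr
      _ = _ := by rw [hb2, one_div_div]
  have hP1 := measureReal_pi_exists_le (N := N) (μ := μ) (S := {e | b < |ξ e|})
    (measurableSet_lt measurable_const hξm.abs)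
  have hP1' : μ.real {e | b < |ξ e|} ≤ 1 / b ^ q :=
    measureReal_abs_gt_le (by linarith) hb0 hξq hξq1
  -- The tilt 2 log w makes exp l = w², which cancels the w² in the bound on the mean and leaves
  -- log² N in the exponent.
  have hP2 := measureReal_sum_ge_le_of_mem_Icc (N := N) hZm hZI (l := 2 * a) (by linarith) hη
    ((1 + 3 * q) * t ^ 2)
  have hsub : {ω : Fin N → E | (1 + 3 * q) * (w ^ 2 * N) < ∑ i, ξ (ω i) ^ 2}
      ⊆ {ω | ∃ i, ω i ∈ {e | b < |ξ e|}} ∪ {ω | (1 + 3 * q) * t ^ 2 ≤ ∑ i, Z (ω i)} := by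
    intro ω hω
    by_cases hex : ∃ i, ω i ∈ {e | b < |ξ e|}
    · exact Or.inl hex
    · right
      push Not at hex
      have hZeq : ∀ i, Z (ω i) = ξ (ω i) ^ 2 / b ^ 2 := fun i =>
        Set.indicator_of_mem (s := {e | |ξ e| ≤ b}) (show |ξ (ω i)| ≤ b from not_lt.1 (hex i)) _
      simp only [Set.mem_ofPred_eq] at hω ⊢
      simp only [hZeq]
      rw [← Finset.sum_div, le_div_iff₀ (by positivity), hb2]
      calc (1 + 3 * q) * t ^ 2 * (w ^ 2 * N / t ^ 2) = (1 + 3 * q) * (w ^ 2 * N) := by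
            field_simp
        _ ≤ _ := hω.le
  refine (measureReal_mono hsub (measure_ne_top _ _)).trans
    ((measureReal_union_le _ _).trans ?_)
  have hw0 : 0 < w := by linarith
  have e1 : N * (1 / b ^ q) = t ^ q / (w ^ q * (N : ℝ) ^ (q / 2 - 1)) := by
    rw [hb, Real.div_rpow (by positivity) (by positivity), Real.mul_rpow (by positivity)
      (by positivity), Real.sqrt_eq_rpow, ← Real.rpow_mul hN0.le, Real.rpow_sub hN0,
      Real.rpow_one, show 1 / 2 * q = q / 2 by ring]
    field_simp
  have e2 : Real.exp (-(2 * a * ((1 + 3 * q) * t ^ 2)) + N * (t ^ 2 / (w ^ 2 * N)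
      * Real.exp (2 * a))) ≤ 2 ^ q * t ^ q / (w ^ q * (N : ℝ) ^ (q / 2 - 1)) := by
    have hexp : Real.exp (2 * a) = w ^ 2 := by
      rw [two_mul, Real.exp_add, hadef, Real.exp_log hw0]; ring
    rw [hexp, show N * (t ^ 2 / (w ^ 2 * N) * w ^ 2) = t ^ 2 by field_simp]
    -- Since log N ≥ 1/2, this factor is harmless; it puts the Chernoff term in the same form as the
    -- union bound term.
    have h1 : (1 : ℝ) ≤ 2 ^ q * t ^ q := by
      rw [← Real.mul_rpow (by norm_num) (by linarith)]
      exact Real.one_le_rpow (by linarith) (by linarith)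
    have h2 : Real.exp (-(2 * a * ((1 + 3 * q) * t ^ 2)) + t ^ 2)
        ≤ 1 / (w ^ q * (N : ℝ) ^ (q / 2 - 1)) := by
      rw [Real.rpow_def_of_pos hw0, Real.rpow_def_of_pos hN0, ← Real.exp_add, one_div,
        ← Real.exp_neg]
      apply Real.exp_le_exp.2
      rw [← htdef, ← hadef]
      have k1 : t ^ 2 ≤ 2 * a * t ^ 2 := by nlinarith [sq_nonneg t]
      have k0 : 1 / 4 ≤ t ^ 2 := by nlinarith
      have k2 : a / 4 ≤ a * t ^ 2 := by nlinarith
      have k3 : t / 4 ≤ a * t ^ 2 := by nlinarith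
      have k4 : q * (a / 4) ≤ q * (a * t ^ 2) := by gcongr
      have k5 : q * (t / 4) ≤ q * (a * t ^ 2) := by gcongr
      linarith
    refine h2.trans ?_
    gcongr
  calc _ ≤ N * (1 / b ^ q) + 2 ^ q * t ^ q / (w ^ q * (N : ℝ) ^ (q / 2 - 1)) :=
        add_le_add (hP1.trans (by gcongr)) (hP2.trans e2)
    _ = _ := by rw [e1]; ring

theorem self_pow_le_exp_mul_factorial (n : ℕ) : (n : ℝ) ^ n ≤ Real.exp n * n ! := by
  have := Real.pow_div_factorial_le_exp (n : ℝ) (by positivity) n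
  rwa [div_le_iff₀ (by positivity)] at this

/-- Extends the moment bounds to orders between 0 and 2, where the hypothesis says nothing: |x|^(2t)
≤ 1 + x², with integral at most 3. The shape of the bound lets both ranges be summed together. -/
theorem SubgaussianMoments.integrable_rpow_and_le {E : Type*} [MeasurableSpace E] {μ : Measure E}
    [IsProbabilityMeasure μ] {x : E → ℝ} (hxm : Measurable x) {p : ℝ} (hp : 1 ≤ p)
    (hx : SubgaussianMoments μ x (2 * p)) {t : ℝ} (ht0 : 0 ≤ t) (ht : t ≤ p) :
    Integrable (fun e => |x e| ^ (2 * t)) μ ∧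
      ∫ e, |x e| ^ (2 * t) ∂μ ≤ 3 * (2 * t + 2) ^ t := by
  rcases le_or_gt 1 t with h1 | h1
  · obtain ⟨hi, hb⟩ := hx (2 * t) (by linarith) (by linarith)
    refine ⟨hi, hb.trans ?_⟩
    rw [show 2 * t / 2 = t by ring]
    have : (2 * t) ^ t ≤ (2 * t + 2) ^ t := Real.rpow_le_rpow (by linarith) (by linarith) ht0
    have h0 : 0 ≤ (2 * t + 2) ^ t := by positivity
    linarith
  · obtain ⟨hi, hb⟩ := hx 2 le_rfl (by linarith)
    norm_num at hb hi
    have hle : ∀ e, |x e| ^ (2 * t) ≤ 1 + x e ^ 2 := fun e => by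
      rcases le_or_gt |x e| 1 with h | h
      · have := Real.rpow_le_one (abs_nonneg (x e)) h (by linarith : 0 ≤ 2 * t)
        nlinarith [sq_nonneg (x e)]
      · have := Real.rpow_le_rpow_of_exponent_le h.le (by linarith : 2 * t ≤ 2)
        rw [Real.rpow_ofNat, sq_abs] at this
        linarith
    have hi2 : Integrable (fun e => 1 + x e ^ 2) μ := (integrable_const _).add hi
    have hi' : Integrable (fun e => |x e| ^ (2 * t)) μ :=
      hi2.mono' (hxm.abs.pow_const _).aestronglyMeasurable (.of_forall fun e => by
        rw [Real.norm_of_nonneg (by positivity)]; exact hle e)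
    refine ⟨hi', (integral_mono hi' hi2 hle).trans ?_⟩
    rw [integral_add (integrable_const _) hi]
    have h3 : 1 ≤ (2 * t + 2) ^ t := Real.one_le_rpow (by linarith) ht0
    simp
    linarith

/-- The decay u^(-2p) for real p needs the full moment of order 2p, and truncating the series at n =
⌊p⌋ alone would lose the fractional part f = p - n. The extra factor 1 + y^f recovers it. It is
submultiplicative because y ↦ y^f is subadditive for f ≤ 1. -/
theorem measureReal_sum_sq_ge_le {E : Type*} [MeasurableSpace E] {μ : Measure E}
    [IsProbabilityMeasure μ] {x : E → ℝ} (hxm : Measurable x) {p : ℝ} (hp : 1 ≤ p)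
    (hx : SubgaussianMoments μ x (2 * p)) {N : ℕ} (hN : (N : ℝ) ≤ p) {u : ℝ} (hu : 0 < u) :
    (Measure.pi fun _ : Fin N => μ).real
        {ω | 8 * Real.exp 9 * (u ^ 2 * p) ≤ ∑ i, x (ω i) ^ 2}
      ≤ Real.exp (-(2 * p)) / u ^ (2 * p) := by
  have hp0 : 0 < p := by linarith
  set n := ⌊p⌋₊ with hn
  have hnp : (n : ℝ) ≤ p := Nat.floor_le hp0.le
  have hpn : p < n + 1 := Nat.lt_floor_add_one p
  set f := p - n with hf
  have hf0 : 0 ≤ f := by linarith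
  have hf1 : f ≤ 1 := by linarith
  -- The moments of order 2l and 2(l + f) are bounded by a constant times (4e)^l l!, so this scaling
  -- turns the series into a geometric one of ratio 1/2.
  set c : ℝ := 1 / (8 * Real.exp 1) with hc
  have hc0 : 0 < c := by positivity
  have hc1 : c ≤ 1 := by
    rw [hc, div_le_one (by positivity)]; linarith [Real.add_one_le_exp (1 : ℝ)]
  set g : E → ℝ := fun e =>
    ∑ l ∈ Finset.range (n + 1), (|x e| ^ (2 * (l : ℝ)) + |x e| ^ (2 * (l + f))) * (c ^ l / l !)
    with hg
  have hl : ∀ l ∈ Finset.range (n + 1), (l : ℝ) ≤ n := fun l h => by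
    exact_mod_cast Nat.lt_succ_iff.1 (Finset.mem_range.1 h)
  have hm1 : ∀ l ∈ Finset.range (n + 1), _ := fun l h =>
    hx.integrable_rpow_and_le hxm hp (t := (l : ℝ)) (by positivity) ((hl l h).trans hnp)
  have hm2 : ∀ l ∈ Finset.range (n + 1), _ := fun l h =>
    hx.integrable_rpow_and_le hxm hp (t := (l : ℝ) + f) (by positivity) (by linarith [hl l h])
  have hgi : Integrable g μ := integrable_finsetSum _ fun l h =>
    ((hm1 l h).1.add (hm2 l h).1).mul_const _
  have hgb : ∫ e, g e ∂μ ≤ Real.exp 6 := by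
    have hgi' : ∀ l ∈ Finset.range (n + 1), Integrable (fun e =>
        (|x e| ^ (2 * (l : ℝ)) + |x e| ^ (2 * (l + f))) * (c ^ l / l !)) μ :=
      fun l h => ((hm1 l h).1.add (hm2 l h).1).mul_const _
    simp only [hg]
    rw [integral_finsetSum _ hgi']
    have hterm : ∀ l ∈ Finset.range (n + 1),
        ∫ e, (|x e| ^ (2 * (l : ℝ)) + |x e| ^ (2 * (l + f))) * (c ^ l / l !) ∂μ
          ≤ 12 * Real.exp 2 * (1 / 2) ^ l := fun l h => by
      rw [integral_mul_const, integral_add (hm1 l h).1 (hm2 l h).1]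
      have b1 : (3 : ℝ) * (2 * l + 2) ^ (l : ℝ) ≤ 3 * (2 * l + 4) ^ (l + 1) := by
        rw [Real.rpow_natCast]
        have : ((2 : ℝ) * l + 2) ^ l ≤ (2 * l + 4) ^ l := by gcongr; norm_num
        have h4 : ((2 : ℝ) * l + 4) ^ l ≤ (2 * l + 4) ^ (l + 1) :=
          pow_le_pow_right₀ (by linarith [(Nat.cast_nonneg l : (0 : ℝ) ≤ l)]) (Nat.le_succ l)
        linarith
      have b2 : (3 : ℝ) * (2 * (l + f) + 2) ^ ((l : ℝ) + f) ≤ 3 * (2 * l + 4) ^ (l + 1) := by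
        have h5 : (2 * ((l : ℝ) + f) + 2) ^ ((l : ℝ) + f) ≤ (2 * l + 4) ^ ((l : ℝ) + f) :=
          Real.rpow_le_rpow (by positivity) (by linarith) (by positivity)
        have h6 : ((2 : ℝ) * l + 4) ^ ((l : ℝ) + f) ≤ (2 * l + 4) ^ (((l + 1 : ℕ) : ℝ)) :=
          Real.rpow_le_rpow_of_exponent_le
            (by linarith [(Nat.cast_nonneg l : (0 : ℝ) ≤ l)]) (by push_cast; linarith)
        rw [Real.rpow_natCast] at h6
        linarith
      have b3 : ((2 : ℝ) * l + 4) ^ (l + 1) ≤ 2 * 4 ^ l * Real.exp (l + 2) * l ! := by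
        have h7 := self_pow_le_exp_mul_factorial (l + 2)
        push_cast at h7
        have h8 : ((l : ℝ) + 2) ^ (l + 1) ≤ Real.exp (l + 2) * ((l + 1) * l !) := by
          have : ((l + 2) ! : ℝ) = (l + 2) * ((l + 1) * l !) := by
            rw [Nat.factorial_succ, Nat.factorial_succ]; push_cast; ring
          rw [this, show l + 2 = (l + 1) + 1 from rfl, pow_succ] at h7
          have h9 : (0 : ℝ) < l + 2 := by positivity
          nlinarith
        have h10 : ((l : ℝ) + 1) ≤ 2 ^ l := by exact_mod_cast Nat.lt_two_pow_self (n := l)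
        calc ((2 : ℝ) * l + 4) ^ (l + 1) = 2 ^ (l + 1) * ((l : ℝ) + 2) ^ (l + 1) := by
              rw [← mul_pow]; ring
          _ ≤ 2 ^ (l + 1) * (Real.exp (l + 2) * (2 ^ l * l !)) := by
              gcongr
              refine h8.trans ?_
              gcongr
          _ = _ := by rw [show (4 : ℝ) = 2 * 2 by norm_num, mul_pow]; ring
      have hcl : c ^ l = (1 / 8) ^ l * Real.exp (-l) := by
        rw [hc, one_div, mul_inv, mul_pow, ← Real.exp_neg, ← Real.exp_nat_mul]
        congr 2 <;> norm_num
      have : (∫ e, |x e| ^ (2 * (l : ℝ)) ∂μ) + ∫ e, |x e| ^ (2 * ((l : ℝ) + f)) ∂μ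
          ≤ 6 * (2 * 4 ^ l * Real.exp (l + 2) * l !) := by
        linarith [(hm1 l h).2, (hm2 l h).2]
      calc _ ≤ 6 * (2 * 4 ^ l * Real.exp (l + 2) * l !) * (c ^ l / l !) := by gcongr
        _ = 12 * (4 ^ l * (1 / 8) ^ l) * (Real.exp (l + 2) * Real.exp (-l)) := by
            rw [hcl]; field_simp; ring
        _ = _ := by
            rw [← mul_pow, ← Real.exp_add]; norm_num; ring
    refine (Finset.sum_le_sum hterm).trans ?_
    rw [← Finset.mul_sum]
    have hgeo : ∑ l ∈ Finset.range (n + 1), (1 / 2 : ℝ) ^ l ≤ 2 := by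
      exact sum_geometric_two_le (n + 1)
    have h24 : (24 : ℝ) ≤ Real.exp 4 := by
      have := Real.add_one_le_exp (1 : ℝ)
      have h2 : Real.exp 4 = Real.exp 1 ^ 4 := by rw [← Real.exp_nat_mul]; norm_num
      have h3 : (2.7 : ℝ) ≤ Real.exp 1 := by linarith [Real.exp_one_gt_d9]
      rw [h2]
      calc (24 : ℝ) ≤ 2.7 ^ 4 := by norm_num
        _ ≤ _ := by gcongr
    calc 12 * Real.exp 2 * ∑ l ∈ Finset.range (n + 1), (1 / 2 : ℝ) ^ l
        ≤ 12 * Real.exp 2 * 2 := by gcongr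
      _ = 24 * Real.exp 2 := by ring
      _ ≤ Real.exp 4 * Real.exp 2 := by gcongr
      _ = _ := by rw [← Real.exp_add]; norm_num
  have hg0 : ∀ e, 0 ≤ g e := fun e => Finset.sum_nonneg fun l _ => by positivity
  have hGg : ∀ e, expPoly n (c * x e ^ 2) * (1 + (c * x e ^ 2) ^ f) ≤ g e := fun e => by
    simp only [hg, expPoly]
    rw [Finset.sum_mul]
    refine Finset.sum_le_sum fun l _ => ?_
    have h1 : |x e| ^ (2 * (l : ℝ)) = (x e ^ 2) ^ l := by
      rw [Real.rpow_mul (abs_nonneg _), Real.rpow_ofNat, sq_abs, Real.rpow_natCast]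
    have h2 : |x e| ^ (2 * ((l : ℝ) + f)) = (x e ^ 2) ^ l * (x e ^ 2) ^ f := by
      rw [Real.rpow_mul (abs_nonneg _), Real.rpow_ofNat, sq_abs,
        Real.rpow_add_of_nonneg (sq_nonneg _) (by positivity) hf0, Real.rpow_natCast]
    rw [h1, h2, mul_pow, Real.mul_rpow hc0.le (sq_nonneg _)]
    have hcf : c ^ f ≤ 1 := Real.rpow_le_one hc0.le hc1 hf0
    have h3 : 0 ≤ (x e ^ 2) ^ f := by positivity
    have h4 : c ^ f * (x e ^ 2) ^ f ≤ (x e ^ 2) ^ f := mul_le_of_le_one_left h3 hcf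
    calc c ^ l * (x e ^ 2) ^ l / l ! * (1 + c ^ f * (x e ^ 2) ^ f)
        ≤ c ^ l * (x e ^ 2) ^ l / l ! * (1 + (x e ^ 2) ^ f) := by gcongr
      _ = _ := by ring
  set s : ℝ := 8 * Real.exp 9 * (u ^ 2 * p) with hs
  have hs0 : 0 < s := by positivity
  have hcs : c * s = Real.exp 8 * (u ^ 2 * p) := by
    rw [hc, hs, show (9 : ℝ) = 1 + 8 by norm_num, Real.exp_add]; field_simp
  have hprod := measureReal_pi_le_of_le_prod (N := N) hg0 hgi (a := (c * s) ^ p / n !)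
    (by positivity) (S := {ω | s ≤ ∑ i, x (ω i) ^ 2}) (fun ω hω => by
      have hω' : c * s ≤ ∑ i, c * x (ω i) ^ 2 := by
        rw [← Finset.mul_sum]; exact mul_le_mul_of_nonneg_left hω hc0.le
      have hp' : p = n + f := by rw [hf]; ring
      set y := ∑ i, c * x (ω i) ^ 2 with hy
      have hy0 : 0 ≤ y := le_trans (by positivity) hω'
      -- The value at 0 is set to 1 by hand: when f = 0, the convention 0 ^ 0 = 1 would make 1 + y^f
      -- equal to 2 there, violating G 0 ≤ 1.
      have hsubm := le_prod_of_submultiplicative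
        (G := fun y => expPoly n y * (if y = 0 then 1 else (1 + y ^ f)))
        (fun y hy => mul_nonneg (expPoly_nonneg n hy) (by split_ifs <;> positivity))
        (by simp [expPoly_zero])
        (fun y z hy hz => by
          have h1 := expPoly_add_le n hy hz
          have h2 : (if y + z = 0 then (1 : ℝ) else 1 + (y + z) ^ f)
              ≤ (if y = 0 then 1 else 1 + y ^ f) * (if z = 0 then 1 else 1 + z ^ f) := by
            have h3 := Real.rpow_add_le_add_rpow hy hz hf0 hf1
            rcases hy.eq_or_lt with rfl | hy'
            · simp
            rcases hz.eq_or_lt with rfl | hz'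
            · simp
            rw [if_neg (by positivity), if_neg (by positivity), if_neg (by positivity)]
            nlinarith [Real.rpow_nonneg hy f, Real.rpow_nonneg hz f,
              mul_nonneg (Real.rpow_nonneg hy f) (Real.rpow_nonneg hz f)]
          calc _ ≤ (expPoly n y * expPoly n z) * _ :=
                mul_le_mul h1 h2 (by split_ifs <;> positivity)
                  (mul_nonneg (expPoly_nonneg n hy) (expPoly_nonneg n hz))
            _ = _ := by ring)
        Finset.univ (fun i => c * x (ω i) ^ 2) (fun i => by positivity)
      have hy1 : 0 < y := lt_of_lt_of_le (by positivity) hω'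
      calc (c * s) ^ p / n ! ≤ y ^ p / n ! := by gcongr
        _ = (y ^ n / n !) * y ^ f := by
            rw [hp', Real.rpow_add hy1, Real.rpow_natCast]; ring
        _ ≤ expPoly n y * (1 + y ^ f) := by
            gcongr
            · exact expPoly_nonneg n hy0
            · exact pow_div_factorial_le_expPoly n hy0
            · linarith
        _ = expPoly n y * (if y = 0 then 1 else (1 + y ^ f)) := by rw [if_neg hy1.ne']
        _ ≤ _ := hsubm
        _ ≤ ∏ i, g (ω i) := by
            refine Finset.prod_le_prod (fun i _ => mul_nonneg (expPoly_nonneg n (by positivity))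
              (by split_ifs <;> positivity)) fun i _ => le_trans ?_ (hGg (ω i))
            refine mul_le_mul_of_nonneg_left ?_ (expPoly_nonneg n (by positivity))
            split_ifs
            · simp only [le_add_iff_nonneg_right]; positivity
            · rfl)
  refine hprod.trans ?_
  have hfac : (n ! : ℝ) ≤ p ^ p := by
    calc (n ! : ℝ) ≤ (n : ℝ) ^ n := by exact_mod_cast Nat.factorial_le_pow n
      _ ≤ p ^ n := pow_le_pow_left₀ (by positivity) hnp n
      _ = p ^ (n : ℝ) := (Real.rpow_natCast _ _).symm
      _ ≤ p ^ p := Real.rpow_le_rpow_of_exponent_le hp hnp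
  have hpow : (∫ e, g e ∂μ) ^ N ≤ Real.exp (6 * p) := by
    calc (∫ e, g e ∂μ) ^ N ≤ Real.exp 6 ^ N := by
          gcongr
      _ = Real.exp (6 * N) := by rw [← Real.exp_nat_mul, mul_comm]
      _ ≤ _ := Real.exp_le_exp.2 (by linarith)
  have hcsp : (c * s) ^ p = Real.exp (8 * p) * u ^ (2 * p) * p ^ p := by
    rw [hcs, Real.mul_rpow (by positivity) (by positivity), Real.mul_rpow (by positivity) hp0.le,
      Real.rpow_mul hu.le, Real.rpow_ofNat, ← Real.exp_mul]; ring
  rw [hcsp]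
  calc (∫ e, g e ∂μ) ^ N / (Real.exp (8 * p) * u ^ (2 * p) * p ^ p / n !)
      ≤ Real.exp (6 * p) / (Real.exp (8 * p) * u ^ (2 * p) * p ^ p / p ^ p) := by gcongr
    _ = Real.exp (6 * p) / Real.exp (8 * p) / u ^ (2 * p) := by field_simp
    _ = _ := by rw [← Real.exp_sub]; congr 2; ring

/-- Markov's inequality at order 2L: the threshold is e times the moment bound √(2L), hence the
factor e^(-2L). -/
theorem SubgaussianMoments.measureReal_gt_le {E : Type*} [MeasurableSpace E] {μ : Measure E}
    [IsProbabilityMeasure μ] {x : E → ℝ} {p₀ L : ℝ} (hx : SubgaussianMoments μ x p₀)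
    (hL1 : 1 ≤ L) (hL : 2 * L ≤ p₀) :
    μ.real {e | Real.exp 1 * √(2 * L) < |x e|} ≤ Real.exp (-(2 * L)) := by
  obtain ⟨hi, hb⟩ := hx (2 * L) (by linarith) hL
  refine (measureReal_abs_gt_le (by linarith) (by positivity) hi hb).trans_eq ?_
  have h2 : √(2 * L) ^ (2 * L) = (2 * L) ^ (2 * L / 2) := by
    rw [Real.sqrt_eq_rpow, ← Real.rpow_mul (by linarith)]; congr 1; ring
  have h0 : 0 < (2 * L) ^ (2 * L / 2) := by positivity
  rw [Real.mul_rpow (x := Real.exp 1) (by positivity) (by positivity), h2, ← Real.exp_mul, one_mul, Real.exp_neg]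
  field_simp

theorem SubgaussianMoments.integrable_pow_and_le {E : Type*} [MeasurableSpace E] {μ : Measure E}
    {x : E → ℝ} {p₀ : ℝ} (hx : SubgaussianMoments μ x p₀) {k : ℕ} (hk : 1 ≤ k)
    (hkp : 2 * (k : ℝ) ≤ p₀) :
    Integrable (fun e => x e ^ (2 * k)) μ ∧ ∫ e, x e ^ (2 * k) ∂μ ≤ (2 * (k : ℝ)) ^ k := by
  have hk' : (1 : ℝ) ≤ k := by exact_mod_cast hk
  have h := hx (2 * k) (by linarith) hkp
  have e1 : ∀ e, |x e| ^ (2 * (k : ℝ)) = x e ^ (2 * k) := fun e => by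
    rw [show (2 * (k : ℝ)) = ((2 * k : ℕ) : ℝ) by push_cast; ring, Real.rpow_natCast,
      pow_mul, sq_abs, pow_mul]
  simp only [e1] at h
  rwa [show 2 * (k : ℝ) / 2 = k by ring, Real.rpow_natCast] at h

theorem memLp_two_indicator {E : Type*} [MeasurableSpace E] {μ : Measure E} {f : E → ℝ}
    (hfm : Measurable f) (hf : Integrable (fun e => f e ^ 2) μ) {S : Set E}
    (hS : MeasurableSet S) : MemLp (S.indicator f) 2 μ :=
  ((memLp_two_iff_integrable_sq hfm.aestronglyMeasurable).2 hf).indicator hS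

/-- `∫_S f² ≤ √(∫ f⁴) √(P S)`. -/
theorem setIntegral_le_sqrt_mul_sqrt {E : Type*} [MeasurableSpace E] {μ : Measure E}
    [IsFiniteMeasure μ] {f : E → ℝ} (hfm : Measurable f) (hf : Integrable (fun e => f e ^ 2) μ)
    {S : Set E} (hS : MeasurableSet S) :
    ∫ e, S.indicator (fun e => |f e|) e ∂μ ≤ √(∫ e, f e ^ 2 ∂μ) * √(μ.real S) := by
  have h := integral_mul_sq_le (μ := μ) (f := f) (g := S.indicator fun _ => (1 : ℝ))
    ((memLp_two_iff_integrable_sq hfm.aestronglyMeasurable).2 hf)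
    (memLp_two_indicator measurable_const (by simp) hS)
  have e1 : ∀ e, |f e * S.indicator (fun _ => (1 : ℝ)) e| = S.indicator (fun e => |f e|) e :=
    fun e => by by_cases he : e ∈ S <;> simp [he]
  have e2 : ∀ e, S.indicator (fun _ => (1 : ℝ)) e ^ 2 = S.indicator 1 e :=
    fun e => by by_cases he : e ∈ S <;> simp [he]
  simp only [e1, e2, integral_indicator_one hS] at h
  exact h

/-- The terms of positive degree in the series live on the rare set A. The Cauchy–Schwarz inequality
against √(μ A) ≤ e^(-L) makes the expected series at most 1 + e^(-L), and N e^(-L) ≤ p keeps the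
N-fold product below e^p. -/
theorem SubgaussianMoments.measureReal_sum_sq_tail_ge_le {E : Type*} [MeasurableSpace E]
    {μ : Measure E} [IsProbabilityMeasure μ] {x : E → ℝ} (hxm : Measurable x) {p L u : ℝ}
    (hp : 8 ≤ p) (hx : SubgaussianMoments μ x (2 * p)) (hL1 : 1 ≤ L) (hLp : L ≤ p) {N : ℕ}
    (hN : p = N * Real.exp (1 - L)) (hu : 1 ≤ u) :
    (Measure.pi fun _ : Fin N => μ).real
        {ω | 4 * Real.exp 17 * (u ^ 2 * p) ≤
          ∑ i, {e | Real.exp 1 * √(2 * L) < |x e|}.indicator (fun e => x e ^ 2) (ω i)}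
      ≤ Real.exp (-(3 * p)) / u ^ (p / 2) := by
  have hp0 : 0 < p := by linarith
  set A := {e | Real.exp 1 * √(2 * L) < |x e|} with hA
  have hAm : MeasurableSet A := measurableSet_lt measurable_const hxm.abs
  have hPA : μ.real A ≤ Real.exp (-(2 * L)) := hx.measureReal_gt_le hL1 (by linarith)
  -- Cauchy–Schwarz doubles the order of the moments, so only degrees up to p/2 are within the
  -- available order 2p.
  set n := ⌊p / 2⌋₊ with hn
  have hnp : (n : ℝ) ≤ p / 2 := Nat.floor_le (by linarith)
  have hpn : p / 4 ≤ n := by linarith [Nat.lt_floor_add_one (p / 2)]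
  set c : ℝ := 1 / (8 * Real.exp 1) with hc
  have hc0 : 0 < c := by positivity
  set Z : E → ℝ := fun e => c * A.indicator (fun e => x e ^ 2) e with hZ
  have hZ0 : ∀ e, 0 ≤ Z e := fun e =>
    mul_nonneg hc0.le (Set.indicator_nonneg (fun _ _ => sq_nonneg _) e)
  have hexp : ∀ e, expPoly n (Z e) = 1 + ∑ l ∈ Finset.range n,
      A.indicator (fun e => |x e ^ (2 * (l + 1))|) e * (c ^ (l + 1) / (l + 1) !) := fun e => by
    rw [expPoly, Finset.sum_range_succ', add_comm]
    simp only [pow_zero, Nat.factorial_zero, Nat.cast_one, div_one]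
    congr 1
    refine Finset.sum_congr rfl fun l _ => ?_
    by_cases he : e ∈ A
    · simp only [hZ, he, Set.indicator_of_mem]
      rw [abs_of_nonneg (by rw [pow_mul]; positivity), mul_pow, ← pow_mul]; ring
    · simp [hZ, he]
  have hmom : ∀ l ∈ Finset.range n, Integrable (fun e => x e ^ (2 * (l + 1))) μ ∧
      Integrable (fun e => (x e ^ (2 * (l + 1))) ^ 2) μ ∧
      ∫ e, (x e ^ (2 * (l + 1))) ^ 2 ∂μ ≤ ((4 * ((l : ℝ) + 1)) ^ (l + 1)) ^ 2 := fun l hl => by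
    have hl' : ((l : ℝ) + 1) ≤ n := by exact_mod_cast Finset.mem_range.1 hl
    have h1 := hx.integrable_pow_and_le (k := l + 1) (by omega) (by push_cast; linarith)
    have h2 := hx.integrable_pow_and_le (k := 2 * (l + 1)) (by omega) (by push_cast; linarith)
    have e1 : ∀ e, (x e ^ (2 * (l + 1))) ^ 2 = x e ^ (2 * (2 * (l + 1))) := fun e => by
      rw [← pow_mul]; congr 1; ring
    refine ⟨h1.1, by simpa only [e1] using h2.1, ?_⟩
    simp only [e1]
    refine h2.2.trans_eq ?_
    rw [← pow_mul]; push_cast; ring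
  have hti : ∀ l ∈ Finset.range n, Integrable (fun e =>
      A.indicator (fun e => |x e ^ (2 * (l + 1))|) e * (c ^ (l + 1) / (l + 1) !)) μ :=
    fun l hl => ((hmom l hl).1.abs.indicator hAm).mul_const _
  have hint : Integrable (fun e => expPoly n (Z e)) μ := by
    simp only [hexp]
    exact (integrable_const _).add (integrable_finsetSum _ hti)
  have hτ : ∫ e, expPoly n (Z e) ∂μ ≤ 1 + Real.exp (-L) := by
    simp only [hexp]
    rw [integral_add (integrable_const _) (integrable_finsetSum _ hti),
      integral_finsetSum _ hti]
    have hterm : ∀ l ∈ Finset.range n, ∫ e,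
        A.indicator (fun e => |x e ^ (2 * (l + 1))|) e * (c ^ (l + 1) / (l + 1) !) ∂μ
          ≤ Real.exp (-L) * (1 / 2 * (1 / 2) ^ l) := fun l hl => by
      obtain ⟨h1, h2, h3⟩ := hmom l hl
      rw [integral_mul_const]
      have h4 := setIntegral_le_sqrt_mul_sqrt (hxm.pow_const (2 * (l + 1))) h2 hAm
      have h5 : √(∫ e, (x e ^ (2 * (l + 1))) ^ 2 ∂μ) ≤ (4 * ((l : ℝ) + 1)) ^ (l + 1) :=
        Real.sqrt_le_iff.2 ⟨by positivity, h3⟩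
      have h6 : √(μ.real A) ≤ Real.exp (-L) :=
        Real.sqrt_le_iff.2 ⟨by positivity, hPA.trans_eq (by rw [sq, ← Real.exp_add]; ring_nf)⟩
      have h7 := self_pow_le_exp_mul_factorial (l + 1)
      have hfac : (0 : ℝ) < (l + 1) ! := by positivity
      calc _ ≤ ((4 * ((l : ℝ) + 1)) ^ (l + 1) * Real.exp (-L)) * (c ^ (l + 1) / (l + 1) !) := by
            gcongr
            exact h4.trans (by gcongr)
        _ = Real.exp (-L) * (4 * c) ^ (l + 1) * ((((l + 1 : ℕ) : ℝ)) ^ (l + 1) / (l + 1) !) := by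
            rw [mul_pow, mul_pow]; push_cast; ring
        _ ≤ Real.exp (-L) * (4 * c) ^ (l + 1) * Real.exp ((l + 1 : ℕ) : ℝ) := by
            gcongr
            rw [div_le_iff₀ hfac]; exact h7
        _ = Real.exp (-L) * (4 * c * Real.exp 1) ^ (l + 1) := by
            rw [mul_pow (4 * c), ← Real.exp_nat_mul, mul_one]; ring
        _ = _ := by
            rw [show 4 * c * Real.exp 1 = 1 / 2 by rw [hc]; field_simp; norm_num, pow_succ]; ring
    have hgeo := sum_geometric_two_le n
    have := Finset.sum_le_sum hterm
    rw [← Finset.mul_sum, ← Finset.mul_sum] at this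
    have h8 : Real.exp (-L) * (1 / 2 * ∑ l ∈ Finset.range n, (1 / 2 : ℝ) ^ l)
        ≤ Real.exp (-L) * 1 := by gcongr; linarith
    simp only [integral_const, probReal_univ, smul_eq_mul, mul_one]
    linarith
  set s : ℝ := 4 * Real.exp 17 * (u ^ 2 * p) with hs
  have hu0 : 0 < u := by linarith
  have hs0 : 0 < s := by positivity
  have hcs : c * s = Real.exp 16 * (u ^ 2 * (p / 2)) := by
    rw [hc, hs, show (17 : ℝ) = 1 + 16 by norm_num, Real.exp_add]; field_simp; norm_num
  have h := measureReal_sum_ge_le_of_expPoly (N := N) hZ0 hint hτ (s := c * s) (by positivity)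
  have hset : {ω : Fin N → E | c * s ≤ ∑ i, Z (ω i)}
      = {ω | s ≤ ∑ i, A.indicator (fun e => x e ^ 2) (ω i)} := by
    ext ω
    simp only [hZ, Set.mem_ofPred_eq, ← Finset.mul_sum]
    exact mul_le_mul_iff_right₀ hc0
  rw [hset] at h
  refine h.trans ?_
  have hNL : N * Real.exp (-L) ≤ p := by
    rw [hN]; gcongr; linarith
  have hfac : (n ! : ℝ) ≤ (p / 2) ^ n := by
    calc (n ! : ℝ) ≤ (n : ℝ) ^ n := by exact_mod_cast Nat.factorial_le_pow n
      _ ≤ (p / 2) ^ n := pow_le_pow_left₀ (by positivity) hnp n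
  have hup : u ^ (p / 2) ≤ (u ^ 2) ^ n := by
    rw [← pow_mul, ← Real.rpow_natCast]
    exact Real.rpow_le_rpow_of_exponent_le hu (by push_cast; linarith)
  have hep : Real.exp (4 * p) ≤ Real.exp 16 ^ n := by
    rw [← Real.exp_nat_mul]; exact Real.exp_le_exp.2 (by linarith)
  calc Real.exp (N * Real.exp (-L)) * (n ! / (c * s) ^ n)
      ≤ Real.exp p * ((p / 2) ^ n / (c * s) ^ n) := by gcongr
    _ = Real.exp p / (Real.exp 16 ^ n * (u ^ 2) ^ n) := by
        rw [hcs, mul_pow, mul_pow]; field_simp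
    _ ≤ Real.exp p / (Real.exp (4 * p) * u ^ (p / 2)) := by gcongr
    _ = Real.exp p / Real.exp (4 * p) / u ^ (p / 2) := by field_simp
    _ = _ := by rw [← Real.exp_sub]; congr 2; ring

/-- The number of large values of a variable with a finite `q`-th moment. -/
theorem measureReal_card_large_ge_le {E : Type*} [MeasurableSpace E] {μ : Measure E}
    [IsProbabilityMeasure μ] {ξ : E → ℝ} (hξm : Measurable ξ) {q : ℝ} (hq : 2 < q)
    (hξq : Integrable (fun e => |ξ e| ^ q) μ) (hξq1 : ∫ e, |ξ e| ^ q ∂μ ≤ 1)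
    {p L u : ℝ} (hL1 : 1 ≤ L) {N : ℕ} (hN : p = N * Real.exp (1 - L)) (hu : 1 ≤ u) :
    (Measure.pi fun _ : Fin N => μ).real
        {ω | 8 / (q - 2) * (p / L) ≤ ∑ i,
          {e | u ^ (1 / 2 : ℝ) * Real.exp ((1 / 4 + 1 / (2 * q)) * L) < |ξ e|}.indicator
            (fun _ => (1 : ℝ)) (ω i)}
      ≤ Real.exp (-p) / u ^ (p / L) := by
  have hu0 : 0 < u := by linarith
  have hq0 : 0 < q := by linarith
  have hp0 : 0 ≤ p := by rw [hN]; positivity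
  set a := Real.log u with ha
  have ha0 : 0 ≤ a := Real.log_nonneg hu
  set B := u ^ (1 / 2 : ℝ) * Real.exp ((1 / 4 + 1 / (2 * q)) * L) with hB
  have hB0 : 0 < B := by positivity
  set S := {e | B < |ξ e|} with hS
  have hSm : MeasurableSet S := measurableSet_lt measurable_const hξm.abs
  have hBq : B ^ q = Real.exp ((q / 2) * a + (q / 4 + 1 / 2) * L) := by
    rw [hB, Real.rpow_def_of_pos hu0, ← Real.exp_add, ← Real.exp_mul, ← ha]
    congr 1; field_simp
  have hPS : μ.real S ≤ Real.exp (-((q / 2) * a + (q / 4 + 1 / 2) * L)) := by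
    refine (measureReal_abs_gt_le (by linarith) hB0 hξq hξq1).trans_eq ?_
    rw [hBq, Real.exp_neg, one_div]
  have h := measureReal_sum_ge_le_of_mem_Icc (N := N) (Z := S.indicator fun _ => (1 : ℝ))
    (measurable_const.indicator hSm)
    (fun e => by by_cases he : e ∈ S <;> simp [he])
    -- The tilt leaves N η e^l = N e^(-L) ≤ p, while l times the threshold exceeds 2p by at least p
    -- log u / L.
    (l := (q / 4 - 1 / 2) * L + (q / 2) * a) (by nlinarith [mul_nonneg hq0.le ha0])
    (η := Real.exp (-((q / 2) * a + (q / 4 + 1 / 2) * L)))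
    (by
      rw [integral_indicator hSm]
      simpa using hPS) (8 / (q - 2) * (p / L))
  refine h.trans ?_
  rw [Real.rpow_def_of_pos hu0, ← Real.exp_sub, ← Real.exp_add, ← ha]
  apply Real.exp_le_exp.2
  have e1 : N * Real.exp (-((q / 2) * a + (q / 4 + 1 / 2) * L)
      + ((q / 4 - 1 / 2) * L + (q / 2) * a)) ≤ p := by
    rw [hN]; gcongr; linarith
  have hq2 : 0 < q - 2 := by linarith
  have e2 : ((q / 4 - 1 / 2) * L + (q / 2) * a) * (8 / (q - 2) * (p / L))
      = 2 * p + (4 * q / (q - 2)) * (a * (p / L)) := by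
    field_simp; ring
  have e3 : 1 ≤ 4 * q / (q - 2) := by rw [le_div_iff₀ hq2]; linarith
  have e4 : 0 ≤ a * (p / L) := by positivity
  rw [e2]
  nlinarith

/-! ### The multiplier process -/

/-- As ξx is centred, the truncated mean is minus the integral over the removed set. On {|x| > A},
two uses of the Cauchy–Schwarz inequality bound the contribution by 2 e^(-L/2); on {|ξ| > B}, the
second moment of ξx and the small probability give √V e^(-L/2). -/
theorem abs_integral_truncated_mul_le {E : Type*} [MeasurableSpace E] {μ : Measure E}
    [IsProbabilityMeasure μ] {ξ x : E → ℝ} (hξm : Measurable ξ) (hxm : Measurable x)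
    (hξ2 : Integrable (fun e => ξ e ^ 2) μ) (hξ21 : ∫ e, ξ e ^ 2 ∂μ ≤ 1)
    (hx2 : Integrable (fun e => x e ^ 2) μ)
    (hx4 : Integrable (fun e => (x e ^ 2) ^ 2) μ) (hx41 : ∫ e, (x e ^ 2) ^ 2 ∂μ ≤ 16)
    {V : ℝ} (hξx2 : Integrable (fun e => (ξ e * x e) ^ 2) μ)
    (hV : ∫ e, (ξ e * x e) ^ 2 ∂μ ≤ V) (hmean : ∫ e, ξ e * x e ∂μ = 0)
    {A B L : ℝ} (hA : μ.real {e | A < |x e|} ≤ Real.exp (-(2 * L)))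
    (hB : μ.real {e | B < |ξ e|} ≤ Real.exp (-L)) :
    |∫ e, {e | |ξ e| ≤ B ∧ |x e| ≤ A}.indicator (fun e => ξ e * x e) e ∂μ|
      ≤ (2 + √V) * Real.exp (-(L / 2)) := by
  have hAm : MeasurableSet {e | A < |x e|} := measurableSet_lt measurable_const hxm.abs
  have hBm : MeasurableSet {e | B < |ξ e|} := measurableSet_lt measurable_const hξm.abs
  have hGm : MeasurableSet {e | |ξ e| ≤ B ∧ |x e| ≤ A} :=
    (measurableSet_le hξm.abs measurable_const).inter (measurableSet_le hxm.abs measurable_const)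
  set G := {e | |ξ e| ≤ B ∧ |x e| ≤ A} with hG
  set SA := {e | A < |x e|} with hSA
  set SB := {e | B < |ξ e|} with hSB
  have hi : Integrable (fun e => ξ e * x e) μ :=
    ((memLp_two_iff_integrable_sq (hξm.mul hxm).aestronglyMeasurable).2 hξx2).integrable
      (by norm_num)
  have h1 : ∫ e, G.indicator (fun e => ξ e * x e) e ∂μ
      = ∫ e, (G.indicator (fun e => ξ e * x e) e - ξ e * x e) ∂μ := by
    rw [integral_sub (hi.indicator hGm) hi, hmean, sub_zero]
  have hmSA := memLp_two_indicator hxm hx2 hAm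
  have hiSA : Integrable (fun e => |ξ e * SA.indicator x e|) μ :=
    (((memLp_two_iff_integrable_sq hξm.aestronglyMeasurable).2 hξ2).integrable_mul hmSA).abs
  have hpt : ∀ e, |G.indicator (fun e => ξ e * x e) e - ξ e * x e|
      ≤ |ξ e * SA.indicator x e| + SB.indicator (fun e => |ξ e * x e|) e := fun e => by
    have n1 : 0 ≤ SB.indicator (fun e => |ξ e * x e|) e :=
      Set.indicator_nonneg (fun _ _ => abs_nonneg _) e
    by_cases hSAe : e ∈ SA
    · have hGe : e ∉ G := fun h => absurd h.2 (not_le.2 hSAe)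
      simp only [Set.indicator_of_notMem hGe, Set.indicator_of_mem hSAe, zero_sub, abs_neg]
      linarith
    · by_cases hSBe : e ∈ SB
      · have hGe : e ∉ G := fun h => absurd h.1 (not_le.2 hSBe)
        simp only [Set.indicator_of_notMem hGe, Set.indicator_of_mem hSBe, zero_sub, abs_neg]
        linarith [abs_nonneg (ξ e * SA.indicator x e)]
      · have hGe : e ∈ G := ⟨not_lt.1 hSBe, not_lt.1 hSAe⟩
        simp only [Set.indicator_of_mem hGe, sub_self, abs_zero]
        linarith [abs_nonneg (ξ e * SA.indicator x e)]
  have hb1 : ∫ e, |ξ e * SA.indicator x e| ∂μ ≤ 2 * Real.exp (-(L / 2)) := by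
    have h := integral_mul_sq_le ((memLp_two_iff_integrable_sq hξm.aestronglyMeasurable).2 hξ2)
      hmSA
    have h2 := setIntegral_le_sqrt_mul_sqrt (hxm.pow_const 2) hx4 hAm
    have e1 : ∀ e, SA.indicator x e ^ 2 = SA.indicator (fun e => |x e ^ 2|) e := fun e => by
      by_cases he : e ∈ SA <;> simp [he]
    simp only [e1] at h
    have h3 : √(∫ e, ξ e ^ 2 ∂μ) ≤ 1 := Real.sqrt_le_one.2 hξ21
    have h4 : √(∫ e, (x e ^ 2) ^ 2 ∂μ) ≤ 4 := Real.sqrt_le_iff.2 ⟨by norm_num, by linarith⟩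
    have h5 : √(μ.real SA) ≤ Real.exp (-L) :=
      Real.sqrt_le_iff.2 ⟨by positivity, hA.trans_eq (by rw [sq, ← Real.exp_add]; ring_nf)⟩
    have h6 : √(∫ e, SA.indicator (fun e => |x e ^ 2|) e ∂μ) ≤ 2 * Real.exp (-(L / 2)) := by
      refine Real.sqrt_le_iff.2 ⟨by positivity, h2.trans ?_⟩
      calc _ ≤ 4 * Real.exp (-L) := by gcongr
        _ = _ := by rw [mul_pow, sq (Real.exp _), ← Real.exp_add]; ring_nf
    calc _ ≤ _ := h
      _ ≤ 1 * (2 * Real.exp (-(L / 2))) := by gcongr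
      _ = _ := one_mul _
  have hb2 : ∫ e, SB.indicator (fun e => |ξ e * x e|) e ∂μ ≤ √V * Real.exp (-(L / 2)) := by
    refine (setIntegral_le_sqrt_mul_sqrt (hξm.mul hxm) hξx2 hBm).trans ?_
    have h5 : √(μ.real SB) ≤ Real.exp (-(L / 2)) :=
      Real.sqrt_le_iff.2 ⟨by positivity, hB.trans_eq (by rw [sq, ← Real.exp_add]; ring_nf)⟩
    gcongr
    exact hV
  have hiSB : Integrable (SB.indicator fun e => |ξ e * x e|) μ := hi.abs.indicator hBm
  rw [h1]
  calc _ ≤ ∫ e, |G.indicator (fun e => ξ e * x e) e - ξ e * x e| ∂μ := abs_integral_le_integral_abs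
    _ ≤ ∫ e, (|ξ e * SA.indicator x e| + SB.indicator (fun e => |ξ e * x e|) e) ∂μ :=
        integral_mono ((hi.indicator hGm).sub hi).abs (hiSA.add hiSB) hpt
    _ = (∫ e, |ξ e * SA.indicator x e| ∂μ) + ∫ e, SB.indicator (fun e => |ξ e * x e|) e ∂μ :=
        integral_add hiSA hiSB
    _ ≤ _ := by linarith

theorem measureReal_sum_truncated_ge_le {E : Type*} [MeasurableSpace E] {μ : Measure E}
    [IsProbabilityMeasure μ] {ξ x : E → ℝ} (hξm : Measurable ξ) (hxm : Measurable x)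
    (hξx2 : Integrable (fun e => (ξ e * x e) ^ 2) μ)
    {V b η l : ℝ} {G : Set E} (hG : MeasurableSet G)
    (hV : ∫ e, (ξ e * x e) ^ 2 ∂μ ≤ V)
    (hGb : ∀ e ∈ G, |ξ e * x e| ≤ b)
    (hmean : |∫ e, G.indicator (fun e => ξ e * x e) e ∂μ| ≤ η)
    (hl : 0 < l) (hlb : l * b ≤ 1) {N : ℕ} (t : ℝ) :
    (Measure.pi fun _ : Fin N => μ).real
        {ω | t < |∑ i, G.indicator (fun e => ξ e * x e) (ω i)|}
      ≤ 2 * Real.exp (-(l * t) + N * (l * η + l ^ 2 * V)) := by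
  set y := G.indicator (fun e => ξ e * x e) with hy
  have hym : Measurable y := (hξm.mul hxm).indicator hG
  have hyb : ∀ e, |l * y e| ≤ 1 := fun e => by
    by_cases he : e ∈ G
    · rw [abs_mul, abs_of_pos hl, hy, Set.indicator_of_mem he]
      exact (mul_le_mul_of_nonneg_left (hGb e he) hl.le).trans hlb
    · simp [hy, he]
  have hy2 : ∫ e, (l * y e) ^ 2 ∂μ ≤ l ^ 2 * V := by
    simp only [mul_pow]
    rw [integral_const_mul]
    have hle : ∀ e, y e ^ 2 ≤ (ξ e * x e) ^ 2 := fun e => by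
      by_cases he : e ∈ G
      · simp [hy, he]
      · rw [hy, Set.indicator_of_notMem he, zero_pow two_ne_zero]; exact sq_nonneg _
    have : ∫ e, y e ^ 2 ∂μ ≤ V := by
      refine (integral_mono ?_ hξx2 hle).trans hV
      exact hξx2.mono' (by fun_prop) (.of_forall fun e => by
        rw [Real.norm_of_nonneg (sq_nonneg _)]; exact hle e)
    gcongr
  have hη := abs_le.1 hmean
  have hm : ∫ e, l * y e ∂μ ≤ l * η := by
    rw [integral_const_mul]; exact mul_le_mul_of_nonneg_left hη.2 hl.le
  have hm' : ∫ e, -(l * y e) ∂μ ≤ l * η := by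
    rw [integral_neg, integral_const_mul, ← mul_neg]
    exact mul_le_mul_of_nonneg_left (by linarith [hη.1]) hl.le
  have h1 := measureReal_sum_ge_le_of_abs_le_one (μ := μ) (N := N) (Z := fun e => l * y e)
    (by fun_prop) hyb (l * t)
  have h2 := measureReal_sum_ge_le_of_abs_le_one (μ := μ) (N := N) (Z := fun e => -(l * y e))
    (by fun_prop) (fun e => by rw [abs_neg]; exact hyb e) (l * t)
  simp only [neg_sq] at h2
  have hsub : {ω : Fin N → E | t < |∑ i, y (ω i)|}
      ⊆ {ω | l * t ≤ ∑ i, l * y (ω i)} ∪ {ω | l * t ≤ ∑ i, -(l * y (ω i))} := by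
    intro ω hω
    rcases lt_abs.1 (show t < |∑ i, y (ω i)| from hω) with h | h
    · left
      show l * t ≤ ∑ i, l * y (ω i)
      rw [← Finset.mul_sum]; gcongr
    · right
      show l * t ≤ ∑ i, -(l * y (ω i))
      rw [Finset.sum_neg_distrib, ← Finset.mul_sum, ← mul_neg]; gcongr
  refine (measureReal_mono hsub (measure_ne_top _ _)).trans
    ((measureReal_union_le _ _).trans ?_)
  have h3 : Real.exp (-(l * t) + N * (∫ e, l * y e ∂μ + ∫ e, (l * y e) ^ 2 ∂μ))
      ≤ Real.exp (-(l * t) + N * (l * η + l ^ 2 * V)) := by gcongr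
  have h4 : Real.exp (-(l * t) + N * (∫ e, -(l * y e) ∂μ + ∫ e, (l * y e) ^ 2 ∂μ))
      ≤ Real.exp (-(l * t) + N * (l * η + l ^ 2 * V)) := by gcongr
  linarith

theorem abs_sum_mul_le_sqrt_mul_sqrt {ι : Type*} (s : Finset ι) (f g : ι → ℝ) :
    |∑ i ∈ s, f i * g i| ≤ √(∑ i ∈ s, f i ^ 2) * √(∑ i ∈ s, g i ^ 2) := by
  rw [← Real.sqrt_mul (Finset.sum_nonneg fun i _ => sq_nonneg _), ← Real.sqrt_sq_eq_abs]
  exact Real.sqrt_le_sqrt (Finset.sum_mul_sq_le_sq_mul_sq s f g)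

/-- Three disjoint pieces: both factors moderate, x large, and x moderate with ξ large. In the last,
x is at most A, so only the number of large ξ values matters after Cauchy–Schwarz. -/
theorem abs_sum_mul_le_truncated {E : Type*} (ξ x : E → ℝ) {A : ℝ} (hA : 0 ≤ A) (B : ℝ) {N : ℕ}
    (ω : Fin N → E) :
    |∑ i, ξ (ω i) * x (ω i)| ≤
      |∑ i, {e | |ξ e| ≤ B ∧ |x e| ≤ A}.indicator (fun e => ξ e * x e) (ω i)|
      + √(∑ i, ξ (ω i) ^ 2) * (√(∑ i, {e | A < |x e|}.indicator (fun e => x e ^ 2) (ω i))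
        + A * √(∑ i, {e | B < |ξ e|}.indicator (fun _ => (1 : ℝ)) (ω i))) := by
  set G := {e | |ξ e| ≤ B ∧ |x e| ≤ A} with hG
  set SA := {e | A < |x e|} with hSA
  set SB := {e | B < |ξ e|} with hSB
  have hpt : ∀ e, ξ e * x e = G.indicator (fun e => ξ e * x e) e + ξ e * SA.indicator x e
      + ξ e * (SB \ SA).indicator x e := fun e => by
    by_cases h1 : e ∈ SA
    · have h2 : e ∉ G := fun h => absurd h.2 (not_le.2 h1)
      have h3 : e ∉ SB \ SA := fun h => h.2 h1
      rw [Set.indicator_of_notMem h2, Set.indicator_of_notMem h3, Set.indicator_of_mem h1]; ring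
    · by_cases h4 : e ∈ SB
      · have h2 : e ∉ G := fun h => absurd h.1 (not_le.2 h4)
        have h3 : e ∈ SB \ SA := ⟨h4, h1⟩
        rw [Set.indicator_of_notMem h2, Set.indicator_of_mem h3, Set.indicator_of_notMem h1]; ring
      · have h2 : e ∈ G := ⟨not_lt.1 h4, not_lt.1 h1⟩
        have h3 : e ∉ SB \ SA := fun h => h4 h.1
        rw [Set.indicator_of_mem h2, Set.indicator_of_notMem h3, Set.indicator_of_notMem h1]; ring
  have hsum : ∑ i, ξ (ω i) * x (ω i) = (∑ i, G.indicator (fun e => ξ e * x e) (ω i))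
      + (∑ i, ξ (ω i) * SA.indicator x (ω i)) + ∑ i, ξ (ω i) * (SB \ SA).indicator x (ω i) := by
    rw [← Finset.sum_add_distrib, ← Finset.sum_add_distrib]
    exact Finset.sum_congr rfl fun i _ => hpt (ω i)
  have c1 := abs_sum_mul_le_sqrt_mul_sqrt Finset.univ (fun i => ξ (ω i))
    (fun i => SA.indicator x (ω i))
  have c2 := abs_sum_mul_le_sqrt_mul_sqrt Finset.univ (fun i => ξ (ω i))
    (fun i => (SB \ SA).indicator x (ω i))
  have e1 : ∀ e, SA.indicator x e ^ 2 = SA.indicator (fun e => x e ^ 2) e := fun e => by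
    by_cases he : e ∈ SA <;> simp [he]
  simp only [e1] at c1
  have e2 : √(∑ i, (SB \ SA).indicator x (ω i) ^ 2)
      ≤ A * √(∑ i, SB.indicator (fun _ => (1 : ℝ)) (ω i)) := by
    have e3 : ∀ y, A * √y = √(A ^ 2 * y) := fun y => by
      rw [Real.sqrt_mul (sq_nonneg A), Real.sqrt_sq hA]
    rw [e3, Finset.mul_sum]
    refine Real.sqrt_le_sqrt (Finset.sum_le_sum fun i _ => ?_)
    by_cases h3 : ω i ∈ SB \ SA
    · rw [Set.indicator_of_mem h3, Set.indicator_of_mem h3.1, mul_one]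
      have : |x (ω i)| ≤ A := not_lt.1 h3.2
      exact sq_le_sq' (by linarith [(abs_le.1 this).1]) (abs_le.1 this).2
    · rw [Set.indicator_of_notMem h3, zero_pow two_ne_zero]
      exact mul_nonneg (sq_nonneg _) (Set.indicator_nonneg (fun _ _ => zero_le_one) _)
  rw [hsum, mul_add]
  have t1 := abs_add_le ((∑ i, G.indicator (fun e => ξ e * x e) (ω i))
    + ∑ i, ξ (ω i) * SA.indicator x (ω i)) (∑ i, ξ (ω i) * (SB \ SA).indicator x (ω i))
  have t2 := abs_add_le (∑ i, G.indicator (fun e => ξ e * x e) (ω i))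
    (∑ i, ξ (ω i) * SA.indicator x (ω i))
  have t3 := mul_le_mul_of_nonneg_left e2 (Real.sqrt_nonneg (∑ i, ξ (ω i) ^ 2))
  linarith

/-- The variance proxy `2q / (q - 2)` of the multiplier process. -/
noncomputable def multVar (q : ℝ) : ℝ := 2 * q / (q - 2)

/-- The constant in the deviation bound for the truncated multiplier process. -/
noncomputable def truncConst (q : ℝ) : ℝ :=
  (4 + √(multVar q) + multVar q) * Real.exp (3 / 2) / √(1 / 4 - 1 / (2 * q))

-- Bernstein's bound at a scale l proportional to u^(-1/2) √(p/N), which is admissible because the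
-- product of the truncation levels is at most a constant times √u e^(L/2). Here q > 2 is essential:
-- it leaves the positive gap ζ = 1/4 - 1/(2q) in the exponent, which absorbs the factor √L of the
-- level for x.
set_option maxHeartbeats 800000 in
theorem measureReal_truncated_multiplier_le {E : Type*} [MeasurableSpace E] {μ : Measure E}
    [IsProbabilityMeasure μ] {ξ x : E → ℝ} (hξm : Measurable ξ) (hxm : Measurable x)
    {q : ℝ} (hq : 2 < q)
    (hξq : Integrable (fun e => |ξ e| ^ q) μ) (hξq1 : ∫ e, |ξ e| ^ q ∂μ ≤ 1)
    (hξ2 : Integrable (fun e => ξ e ^ 2) μ) (hξ21 : ∫ e, ξ e ^ 2 ∂μ ≤ 1)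
    {p L u : ℝ} (hp : 8 ≤ p) (hx : SubgaussianMoments μ x (2 * p)) (hL1 : 1 ≤ L) (hLp : L ≤ p)
    (hξx2 : Integrable (fun e => (ξ e * x e) ^ 2) μ)
    (hV : ∫ e, (ξ e * x e) ^ 2 ∂μ ≤ multVar q) (hmean : ∫ e, ξ e * x e ∂μ = 0)
    {N : ℕ} (hN : p = N * Real.exp (1 - L)) (hu : 1 ≤ u) :
    (Measure.pi fun _ : Fin N => μ).real
      {ω | truncConst q * u * √(N * p) < |∑ i, {e |
        |ξ e| ≤ u ^ (1 / 2 : ℝ) * Real.exp ((1 / 4 + 1 / (2 * q)) * L) ∧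
          |x e| ≤ Real.exp 1 * √(2 * L)}.indicator (fun e => ξ e * x e) (ω i)|}
      ≤ 2 * (Real.exp (-(2 * p)) / u ^ p) := by
  have hu0 : 0 < u := by linarith
  have hq0 : 0 < q := by linarith
  have hp0 : 0 < p := by linarith
  set V := multVar q with hVdef
  have hV0 : 0 ≤ V := by rw [hVdef, multVar]; exact div_nonneg (by linarith) (by linarith)
  set ζ : ℝ := 1 / 4 - 1 / (2 * q) with hζ
  have hζ0 : 0 < ζ := by
    have : 1 / (2 * q) < 1 / 4 := by gcongr; linarith
    linarith
  have hζ1 : ζ ≤ 1 := by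
    have : 0 < 1 / (2 * q) := by positivity
    linarith
  obtain ⟨c, hc⟩ : ∃ c : ℝ, c = √ζ / Real.exp (3 / 2) := ⟨_, rfl⟩
  have hc0 : 0 < c := by rw [hc]; positivity
  have hc1 : c ≤ 1 := by
    rw [hc, div_le_one (by positivity)]
    calc √ζ ≤ 1 := Real.sqrt_le_one.2 hζ1
      _ ≤ _ := Real.one_le_exp (by norm_num)
  set A := Real.exp 1 * √(2 * L) with hA
  set a := Real.log u with ha
  have ha0 : 0 ≤ a := Real.log_nonneg hu
  have hu12 : u ^ (1 / 2 : ℝ) = Real.exp (a / 2) := by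
    rw [Real.rpow_def_of_pos hu0]; congr 1; ring
  set B := u ^ (1 / 2 : ℝ) * Real.exp ((1 / 4 + 1 / (2 * q)) * L) with hB
  have hB0 : 0 < B := by positivity
  have hAm : μ.real {e | A < |x e|} ≤ Real.exp (-(2 * L)) := hx.measureReal_gt_le hL1 (by linarith)
  have hBm : μ.real {e | B < |ξ e|} ≤ Real.exp (-L) := by
    refine (measureReal_abs_gt_le (by linarith) hB0 hξq hξq1).trans ?_
    rw [one_div, ← Real.rpow_neg hB0.le, hB, hu12, ← Real.exp_add, ← Real.exp_mul]
    apply Real.exp_le_exp.2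
    have e1 : (a / 2 + (1 / 4 + 1 / (2 * q)) * L) * -q = -(q / 2 * a) - (q / 4 + 1 / 2) * L := by
      field_simp; ring
    rw [e1]
    nlinarith [mul_nonneg hq0.le ha0]
  have hx2 := hx.integrable_pow_and_le (k := 1) le_rfl (by push_cast; linarith)
  have hx4 := hx.integrable_pow_and_le (k := 2) (by norm_num) (by push_cast; linarith)
  norm_num at hx2 hx4
  have e4 : ∀ e, (x e ^ 2) ^ 2 = x e ^ 4 := fun e => by ring
  have hmean' := abs_integral_truncated_mul_le hξm hxm hξ2 hξ21 hx2.1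
    (by simpa only [e4] using hx4.1) (by simpa only [e4] using hx4.2) hξx2 hV hmean hAm hBm
  obtain ⟨l, hl⟩ : ∃ l, l = c * Real.exp (-(a / 2)) * Real.exp ((1 - L) / 2) := ⟨_, rfl⟩
  have hl0 : 0 < l := by rw [hl]; positivity
  have hsq : √(2 * L) ≤ Real.exp (ζ * L) / √ζ := by
    rw [le_div_iff₀ (by positivity), ← Real.sqrt_mul (by linarith), Real.sqrt_le_iff]
    refine ⟨by positivity, ?_⟩
    rw [sq, ← Real.exp_add]
    linarith [Real.add_one_le_exp (ζ * L + ζ * L)]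
  have hlb : l * (B * A) ≤ 1 := by
    calc l * (B * A) ≤ l * (B * (Real.exp 1 * (Real.exp (ζ * L) / √ζ))) := by
          rw [hA]; gcongr
      _ = (√ζ / √ζ) * (Real.exp (-(a / 2)) * Real.exp ((1 - L) / 2) * Real.exp (a / 2)
            * Real.exp ((1 / 4 + 1 / (2 * q)) * L) * Real.exp 1 * Real.exp (ζ * L)
            * Real.exp (-(3 / 2))) := by
          rw [hl, hB, hc, hu12, Real.exp_neg (3 / 2)]; ring
      _ = 1 := by
          rw [div_self (by positivity), one_mul, ← Real.exp_add, ← Real.exp_add, ← Real.exp_add,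
            ← Real.exp_add, ← Real.exp_add, ← Real.exp_add, Real.exp_eq_one_iff, hζ]
          ring
  have hGm : MeasurableSet {e | |ξ e| ≤ B ∧ |x e| ≤ A} :=
    (measurableSet_le hξm.abs measurable_const).inter (measurableSet_le hxm.abs measurable_const)
  have h := measureReal_sum_truncated_ge_le (N := N) hξm hxm hξx2 hGm hV
    (b := B * A) (fun e he => by
      rw [abs_mul]; exact mul_le_mul he.1 he.2 (abs_nonneg _) hB0.le)
    hmean' hl0 hlb (truncConst q * u * √(N * p))
  refine h.trans ?_
  rw [Real.rpow_def_of_pos hu0, ← Real.exp_sub]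
  gcongr
  have hNp : √(N * p) = N * Real.exp ((1 - L) / 2) := by
    rw [hN, show (N : ℝ) * (N * Real.exp (1 - L)) = (N * Real.exp ((1 - L) / 2)) ^ 2 by
      rw [mul_pow, sq (Real.exp _), ← Real.exp_add]; ring_nf, Real.sqrt_sq (by positivity)]
  have hee : N * (Real.exp ((1 - L) / 2) * Real.exp ((1 - L) / 2)) = p := by
    rw [hN, ← Real.exp_add]; ring_nf
  have hcT : c * truncConst q = 4 + √V + V := by
    rw [truncConst, ← hVdef, ← hζ, hc]
    field_simp
  have k1 : l * (truncConst q * u * √(N * p)) = (4 + √V + V) * Real.exp (a / 2) * p := by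
    have hu1 : Real.exp (-(a / 2)) * u = Real.exp (a / 2) := by
      calc _ = Real.exp (-(a / 2)) * Real.exp a := by rw [ha, Real.exp_log hu0]
        _ = _ := by rw [← Real.exp_add]; ring_nf
    rw [hNp, hl]
    calc _ = (c * truncConst q) * (Real.exp (-(a / 2)) * u)
          * (N * (Real.exp ((1 - L) / 2) * Real.exp ((1 - L) / 2))) := by ring
      _ = _ := by rw [hcT, hu1, hee]
  have hca : c * Real.exp (-(a / 2)) ≤ 1 :=
    mul_le_one₀ hc1 (Real.exp_pos _).le (Real.exp_le_one_iff.2 (by linarith))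
  have hca0 : 0 ≤ c * Real.exp (-(a / 2)) := by positivity
  have k2 : N * (l * ((2 + √V) * Real.exp (-(L / 2)))) ≤ (2 + √V) * p := by
    have : N * (Real.exp ((1 - L) / 2) * Real.exp (-(L / 2))) ≤ p := by
      rw [← hee]; gcongr; linarith
    calc _ = (c * Real.exp (-(a / 2))) * ((2 + √V)
          * (N * (Real.exp ((1 - L) / 2) * Real.exp (-(L / 2))))) := by rw [hl]; ring
      _ ≤ 1 * ((2 + √V) * p) :=
          mul_le_mul hca (mul_le_mul_of_nonneg_left this (by positivity)) (by positivity) zero_le_one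
      _ = _ := one_mul _
  have k3 : N * (l ^ 2 * V) ≤ V * p := by
    calc _ = (c * Real.exp (-(a / 2))) ^ 2 * (V
          * (N * (Real.exp ((1 - L) / 2) * Real.exp ((1 - L) / 2)))) := by rw [hl]; ring
      _ ≤ 1 ^ 2 * (V * p) := by
          rw [hee]
          exact mul_le_mul_of_nonneg_right (pow_le_pow_left₀ hca0 hca 2) (by positivity)
      _ = _ := by ring
  -- The Bernstein exponent is proportional to √u p; √u ≥ 1 + (log u)/2 splits it into a part giving
  -- e^(-2p) and a part giving u^(-p).
  have k4 : 1 + a / 2 ≤ Real.exp (a / 2) := by linarith [Real.add_one_le_exp (a / 2)]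
  have k5 : (4 + √V + V) * (1 + a / 2) * p ≤ (4 + √V + V) * Real.exp (a / 2) * p := by gcongr
  rw [k1, mul_add]
  nlinarith [mul_nonneg ha0 hp0.le, mul_nonneg (mul_nonneg ha0 hp0.le) hV0,
    mul_nonneg (mul_nonneg ha0 hp0.le) (Real.sqrt_nonneg V)]

/-- The constant in the bound for the multiplier process. -/
noncomputable def multConst (q : ℝ) : ℝ :=
  truncConst q + √(1 + 3 * q) * (√(4 * Real.exp 17) + √(16 * Real.exp 2 / (q - 2)))
    + √(1 + 3 * q) * √(8 * Real.exp 9)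

theorem multConst_pos {q : ℝ} (hq : 2 < q) : 0 < multConst q := by
  have h1 : 0 < √(1 + 3 * q) * √(8 * Real.exp 9) :=
    mul_pos (Real.sqrt_pos.2 (by linarith)) (by positivity)
  have h2 : 0 ≤ truncConst q := by
    unfold truncConst multVar
    have : 0 ≤ 2 * q / (q - 2) := div_nonneg (by linarith) (by linarith)
    positivity
  unfold multConst
  positivity

theorem truncConst_nonneg {q : ℝ} (hq : 2 < q) : 0 ≤ truncConst q := by
  unfold truncConst multVar
  have : 0 ≤ 2 * q / (q - 2) := div_nonneg (by linarith) (by linarith)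
  positivity

theorem measureReal_iUnion_le_mul {E : Type*} [MeasurableSpace E] {ν : Measure E} {d : ℕ}
    {S : Fin d → Set E} {b c : ℝ} (hb : 0 ≤ b) (hd : (d : ℝ) ≤ c) (h : ∀ j, ν.real (S j) ≤ b) :
    ν.real (⋃ j, S j) ≤ c * b := by
  refine (measureReal_iUnion_fintype_le _).trans ((Finset.sum_le_sum fun j _ => h j).trans ?_)
  simp only [Finset.sum_const, Finset.card_univ, Fintype.card_fin, nsmul_eq_mul]
  gcongr

/-- A deviation bound for the maximum of the coordinates of a multiplier process. -/
theorem measureReal_multiplier_le {E : Type*} [MeasurableSpace E] {μ : Measure E}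
    [IsProbabilityMeasure μ] {d : ℕ} {ξ : E → ℝ} {x : Fin d → E → ℝ} (hξm : Measurable ξ)
    (hxm : ∀ j, Measurable (x j)) {q : ℝ} (hq : 2 < q)
    (hξq : Integrable (fun e => |ξ e| ^ q) μ) (hξq1 : ∫ e, |ξ e| ^ q ∂μ ≤ 1)
    (hξ2 : Integrable (fun e => ξ e ^ 2) μ) (hξ21 : ∫ e, ξ e ^ 2 ∂μ ≤ 1)
    {p u w : ℝ} (hp : 8 ≤ p) (hx : ∀ j, SubgaussianMoments μ (x j) (2 * p))
    (hξx2 : ∀ j, Integrable (fun e => (ξ e * x j e) ^ 2) μ)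
    (hV : ∀ j, ∫ e, (ξ e * x j e) ^ 2 ∂μ ≤ multVar q) (hmean : ∀ j, ∫ e, ξ e * x j e ∂μ = 0)
    {N : ℕ} (hN : 2 ≤ N) (hNp : Real.log N ≤ p) (hdp : (d : ℝ) ≤ Real.exp (p / 2))
    (hu : 1 ≤ u) (hw : 2 ≤ w) :
    (Measure.pi fun _ : Fin N => μ).real
      {ω | ∃ j, multConst q * (u * w) * √(N * p) < |∑ i, ξ (ω i) * x j (ω i)|}
      ≤ Real.exp (-p / 2) / u ^ (2 * p)
        + 4 * Real.exp (-p / 2) / u ^ (1 / 2 * (p / Real.log (Real.exp 1 * N / p)))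
        + (1 + 2 ^ q) * Real.log N ^ q / (w ^ q * (N : ℝ) ^ (q / 2 - 1)) := by
  have hp0 : 0 < p := by linarith
  have hu0 : 0 < u := by linarith
  have hw0 : 0 < w := by linarith
  have hN0 : (0 : ℝ) < N := by exact_mod_cast (by omega : 0 < N)
  have hE1 := measureReal_sum_sq_gt_le_of_weak_moment hξm hq hξq hξq1 hξ2 hξ21 hN hw
  set T₃ := (1 + 2 ^ q) * Real.log N ^ q / (w ^ q * (N : ℝ) ^ (q / 2 - 1))
  have hT1 : 0 ≤ Real.exp (-p / 2) / u ^ (2 * p) := by positivity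
  set L := Real.log (Real.exp 1 * N / p) with hL
  have hT2 : 0 ≤ 4 * Real.exp (-p / 2) / u ^ (1 / 2 * (p / L)) := by positivity
  have htc := truncConst_nonneg hq
  have hsK1 : ∀ ω : Fin N → E, ¬ ((1 + 3 * q) * (w ^ 2 * N) < ∑ i, ξ (ω i) ^ 2) →
      √(∑ i, ξ (ω i) ^ 2) ≤ √(1 + 3 * q) * (w * √N) := fun ω h => by
    refine (Real.sqrt_le_sqrt (not_lt.1 h)).trans_eq ?_
    rw [Real.sqrt_mul (by linarith), Real.sqrt_mul (by positivity), Real.sqrt_sq hw0.le]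
  rw [show √(N * p) = √N * √p from Real.sqrt_mul hN0.le p]
  have huwp : 0 ≤ u * w * (√N * √p) := by positivity
  have hpos1 : 0 ≤ √(1 + 3 * q) * (√(4 * Real.exp 17) + √(16 * Real.exp 2 / (q - 2))) := by
    positivity
  have hpos2 : 0 ≤ √(1 + 3 * q) * √(8 * Real.exp 9) := by positivity
  -- For N ≤ p no truncation is needed. For p < N one has L ≥ 1, and p = N e^(1 - L) makes the
  -- truncation bounds available.
  rcases le_or_gt (N : ℝ) p with hreg | hreg
  · have hsub : {ω : Fin N → E | ∃ j, multConst q * (u * w) * (√N * √p)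
          < |∑ i, ξ (ω i) * x j (ω i)|}
        ⊆ {ω | (1 + 3 * q) * (w ^ 2 * N) < ∑ i, ξ (ω i) ^ 2} ∪
          ⋃ j, {ω | 8 * Real.exp 9 * (u ^ 2 * p) ≤ ∑ i, x j (ω i) ^ 2} := by
      rintro ω ⟨j, hj⟩
      by_contra hcon
      simp only [Set.mem_union, Set.mem_iUnion, Set.mem_ofPred_eq, not_or, not_exists] at hcon
      have h1 := hsK1 ω hcon.1
      have h2 : √(∑ i, x j (ω i) ^ 2) ≤ √(8 * Real.exp 9) * (u * √p) := by
        refine (Real.sqrt_le_sqrt (not_le.1 (hcon.2 j)).le).trans_eq ?_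
        rw [Real.sqrt_mul (x := 8 * Real.exp 9) (by positivity), Real.sqrt_mul (x := u ^ 2) (by positivity), Real.sqrt_sq hu0.le]
      have h3 := abs_sum_mul_le_sqrt_mul_sqrt Finset.univ (fun i => ξ (ω i))
        (fun i => x j (ω i))
      refine absurd hj (not_lt.2 (h3.trans ?_))
      calc _ ≤ (√(1 + 3 * q) * (w * √N)) * (√(8 * Real.exp 9) * (u * √p)) := by gcongr
        _ = (√(1 + 3 * q) * √(8 * Real.exp 9)) * (u * w * (√N * √p)) := by ring
        _ ≤ multConst q * (u * w * (√N * √p)) := by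
            gcongr; unfold multConst; linarith
        _ = _ := by ring
    refine (measureReal_mono hsub (measure_ne_top _ _)).trans
      ((measureReal_union_le _ _).trans ?_)
    have hE2 := measureReal_iUnion_le_mul (ν := Measure.pi fun _ : Fin N => μ) (by positivity) hdp
      (fun j => measureReal_sum_sq_ge_le (hxm j) (by linarith) (hx j) hreg hu0)
    have hle : Real.exp (p / 2) * (Real.exp (-(2 * p)) / u ^ (2 * p))
        ≤ Real.exp (-p / 2) / u ^ (2 * p) := by
      rw [← mul_div_assoc, ← Real.exp_add]; gcongr; linarith
    linarith
  · have hexpL : Real.exp L = Real.exp 1 * N / p := Real.exp_log (by positivity)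
    have hNL : p = N * Real.exp (1 - L) := by
      rw [Real.exp_sub, hexpL]; field_simp
    have hL1 : 1 ≤ L := by
      rw [← Real.exp_le_exp, hexpL, le_div_iff₀ hp0]; gcongr
    have hLp : L ≤ p := by
      refine le_trans ?_ hNp
      refine Real.log_le_log (by positivity) ?_
      rw [div_le_iff₀ hp0]
      have := Real.exp_one_lt_d9
      nlinarith
    set A := Real.exp 1 * √(2 * L) with hA
    set B := u ^ (1 / 2 : ℝ) * Real.exp ((1 / 4 + 1 / (2 * q)) * L) with hB
    have hA0 : 0 ≤ A := by positivity
    have hsub : {ω : Fin N → E | ∃ j, multConst q * (u * w) * (√N * √p)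
          < |∑ i, ξ (ω i) * x j (ω i)|}
        ⊆ ({ω | (1 + 3 * q) * (w ^ 2 * N) < ∑ i, ξ (ω i) ^ 2} ∪
          {ω | 8 / (q - 2) * (p / L) ≤
            ∑ i, {e | B < |ξ e|}.indicator (fun _ => (1 : ℝ)) (ω i)}) ∪
          ((⋃ j, {ω | 4 * Real.exp 17 * (u ^ 2 * p) ≤
            ∑ i, {e | A < |x j e|}.indicator (fun e => x j e ^ 2) (ω i)}) ∪
          ⋃ j, {ω | truncConst q * u * √(N * p) < |∑ i, {e | |ξ e| ≤ B ∧
            |x j e| ≤ A}.indicator (fun e => ξ e * x j e) (ω i)|}) := by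
      rintro ω ⟨j, hj⟩
      by_contra hcon
      simp only [Set.mem_union, Set.mem_iUnion, Set.mem_ofPred_eq, not_or, not_exists] at hcon
      obtain ⟨⟨g1, g2⟩, g3, g4⟩ := hcon
      have h1 := hsK1 ω g1
      have h2 := not_lt.1 (g4 j)
      have h3 : √(∑ i, {e | A < |x j e|}.indicator (fun e => x j e ^ 2) (ω i))
          ≤ √(4 * Real.exp 17) * (u * √p) := by
        refine (Real.sqrt_le_sqrt (not_le.1 (g3 j)).le).trans_eq ?_
        rw [Real.sqrt_mul (x := 4 * Real.exp 17) (by positivity), Real.sqrt_mul (x := u ^ 2) (by positivity), Real.sqrt_sq hu0.le]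
      have h4 : A * √(∑ i, {e | B < |ξ e|}.indicator (fun _ => (1 : ℝ)) (ω i))
          ≤ √(16 * Real.exp 2 / (q - 2)) * (u * √p) := by
        have hq2 : 0 < q - 2 := by linarith
        calc _ ≤ A * √(8 / (q - 2) * (p / L)) := by gcongr; exact (not_le.1 g2).le
          _ = √(16 * Real.exp 2 / (q - 2) * p) := by
              rw [← Real.sqrt_sq hA0, ← Real.sqrt_mul (sq_nonneg A), hA, mul_pow,
                Real.sq_sqrt (by positivity), show Real.exp 2 = Real.exp 1 ^ 2 by
                  rw [← Real.exp_nat_mul]; norm_num]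
              congr 1; field_simp; ring
          _ = √(16 * Real.exp 2 / (q - 2)) * (1 * √p) := by
              rw [Real.sqrt_mul (by positivity), one_mul]
          _ ≤ _ := by gcongr
      have h5 := abs_sum_mul_le_truncated ξ (x j) hA0 B ω
      refine absurd hj (not_lt.2 (h5.trans ?_))
      rw [Real.sqrt_mul hN0.le] at h2
      calc _ ≤ truncConst q * u * (√N * √p) + (√(1 + 3 * q) * (w * √N))
            * (√(4 * Real.exp 17) * (u * √p) + √(16 * Real.exp 2 / (q - 2)) * (u * √p)) := by
            gcongr
        _ ≤ truncConst q * (u * w) * (√N * √p) + (√(1 + 3 * q) * (w * √N))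
            * (√(4 * Real.exp 17) * (u * √p) + √(16 * Real.exp 2 / (q - 2)) * (u * √p)) := by
            gcongr; nlinarith
        _ = (truncConst q + √(1 + 3 * q) * (√(4 * Real.exp 17)
              + √(16 * Real.exp 2 / (q - 2)))) * (u * w * (√N * √p)) := by ring
        _ ≤ multConst q * (u * w * (√N * √p)) := by
            gcongr; unfold multConst; linarith
        _ = _ := by ring
    refine (measureReal_mono hsub (measure_ne_top _ _)).trans
      ((measureReal_union_le _ _).trans ((add_le_add (measureReal_union_le _ _)
        (measureReal_union_le _ _)).trans ?_))
    have hE4 := measureReal_card_large_ge_le (N := N) hξm hq hξq hξq1 hL1 hNL hu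
    have hE3 := measureReal_iUnion_le_mul (ν := Measure.pi fun _ : Fin N => μ) (by positivity) hdp
      (fun j => (hx j).measureReal_sum_sq_tail_ge_le (N := N) (hxm j) hp hL1 hLp hNL hu)
    have hE5 := measureReal_iUnion_le_mul (ν := Measure.pi fun _ : Fin N => μ) (by positivity) hdp
      (fun j => measureReal_truncated_multiplier_le (N := N) hξm (hxm j) hq hξq hξq1 hξ2 hξ21 hp
        (hx j) hL1 hLp (hξx2 j) (hV j) (hmean j) hNL hu)
    set b := Real.exp (-p / 2) / u ^ (1 / 2 * (p / L)) with hb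
    have hpL : p / L ≤ p := div_le_self hp0.le hL1
    have hpL0 : 0 ≤ p / L := by positivity
    have f4 : Real.exp (-p) / u ^ (p / L) ≤ b := by
      rw [hb]; gcongr <;> linarith
    have f3 : Real.exp (p / 2) * (Real.exp (-(3 * p)) / u ^ (p / 2)) ≤ b := by
      rw [← mul_div_assoc, ← Real.exp_add, hb]; gcongr <;> linarith
    have f5 : Real.exp (p / 2) * (2 * (Real.exp (-(2 * p)) / u ^ p)) ≤ 2 * b := by
      rw [mul_left_comm, ← mul_div_assoc, ← Real.exp_add, hb]; gcongr <;> linarith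
    have hb4 : 4 * Real.exp (-p / 2) / u ^ (1 / 2 * (p / L)) = 4 * b := by rw [hb]; ring
    rw [hb4]
    linarith

/-! ### Bounded differences -/

/-- Fubini's theorem with the first coordinate split off: the common induction step for McDiarmid's
inequality, symmetrization and the moments of sums. -/
theorem integral_pi_succ {E : Type*} [MeasurableSpace E] {μ : Measure E} [IsProbabilityMeasure μ]
    {n : ℕ} {f : (Fin (n + 1) → E) → ℝ} (hf : Integrable f (Measure.pi fun _ => μ)) :
    Integrable (fun z : E × (Fin n → E) => f (Fin.cons z.1 z.2))
        (μ.prod (Measure.pi fun _ => μ)) ∧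
      ∫ ω, f ω ∂(Measure.pi fun _ => μ)
        = ∫ x, ∫ y, f (Fin.cons x y) ∂(Measure.pi fun _ : Fin n => μ) ∂μ := by
  have hmp := (measurePreserving_piFinSuccAbove (fun _ : Fin (n + 1) => μ) 0).symm
  have e1 : ∀ z : E × (Fin n → E),
      (MeasurableEquiv.piFinSuccAbove (fun _ : Fin (n + 1) => E) 0).symm z = Fin.cons z.1 z.2 := by
    intro z
    simp [MeasurableEquiv.piFinSuccAbove_symm_apply, Fin.insertNthEquiv]
  have h1 : Integrable (fun z : E × (Fin n → E) => f (Fin.cons z.1 z.2))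
      (μ.prod (Measure.pi fun _ => μ)) := by
    have := (hmp.integrable_comp_emb (MeasurableEquiv.measurableEmbedding _) (g := f)).2 hf
    simpa only [Function.comp_def, e1] using this
  refine ⟨h1, ?_⟩
  rw [← hmp.integral_comp' f]
  simp only [e1]
  exact integral_prod _ h1

theorem measurable_fin_cons {E : Type*} [MeasurableSpace E] {n : ℕ} :
    Measurable fun z : E × (Fin n → E) => (Fin.cons z.1 z.2 : Fin (n + 1) → E) := by
  refine measurable_pi_iff.2 fun i => ?_
  refine Fin.cases ?_ (fun i => ?_) i
  · simpa using measurable_fst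
  · simpa [Function.comp_def] using (measurable_pi_apply i).comp
      (measurable_snd (α := E) (β := Fin n → E))

/-- The moment generating function bound behind the bounded differences inequality. -/
theorem integral_exp_pi_le_of_bounded_differences {E : Type*} [MeasurableSpace E] {μ : Measure E}
    [IsProbabilityMeasure μ] {n : ℕ} {f : (Fin n → E) → ℝ} (hf : Measurable f) {a b : ℝ}
    (hab : ∀ ω, f ω ∈ Set.Icc a b) {c : ℝ}
    (hc : ∀ ω i e, |f ω - f (Function.update ω i e)| ≤ c) (t : ℝ) :
    ∫ ω, Real.exp (t * (f ω - ∫ ω', f ω' ∂(Measure.pi fun _ => μ))) ∂(Measure.pi fun _ => μ)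
      ≤ Real.exp (n * (t ^ 2 * c ^ 2 / 8)) := by
  induction n with
  | zero =>
    have h : ∀ ω, f ω = f default := fun ω => congrArg f (Subsingleton.elim _ _)
    simp [h]
  | succ n ih =>
    set ν := Measure.pi fun _ : Fin n => μ
    have hfi : Integrable f (Measure.pi fun _ => μ) :=
      Integrable.of_mem_Icc a b hf.aemeasurable (.of_forall hab)
    have hcm : Measurable fun z : E × (Fin n → E) => f (Fin.cons z.1 z.2) :=
      hf.comp measurable_fin_cons
    have hcx : ∀ x, Measurable fun y : Fin n → E => f (Fin.cons x y) := fun x =>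
      hcm.comp (measurable_const.prodMk measurable_id)
    have hcxi : ∀ x, Integrable (fun y : Fin n → E => f (Fin.cons x y)) ν := fun x =>
      Integrable.of_mem_Icc a b (hcx x).aemeasurable (.of_forall fun y => hab _)
    set g : E → ℝ := fun x => ∫ y, f (Fin.cons x y) ∂ν with hg
    have hgm : Measurable g := (hcm.stronglyMeasurable.integral_prod_right').measurable
    obtain ⟨hpi, hEf⟩ := integral_pi_succ hfi
    have hgab : ∀ x, g x ∈ Set.Icc a b := fun x => by
      constructor
      · simpa using integral_mono (integrable_const a) (hcxi x) fun y => (hab _).1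
      · simpa using integral_mono (hcxi x) (integrable_const b) fun y => (hab _).2
    have hgc : ∀ x x', g x - g x' ≤ c := fun x x' => by
      rw [hg, ← integral_sub (hcxi x) (hcxi x')]
      have : ∀ y : Fin n → E, f (Fin.cons x y) - f (Fin.cons x' y) ≤ c := fun y => by
        have := hc (Fin.cons x y) 0 x'
        rw [Fin.update_cons_zero] at this
        exact (le_abs_self _).trans this
      simpa using integral_mono ((hcxi x).sub (hcxi x')) (integrable_const c) this
    obtain ⟨x₀⟩ : Nonempty E := nonempty_of_isProbabilityMeasure μ
    have hbdd : BddBelow (Set.range g) := ⟨a, by rintro _ ⟨x, rfl⟩; exact (hgab x).1⟩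
    have hc0 : 0 ≤ c := by simpa using hgc x₀ x₀
    have : Nonempty E := ⟨x₀⟩
    have hgI : ∀ x, g x ∈ Set.Icc (⨅ x, g x) ((⨅ x, g x) + c) := fun x => by
      refine ⟨ciInf_le hbdd x, ?_⟩
      have : g x - c ≤ ⨅ x, g x := le_ciInf fun x' => by linarith [hgc x x']
      linarith
    -- Hoeffding's lemma for the conditional mean g given the first coordinate, whose range has
    -- length at most c; the remaining coordinates are covered by induction.
    have hH := (hasSubgaussianMGF_of_mem_Icc (μ := μ) hgm.aemeasurable (.of_forall hgI)).mgf_le t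
    have hH' : ∫ x, Real.exp (t * (g x - ∫ x, g x ∂μ)) ∂μ ≤ Real.exp (t ^ 2 * c ^ 2 / 8) := by
      refine hH.trans_eq ?_
      congr 1
      simp only [add_sub_cancel_left, NNReal.coe_pow, NNReal.coe_div, coe_nnnorm,
        Real.norm_of_nonneg hc0, NNReal.coe_ofNat]
      ring
    have hih : ∀ x, ∫ y, Real.exp (t * (f (Fin.cons x y) - g x)) ∂ν
        ≤ Real.exp (n * (t ^ 2 * c ^ 2 / 8)) := fun x => by
      refine ih (hcx x) (fun y => hab _) fun y i e => ?_
      have := hc (Fin.cons x y) i.succ e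
      rwa [← Fin.cons_update] at this
    have hexpI : ∀ {F : Type _} [MeasurableSpace F] {κ : Measure F} [IsProbabilityMeasure κ]
        {k : F → ℝ} (_ : Measurable k) (_ : ∀ z, |k z| ≤ b - a),
        Integrable (fun z => Real.exp (t * k z)) κ := fun {F} _ {κ} _ {k} hk hkb =>
      Integrable.of_mem_Icc 0 (Real.exp (|t| * (b - a))) (by fun_prop) (.of_forall fun z =>
        ⟨(Real.exp_pos _).le, Real.exp_le_exp.2 ((le_abs_self _).trans (by
          rw [abs_mul]; exact mul_le_mul_of_nonneg_left (hkb z) (abs_nonneg t)))⟩)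
    set m := ∫ x, g x ∂μ with hm
    have hmab : m ∈ Set.Icc a b := by
      have hgi := Integrable.of_mem_Icc (μ := μ) a b hgm.aemeasurable (.of_forall hgab)
      constructor
      · simpa using integral_mono (integrable_const a) hgi fun y => (hgab _).1
      · simpa using integral_mono hgi (integrable_const b) fun y => (hgab _).2
    have hdist : ∀ {p q : ℝ}, p ∈ Set.Icc a b → q ∈ Set.Icc a b → |p - q| ≤ b - a :=
      fun hp hq => abs_le.2 ⟨by linarith [hp.1, hq.2], by linarith [hp.2, hq.1]⟩
    have hI1 : Integrable (fun ω => Real.exp (t * (f ω - m))) (Measure.pi fun _ => μ) :=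
      hexpI (hf.sub_const m) fun ω => hdist (hab ω) hmab
    have hI2 : Integrable (fun x => Real.exp (t * (g x - m))) μ :=
      hexpI (hgm.sub_const m) fun ω => hdist (hgab ω) hmab
    rw [hEf]
    obtain ⟨hI3, hI4⟩ := integral_pi_succ hI1
    rw [hI4]
    have hstep : ∀ x, ∫ y, Real.exp (t * (f (Fin.cons x y) - m)) ∂ν
        ≤ Real.exp (t * (g x - m)) * Real.exp (n * (t ^ 2 * c ^ 2 / 8)) := fun x => by
      have : ∀ y : Fin n → E, Real.exp (t * (f (Fin.cons x y) - m))
          = Real.exp (t * (g x - m)) * Real.exp (t * (f (Fin.cons x y) - g x)) := fun y => by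
        rw [← Real.exp_add]; ring_nf
      simp only [this]
      rw [integral_const_mul]
      exact mul_le_mul_of_nonneg_left (hih x) (Real.exp_pos _).le
    calc _ ≤ ∫ x, Real.exp (t * (g x - m)) * Real.exp (n * (t ^ 2 * c ^ 2 / 8)) ∂μ :=
          integral_mono hI3.integral_prod_left (hI2.mul_const _) hstep
      _ = (∫ x, Real.exp (t * (g x - m)) ∂μ) * Real.exp (n * (t ^ 2 * c ^ 2 / 8)) :=
          integral_mul_const _ _
      _ ≤ Real.exp (t ^ 2 * c ^ 2 / 8) * Real.exp (n * (t ^ 2 * c ^ 2 / 8)) := by gcongr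
      _ = _ := by rw [← Real.exp_add]; push_cast; ring_nf

/-- **McDiarmid's inequality** for independent identically distributed variables. -/
theorem measureReal_pi_ge_le_of_bounded_differences {E : Type*} [MeasurableSpace E]
    {μ : Measure E} [IsProbabilityMeasure μ] {n : ℕ} {f : (Fin n → E) → ℝ} (hf : Measurable f)
    {a b : ℝ} (hab : ∀ ω, f ω ∈ Set.Icc a b)
    (hc : ∀ ω i e, |f ω - f (Function.update ω i e)| ≤ 1) {ε : ℝ} (hε : 0 < ε) :
    (Measure.pi fun _ => μ).real {ω | ∫ ω', f ω' ∂(Measure.pi fun _ => μ) + ε / 2 * n ≤ f ω}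
      ≤ Real.exp (-(ε ^ 2 * n / 2)) := by
  set m := ∫ ω', f ω' ∂(Measure.pi fun _ => μ)
  -- The parameter 2ε minimizes n t²/8 - t ε n/2, with minimum -ε² n/2.
  have hmgf := integral_exp_pi_le_of_bounded_differences (μ := μ) hf hab hc (2 * ε)
  have hint : Integrable (fun ω => Real.exp (2 * ε * (f ω - m))) (Measure.pi fun _ => μ) :=
    Integrable.of_mem_Icc 0 (Real.exp (2 * ε * (b - m))) (by fun_prop) (.of_forall fun ω =>
      ⟨(Real.exp_pos _).le, Real.exp_le_exp.2 (by nlinarith [(hab ω).2])⟩)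
  have hM := mul_meas_ge_le_integral_of_nonneg (.of_forall fun ω => (Real.exp_pos _).le) hint
    (Real.exp (ε ^ 2 * n))
  have hsub : {ω | m + ε / 2 * n ≤ f ω}
      ⊆ {ω | Real.exp (ε ^ 2 * n) ≤ Real.exp (2 * ε * (f ω - m))} := fun ω hω => by
    have hω' : m + ε / 2 * n ≤ f ω := hω
    exact Real.exp_le_exp.2 (by nlinarith)
  have h1 := measureReal_mono (μ := Measure.pi fun _ : Fin n => μ) hsub (measure_ne_top _ _)
  have h2 := (mul_le_mul_of_nonneg_left h1 (Real.exp_pos (ε ^ 2 * n)).le).trans (hM.trans hmgf)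
  rw [mul_comm, ← le_div_iff₀ (Real.exp_pos _), ← Real.exp_sub] at h2
  refine h2.trans_eq ?_
  congr 1; ring

/-! ### Symmetrization and contraction -/

section Symmetrization

theorem le_ciSup_of_finite {ι : Type*} [Finite ι] (f : ι → ℝ) (h : ι) : f h ≤ ⨆ h, f h :=
  le_ciSup (Set.finite_range f).bddAbove h

variable {V : Type*} [MeasurableSpace V] {ι : Type*} [Finite ι] [Nonempty ι]

theorem integrable_ciSup {μ : Measure V} {f : ι → V → ℝ} (hm : ∀ h, Measurable (f h))
    (hi : ∀ h, Integrable (f h) μ) : Integrable (fun x => ⨆ h, f h x) μ := by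
  have := Fintype.ofFinite ι
  refine (integrable_finsetSum Finset.univ fun h _ => (hi h).abs).mono'
    (Measurable.iSup hm).aestronglyMeasurable (.of_forall fun x => ?_)
  obtain ⟨h₀⟩ := ‹Nonempty ι›
  have hle : ∀ h, |f h x| ≤ ∑ h, |f h x| := fun h =>
    Finset.single_le_sum (f := fun h => |f h x|) (fun _ _ => abs_nonneg _) (Finset.mem_univ h)
  rw [Real.norm_eq_abs, abs_le]
  constructor
  · have := le_ciSup_of_finite (fun h => f h x) h₀
    linarith [(abs_le.1 (hle h₀)).1]
  · exact ciSup_le fun h => (le_abs_self _).trans (hle h)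

/-- The symmetrization of a measure: the law of `σ X`, where `X` has law `μ` and `σ` is an
independent random sign. -/
noncomputable def symmetrizedLaw [Neg V] (μ : Measure V) : Measure V :=
  (2⁻¹ : ENNReal) • (μ + μ.map Neg.neg)

variable [AddCommGroup V] [MeasurableNeg V] {μ : Measure V}

instance [IsProbabilityMeasure μ] : IsProbabilityMeasure (symmetrizedLaw μ) := by
  constructor
  have : IsProbabilityMeasure (μ.map Neg.neg) :=
    Measure.isProbabilityMeasure_map measurable_neg.aemeasurable
  simp [symmetrizedLaw, ENNReal.inv_two_add_inv_two]

theorem integrable_symmetrizedLaw {f : V → ℝ} (hf : Measurable f) (hi : Integrable f μ)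
    (hi' : Integrable (fun x => f (-x)) μ) : Integrable f (symmetrizedLaw μ) := by
  refine Integrable.smul_measure (hi.add_measure ?_) (by simp)
  exact (integrable_map_measure hf.aestronglyMeasurable measurable_neg.aemeasurable).2 hi'

theorem integral_symmetrizedLaw {f : V → ℝ} (hf : Measurable f) (hi : Integrable f μ)
    (hi' : Integrable (fun x => f (-x)) μ) :
    ∫ x, f x ∂(symmetrizedLaw μ) = (∫ x, f x ∂μ + ∫ x, f (-x) ∂μ) / 2 := by
  rw [symmetrizedLaw, integral_smul_measure, integral_add_measure hi
    ((integrable_map_measure hf.aestronglyMeasurable measurable_neg.aemeasurable).2 hi'),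
    integral_map measurable_neg.aemeasurable hf.aestronglyMeasurable]
  simp; ring

variable [IsProbabilityMeasure μ]

/-- Symmetrization and contraction, for one variable. -/
theorem integral_ciSup_le_symmetrizedLaw {a : ι → V → ℝ} (ham : ∀ h, Measurable (a h))
    (hai : ∀ h, Integrable (a h) μ) (hodd : ∀ h x, a h (-x) = -a h x) {ψ : ℝ → ℝ}
    (hψm : Measurable ψ) (hψ : ∀ s, ψ s ∈ Set.Icc (0 : ℝ) 1) {K : ℝ}
    (hLip : ∀ s t, |ψ s - ψ t| ≤ K * |s - t|) (u : ι → ℝ) :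
    ∫ x, ⨆ h, (u h + (∫ x', ψ (a h x') ∂μ - ψ (a h x))) ∂μ
      ≤ ∫ x, ⨆ h, (u h + 2 * K * a h x) ∂(symmetrizedLaw μ) := by
  have hψa : ∀ h, Measurable fun x => ψ (a h x) := fun h => hψm.comp (ham h)
  have hψi : ∀ h, Integrable (fun x => ψ (a h x)) μ := fun h =>
    Integrable.of_mem_Icc 0 1 (hψa h).aemeasurable (.of_forall fun x => hψ _)
  set S : (ι → ℝ) → ℝ := fun v => ⨆ h, (u h + v h) with hS
  have hSle : ∀ (v : ι → ℝ) h, u h + v h ≤ S v := fun v h =>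
    le_ciSup_of_finite (fun h => u h + v h) h
  have hSi : ∀ {v : ι → V → ℝ}, (∀ h, Measurable (v h)) → (∀ h, Integrable (v h) μ) →
      Integrable (fun x => S fun h => v h x) μ := fun hm hi =>
    integrable_ciSup (fun h => (hm h).const_add _) fun h => (integrable_const _).add (hi h)
  have hi1 : Integrable (fun x => S fun h => 2 * ψ (a h x)) μ :=
    hSi (fun h => (hψa h).const_mul 2) fun h => (hψi h).const_mul 2
  have hi2 : Integrable (fun x => S fun h => -(2 * ψ (a h x))) μ :=
    hSi (fun h => ((hψa h).const_mul 2).neg) fun h => ((hψi h).const_mul 2).neg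
  have hi3 : Integrable (fun x => S fun h => 2 * K * a h x) μ :=
    hSi (fun h => (ham h).const_mul _) fun h => (hai h).const_mul _
  have hi4 : Integrable (fun x => S fun h => -(2 * K * a h x)) μ :=
    hSi (fun h => ((ham h).const_mul _).neg) fun h => ((hai h).const_mul _).neg
  have hi5 : Integrable (fun x => S fun h => ∫ x', ψ (a h x') ∂μ - ψ (a h x)) μ :=
    hSi (fun h => (hψa h).const_sub _) fun h => (integrable_const _).sub (hψi h)
  have h1 : (S fun h => 2 * ∫ x', ψ (a h x') ∂μ) ≤ ∫ x, (S fun h => 2 * ψ (a h x)) ∂μ := by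
    refine ciSup_le fun h => ?_
    rw [show (fun h => 2 * ∫ x', ψ (a h x') ∂μ) h = ∫ x', 2 * ψ (a h x') ∂μ from
      (integral_const_mul _ _).symm]
    calc u h + ∫ x, 2 * ψ (a h x) ∂μ = ∫ x, (u h + 2 * ψ (a h x)) ∂μ := by
          rw [integral_add (integrable_const _) ((hψi h).const_mul 2)]; simp
      _ ≤ _ := integral_mono ((integrable_const _).add ((hψi h).const_mul 2)) hi1
          fun x => hSle (fun h => 2 * ψ (a h x)) h
  -- Each term is the average of u + 2𝔼ψ and u - 2ψ, so the supremum is at most the average of the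
  -- suprema. By Jensen's inequality (`h1`) the first is then dominated by the mean of the supremum
  -- of u + 2ψ: no independent copy of the variable is needed.
  have h2 : ∀ x, (S fun h => ∫ x', ψ (a h x') ∂μ - ψ (a h x))
      ≤ ((S fun h => 2 * ∫ x', ψ (a h x') ∂μ) + S fun h => -(2 * ψ (a h x))) / 2 := fun x => by
    refine ciSup_le fun h => ?_
    have e1 := hSle (fun h => 2 * ∫ x', ψ (a h x') ∂μ) h
    have e2 := hSle (fun h => -(2 * ψ (a h x))) h
    linarith
  -- Contraction: for a pair h, h', the difference 2ψ(a h) - 2ψ(a h') is at most 2K|a h - a h'|.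
  -- Whatever the sign inside the absolute value, h and h' can be assigned to the two suprema on the
  -- right accordingly.
  have h3 : ∀ x, (S fun h => 2 * ψ (a h x)) + (S fun h => -(2 * ψ (a h x)))
      ≤ (S fun h => 2 * K * a h x) + S fun h => -(2 * K * a h x) := fun x => by
    rw [← le_sub_iff_add_le]
    refine ciSup_le fun h => ?_
    rw [le_sub_iff_add_le, add_comm, ← le_sub_iff_add_le]
    refine ciSup_le fun h' => ?_
    have e1 := hSle (fun h => 2 * K * a h x) h
    have e2 := hSle (fun h => 2 * K * a h x) h'
    have e3 := hSle (fun h => -(2 * K * a h x)) h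
    have e4 := hSle (fun h => -(2 * K * a h x)) h'
    have e5 := (le_abs_self _).trans (hLip (a h x) (a h' x))
    rcases abs_cases (a h x - a h' x) with ⟨h5, _⟩ | ⟨h5, _⟩ <;> rw [h5] at e5 <;> nlinarith
  have hsm : Measurable fun x => ⨆ h, (u h + 2 * K * a h x) :=
    Measurable.iSup fun h => ((ham h).const_mul _).const_add _
  have hneg : ∀ x, (⨆ h, (u h + 2 * K * a h (-x))) = S fun h => -(2 * K * a h x) := fun x => by
    simp only [hS, hodd, mul_neg]
  rw [integral_symmetrizedLaw hsm hi3 (by simpa only [hneg] using hi4)]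
  simp only [hneg]
  calc _ ≤ ∫ x, ((S fun h => 2 * ∫ x', ψ (a h x') ∂μ) + S fun h => -(2 * ψ (a h x))) / 2 ∂μ :=
        integral_mono hi5 (((integrable_const _).add hi2).div_const 2) h2
    _ = ((S fun h => 2 * ∫ x', ψ (a h x') ∂μ) + ∫ x, (S fun h => -(2 * ψ (a h x))) ∂μ) / 2 := by
        rw [integral_div, integral_add (integrable_const _) hi2]; simp
    _ ≤ ((∫ x, (S fun h => 2 * ψ (a h x)) ∂μ) + ∫ x, (S fun h => -(2 * ψ (a h x))) ∂μ) / 2 := by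
        gcongr
    _ = (∫ x, ((S fun h => 2 * ψ (a h x)) + S fun h => -(2 * ψ (a h x))) ∂μ) / 2 := by
        rw [integral_add hi1 hi2]
    _ ≤ (∫ x, ((S fun h => 2 * K * a h x) + S fun h => -(2 * K * a h x)) ∂μ) / 2 := by
        exact div_le_div_of_nonneg_right (integral_mono (hi1.add hi2) (hi3.add hi4) h3) (by norm_num)
    _ = _ := by rw [integral_add hi3 hi4]

/-- Symmetrization and contraction for empirical processes over a finite class. -/
theorem integral_pi_ciSup_le_symmetrizedLaw {a : ι → V → ℝ} (ham : ∀ h, Measurable (a h))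
    (hai : ∀ h, Integrable (a h) μ) (hodd : ∀ h x, a h (-x) = -a h x) {ψ : ℝ → ℝ}
    (hψm : Measurable ψ) (hψ : ∀ s, ψ s ∈ Set.Icc (0 : ℝ) 1) {K : ℝ}
    (hLip : ∀ s t, |ψ s - ψ t| ≤ K * |s - t|) (n : ℕ) (u : ι → ℝ) :
    ∫ ω, ⨆ h, (u h + ∑ i, (∫ x', ψ (a h x') ∂μ - ψ (a h (ω i)))) ∂(Measure.pi fun _ : Fin n => μ)
      ≤ ∫ ω, ⨆ h, (u h + ∑ i, 2 * K * a h (ω i))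
          ∂(Measure.pi fun _ : Fin n => symmetrizedLaw μ) := by
  have hais : ∀ h, Integrable (a h) (symmetrizedLaw μ) := fun h =>
    integrable_symmetrizedLaw (ham h) (hai h) (by simp only [hodd]; exact (hai h).neg)
  have hψa : ∀ h, Measurable fun x => ψ (a h x) := fun h => hψm.comp (ham h)
  have hψi : ∀ h, Integrable (fun x => ψ (a h x)) μ := fun h =>
    Integrable.of_mem_Icc 0 1 (hψa h).aemeasurable (.of_forall fun x => hψ _)
  have hIl : ∀ (n : ℕ) (u : ι → ℝ), Integrable (fun ω : Fin n → V =>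
      ⨆ h, (u h + ∑ i, (∫ x', ψ (a h x') ∂μ - ψ (a h (ω i))))) (Measure.pi fun _ => μ) :=
    fun n u => integrable_ciSup
      (fun h => (Finset.measurable_sum _ fun i _ =>
        ((hψa h).comp (measurable_pi_apply i)).const_sub _).const_add _)
      fun h => (integrable_const _).add (integrable_finsetSum _ fun i _ =>
        (integrable_const _).sub
          (integrable_comp_eval (μ := fun _ => μ) (i := i) (f := fun x => ψ (a h x)) (hψi h)))
  have hIr : ∀ (n : ℕ) (u : ι → ℝ), Integrable (fun ω : Fin n → V =>
      ⨆ h, (u h + ∑ i, 2 * K * a h (ω i))) (Measure.pi fun _ => symmetrizedLaw μ) :=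
    fun n u => integrable_ciSup
      (fun h => (Finset.measurable_sum _ fun i _ =>
        ((ham h).comp (measurable_pi_apply i)).const_mul _).const_add _)
      fun h => (integrable_const _).add (integrable_finsetSum _ fun i _ =>
        (integrable_comp_eval (μ := fun _ => symmetrizedLaw μ) (i := i) (hais h)).const_mul _)
  induction n generalizing u with
  | zero => simp
  | succ n ih =>
    obtain ⟨hl1, hl2⟩ := integral_pi_succ (hIl (n + 1) u)
    obtain ⟨hr1, hr2⟩ := integral_pi_succ (hIr (n + 1) u)
    rw [hl2, hr2]
    simp only [Fin.sum_univ_succ, Fin.cons_zero, Fin.cons_succ] at hl1 hr1 ⊢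
    set π := Measure.pi fun _ : Fin n => symmetrizedLaw μ
    have hmix : Integrable (fun z : V × (Fin n → V) =>
        ⨆ h, (u h + (∫ x', ψ (a h x') ∂μ - ψ (a h z.1)) + ∑ i, 2 * K * a h (z.2 i)))
        (μ.prod π) := by
      refine integrable_ciSup (fun h => ?_) fun h => ?_
      · exact (((((hψa h).comp measurable_fst).const_sub _).const_add _)).add
          (Finset.measurable_sum _ fun i _ =>
            by have := ham h; fun_prop)
      · have k1 : Integrable (fun z : V × (Fin n → V) => ψ (a h z.1)) (μ.prod π) :=
          (hψi h).comp_fst π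
        have k2 : Integrable (fun z : V × (Fin n → V) => ∑ i, 2 * K * a h (z.2 i)) (μ.prod π) :=
          (integrable_finsetSum Finset.univ fun i _ =>
            (integrable_comp_eval (μ := fun _ => symmetrizedLaw μ) (i := i) (hais h)).const_mul (2 * K)).comp_snd μ
        exact ((integrable_const _).add ((integrable_const _).sub k1)).add k2
    -- Coordinates are replaced one group at a time. The coordinates not being treated are frozen
    -- and absorbed into the offset u, which is why u is arbitrary in the induction.
    calc _ ≤ ∫ x, ∫ y, ⨆ h, (u h + (∫ x', ψ (a h x') ∂μ - ψ (a h x))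
            + ∑ i, 2 * K * a h (y i)) ∂π ∂μ := by
          refine integral_mono hl1.integral_prod_left hmix.integral_prod_left fun x => ?_
          have := ih (fun h => u h + (∫ x', ψ (a h x') ∂μ - ψ (a h x)))
          simpa only [add_assoc] using this
      _ = ∫ y, ∫ x, ⨆ h, (u h + (∫ x', ψ (a h x') ∂μ - ψ (a h x))
            + ∑ i, 2 * K * a h (y i)) ∂μ ∂π := integral_integral_swap hmix
      _ ≤ ∫ y, ∫ x, ⨆ h, (u h + (2 * K * a h x + ∑ i, 2 * K * a h (y i)))
            ∂(symmetrizedLaw μ) ∂π := by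
          refine integral_mono hmix.integral_prod_right hr1.integral_prod_right fun y => ?_
          have := integral_ciSup_le_symmetrizedLaw ham hai hodd hψm hψ hLip
            (fun h => u h + ∑ i, 2 * K * a h (y i))
          have e1 : ∀ x h, u h + (∫ x', ψ (a h x') ∂μ - ψ (a h x)) + ∑ i, 2 * K * a h (y i)
              = u h + ∑ i, 2 * K * a h (y i) + (∫ x', ψ (a h x') ∂μ - ψ (a h x)) :=
            fun x h => by ring
          have e2 : ∀ x h, u h + (2 * K * a h x + ∑ i, 2 * K * a h (y i))
              = u h + ∑ i, 2 * K * a h (y i) + 2 * K * a h x := fun x h => by ring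
          simp only [e1, e2]
          exact this
      _ = _ := (integral_integral_swap hr1).symm

end Symmetrization

/-! ### Comparison with Gaussian moments -/

theorem sum_range_two_mul_add_one_of_odd_eq_zero (f : ℕ → ℝ) (hf : ∀ i, Odd i → f i = 0) (l : ℕ) :
    ∑ i ∈ Finset.range (2 * l + 1), f i = ∑ r ∈ Finset.range (l + 1), f (2 * r) := by
  induction l with
  | zero => simp
  | succ l ih =>
    rw [show 2 * (l + 1) + 1 = 2 * l + 1 + 1 + 1 by ring, Finset.sum_range_succ,
      Finset.sum_range_succ, ih, Finset.sum_range_succ _ (l + 1), hf (2 * l + 1) ⟨l, rfl⟩]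
    rw [show 2 * l + 1 + 1 = 2 * (l + 1) by ring]
    ring

/-- The moments of order `2l` of a centered Gaussian variable of variance `v`. -/
noncomputable def gaussMoment (v : ℝ) (l : ℕ) : ℝ := (2 * l)! / (2 ^ l * l !) * v ^ l

/-- The moment identity for a sum of two independent centred Gaussians of variances v and w. It
makes Gaussian moment bounds stable under independent symmetric sums. -/
theorem sum_choose_mul_gaussMoment (v w : ℝ) (l : ℕ) :
    ∑ r ∈ Finset.range (l + 1), ((2 * l).choose (2 * r) : ℝ)
      * (gaussMoment v r * gaussMoment w (l - r)) = gaussMoment (v + w) l := by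
  rw [gaussMoment, add_pow, Finset.mul_sum]
  refine Finset.sum_congr rfl fun r hr => ?_
  have hr' : r ≤ l := Nat.lt_succ_iff.1 (Finset.mem_range.1 hr)
  obtain ⟨m, rfl⟩ := Nat.exists_eq_add_of_le hr'
  have h1 : (((2 * (r + m)).choose (2 * r) : ℕ) : ℝ) * ((2 * r)! : ℝ) * ((2 * m)! : ℝ)
      = ((2 * (r + m))! : ℝ) := by
    rw [show 2 * (r + m) = 2 * r + 2 * m by ring]
    have := Nat.choose_mul_factorial_mul_factorial (Nat.le_add_right (2 * r) (2 * m))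
    rw [Nat.add_sub_cancel_left] at this
    exact_mod_cast this
  have h2 : (((r + m).choose r : ℕ) : ℝ) * (r ! : ℝ) * (m ! : ℝ) = ((r + m)! : ℝ) := by
    have := Nat.choose_mul_factorial_mul_factorial (Nat.le_add_right r m)
    rw [Nat.add_sub_cancel_left] at this
    exact_mod_cast this
  have a1 : (r ! : ℝ) ≠ 0 := by positivity
  have a2 : (m ! : ℝ) ≠ 0 := by positivity
  have a3 : ((r + m)! : ℝ) ≠ 0 := by positivity
  rw [Nat.add_sub_cancel_left, gaussMoment, gaussMoment, ← h1]
  have h3 : (((r + m).choose r : ℕ) : ℝ) = ((r + m)! : ℝ) / ((r ! : ℝ) * (m ! : ℝ)) := by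
    rw [← h2]; field_simp
  rw [h3, pow_add]
  field_simp

theorem gaussMoment_nonneg {v : ℝ} (hv : 0 ≤ v) (l : ℕ) : 0 ≤ gaussMoment v l := by
  unfold gaussMoment; positivity

theorem gaussMoment_le {v : ℝ} (hv : 0 ≤ v) (l : ℕ) : gaussMoment v l ≤ (l * v) ^ l := by
  have h : ((2 * l)! : ℝ) ≤ (2 * l) ^ l * l ! := by exact_mod_cast Nat.factorial_two_mul_le l
  unfold gaussMoment
  rw [mul_pow]
  gcongr
  rw [div_le_iff₀ (by positivity)]
  calc ((2 * l)! : ℝ) ≤ (2 * l) ^ l * l ! := h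
    _ = _ := by rw [mul_pow]; ring

/-- Since (2l)!/l! ≥ l^l, moment bounds of subgaussian type become bounds by Gaussian moments at the
price of a factor 4 in the variance. -/
theorem le_gaussMoment {v : ℝ} (hv : 0 ≤ v) (l : ℕ) : (2 * l * v) ^ l ≤ gaussMoment (4 * v) l := by
  have h : (l ! : ℝ) * (l : ℝ) ^ l ≤ (2 * l)! := by
    have h1 : l ! * (l + 1) ^ l ≤ (2 * l)! := by
      rw [two_mul]; exact Nat.factorial_mul_pow_le_factorial
    calc (l ! : ℝ) * (l : ℝ) ^ l ≤ (l ! : ℝ) * ((l : ℝ) + 1) ^ l := by gcongr; linarith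
      _ ≤ _ := by exact_mod_cast h1
  unfold gaussMoment
  rw [mul_pow 4 v, ← mul_assoc, mul_pow (2 * (l : ℝ)) v]
  gcongr
  rw [div_mul_eq_mul_div, le_div_iff₀ (by positivity), show (4 : ℝ) = 2 * 2 by norm_num, mul_pow,
    mul_pow]
  calc (2 : ℝ) ^ l * l ^ l * (2 ^ l * l !) = (l ! * l ^ l) * (2 ^ l * 2 ^ l) := by ring
    _ ≤ _ := by gcongr

/-- Sums of independent symmetric variables inherit Gaussian moment bounds. -/
theorem integral_pi_sum_pow_le_gaussMoment {V : Type*} [MeasurableSpace V] {ν : Measure V}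
    [IsProbabilityMeasure ν] {b : V → ℝ} {k : ℕ} {v : ℝ} (hv : 0 ≤ v)
    (hi : ∀ i ≤ 2 * k, Integrable (fun x => b x ^ i) ν)
    (hodd : ∀ i, Odd i → ∫ x, b x ^ i ∂ν = 0)
    (hb : ∀ l ≤ k, ∫ x, b x ^ (2 * l) ∂ν ≤ gaussMoment v l) (n : ℕ) :
    (∀ i ≤ 2 * k, Integrable (fun ω : Fin n → V => (∑ j, b (ω j)) ^ i) (Measure.pi fun _ => ν)) ∧
      ∀ l ≤ k, ∫ ω : Fin n → V, (∑ j, b (ω j)) ^ (2 * l) ∂(Measure.pi fun _ => ν)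
        ≤ gaussMoment (n * v) l := by
  induction n with
  | zero =>
    refine ⟨fun i _ => by simp, fun l _ => ?_⟩
    rcases Nat.eq_zero_or_pos l with rfl | hl
    · simp [gaussMoment]
    · simp [gaussMoment, hl.ne']
  | succ n ih =>
    obtain ⟨ih1, ih2⟩ := ih
    set π := Measure.pi fun _ : Fin n => ν
    have hexp : ∀ (i : ℕ) (x : V) (y : Fin n → V), (b x + ∑ j, b (y j)) ^ i
        = ∑ m ∈ Finset.range (i + 1), b x ^ m * (∑ j, b (y j)) ^ (i - m) * (i.choose m) :=
      fun i x y => add_pow _ _ _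
    have hterm : ∀ i ≤ 2 * k, ∀ m ∈ Finset.range (i + 1), Integrable (fun z : V × (Fin n → V) =>
        b z.1 ^ m * (∑ j, b (z.2 j)) ^ (i - m) * (i.choose m)) (ν.prod π) := fun i hik m hm => by
      have hm' := Finset.mem_range.1 hm
      exact ((hi m (by omega)).mul_prod (ih1 (i - m) (by omega))).mul_const _
    have hprodI : ∀ i ≤ 2 * k, Integrable (fun z : V × (Fin n → V) =>
        (b z.1 + ∑ j, b (z.2 j)) ^ i) (ν.prod π) := fun i hik => by
      simp only [hexp]
      exact integrable_finsetSum _ (hterm i hik)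
    have hI : ∀ i ≤ 2 * k, Integrable (fun ω : Fin (n + 1) → V => (∑ j, b (ω j)) ^ i)
        (Measure.pi fun _ => ν) := fun i hik => by
      have hmp := measurePreserving_piFinSuccAbove (fun _ : Fin (n + 1) => ν) 0
      have := (hmp.integrable_comp_emb (MeasurableEquiv.measurableEmbedding _)
        (g := fun z : V × (Fin n → V) => (b z.1 + ∑ j, b (z.2 j)) ^ i)).2 (hprodI i hik)
      refine this.congr (.of_forall fun ω => ?_)
      simp [MeasurableEquiv.piFinSuccAbove_apply, Fin.sum_univ_succ, Fin.insertNthEquiv, Fin.tail]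
    refine ⟨hI, fun l hl => ?_⟩
    obtain ⟨h1, h2⟩ := integral_pi_succ (hI (2 * l) (by omega))
    rw [h2]
    simp only [Fin.sum_univ_succ, Fin.cons_zero, Fin.cons_succ]
    rw [integral_integral (hprodI (2 * l) (by omega))]
    simp only [hexp]
    rw [integral_finsetSum _ (hterm (2 * l) (by omega))]
    have hpm : ∀ i m : ℕ, ∫ z : V × (Fin n → V), b z.1 ^ i * (∑ j, b (z.2 j)) ^ m ∂(ν.prod π)
        = (∫ x, b x ^ i ∂ν) * ∫ y : Fin n → V, (∑ j, b (y j)) ^ m ∂π := fun i m =>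
      integral_prod_mul (fun x => b x ^ i) fun y : Fin n → V => (∑ j, b (y j)) ^ m
    simp only [integral_mul_const, hpm]
    -- Odd moments vanish by symmetry, so only products of even moments survive; these are compared
    -- term by term.
    rw [sum_range_two_mul_add_one_of_odd_eq_zero _ (fun i hi => by rw [hodd i hi]; ring)]
    rw [show ((n + 1 : ℕ) : ℝ) * v = v + n * v by push_cast; ring, ← sum_choose_mul_gaussMoment]
    refine Finset.sum_le_sum fun r hr => ?_
    have hr' : r ≤ l := Nat.lt_succ_iff.1 (Finset.mem_range.1 hr)
    rw [mul_comm, show 2 * l - 2 * r = 2 * (l - r) by omega]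
    gcongr
    · exact integral_nonneg fun y => by rw [pow_mul]; positivity
    · exact gaussMoment_nonneg hv r
    · exact hb r (by omega)
    · exact ih2 (l - r) (by omega)

theorem integrable_pow_of_le {V : Type*} [MeasurableSpace V] {μ : Measure V} [IsFiniteMeasure μ]
    {b : V → ℝ} (hbm : Measurable b) {k i : ℕ} (hi : i ≤ 2 * k)
    (h : Integrable (fun x => b x ^ (2 * k)) μ) : Integrable (fun x => b x ^ i) μ := by
  refine ((integrable_const (1 : ℝ)).add h).mono' (hbm.pow_const i).aestronglyMeasurable
    (.of_forall fun x => ?_)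
  rw [norm_pow, Real.norm_eq_abs]
  have e1 : b x ^ (2 * k) = |b x| ^ (2 * k) := by rw [pow_mul, pow_mul, sq_abs]
  simp only [Pi.add_apply, e1]
  rcases le_or_gt |b x| 1 with h1 | h1
  · linarith [pow_le_one₀ (n := i) (abs_nonneg (b x)) h1, pow_nonneg (abs_nonneg (b x)) (2 * k)]
  · linarith [pow_le_pow_right₀ h1.le hi]

/-- Replaces the maximum of the coordinates by a sum, so that moments can be taken coordinatewise.
-/
theorem norm_pow_le_sum {d : ℕ} (x : Fin d → ℝ) {k : ℕ} (hk : 1 ≤ k) :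
    ‖x‖ ^ (2 * k) ≤ ∑ j, x j ^ (2 * k) := by
  have h0 : ∀ j, 0 ≤ x j ^ (2 * k) := fun j => by rw [pow_mul]; positivity
  rcases isEmpty_or_nonempty (Fin d) with h | h
  · have : x = 0 := Subsingleton.elim _ _
    simp [this, show k ≠ 0 by omega]
  · obtain ⟨j, hj⟩ := exists_eq_ciSup_of_finite (f := fun j => ‖x j‖)
    have hx : ‖x‖ = ‖x j‖ := by
      rw [hj]
      exact le_antisymm ((pi_norm_le_iff_of_nonneg (Real.iSup_nonneg fun _ => norm_nonneg _)).2
        fun i => le_ciSup_of_finite (fun j => ‖x j‖) i) (ciSup_le fun i => norm_le_pi_norm x i)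
    rw [hx, Real.norm_eq_abs, pow_mul, sq_abs, ← pow_mul]
    exact Finset.single_le_sum (f := fun j => x j ^ (2 * k)) (fun j _ => h0 j) (Finset.mem_univ j)

/-- The expected sup norm of a sum of independent symmetrized random vectors. -/
theorem integral_norm_sum_symmetrizedLaw_le {d : ℕ} {μ : Measure (Fin d → ℝ)}
    [IsProbabilityMeasure μ] {k : ℕ} (hk : 1 ≤ k) {s : ℝ} (hs : 0 < s)
    (hi : ∀ j, Integrable (fun x : Fin d → ℝ => x j ^ (2 * k)) μ)
    (hb : ∀ j, ∀ l ≤ k, ∫ x : Fin d → ℝ, x j ^ (2 * l) ∂μ ≤ gaussMoment (s ^ 2) l)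
    (hd : (d : ℝ) ≤ Real.exp (2 * k)) {N : ℕ} :
    Integrable (fun ω : Fin N → Fin d → ℝ => ‖∑ i, ω i‖) (Measure.pi fun _ => symmetrizedLaw μ) ∧
    ∫ ω : Fin N → Fin d → ℝ, ‖∑ i, ω i‖ ∂(Measure.pi fun _ => symmetrizedLaw μ)
      ≤ Real.exp 1 * (√(k * N) * s) := by
  set ν := symmetrizedLaw μ with hν
  set π := Measure.pi fun _ : Fin N => ν
  have hint : ∀ j, ∀ i ≤ 2 * k, Integrable (fun x : Fin d → ℝ => x j ^ i) μ := fun j i hik =>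
    integrable_pow_of_le (measurable_pi_apply j) hik (hi j)
  have hint' : ∀ j, ∀ i ≤ 2 * k, Integrable (fun x : Fin d → ℝ => (-x) j ^ i) μ := fun j i hik =>
    integrable_pow_of_le (measurable_pi_apply j).neg hik
      (by simpa [Even.neg_pow (even_two_mul k)] using hi j)
  have hintν : ∀ j, ∀ i ≤ 2 * k, Integrable (fun x : Fin d → ℝ => x j ^ i) ν := fun j i hik =>
    integrable_symmetrizedLaw (by fun_prop) (hint j i hik) (hint' j i hik)
  have hoddν : ∀ j i, Odd i → ∫ x : Fin d → ℝ, x j ^ i ∂ν = 0 := fun j i hodd => by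
    have hmap : ν.map Neg.neg = ν := by
      rw [hν, symmetrizedLaw, Measure.map_smul, Measure.map_add _ _ measurable_neg,
        Measure.map_map measurable_neg measurable_neg]
      simp [add_comm]
    have h := integral_map (μ := ν) measurable_neg.aemeasurable
      (f := fun x : Fin d → ℝ => x j ^ i)
      ((measurable_pi_apply j).pow_const i).aestronglyMeasurable
    rw [hmap] at h
    simp only [Pi.neg_apply, hodd.neg_pow, integral_neg] at h
    linarith
  have hbν : ∀ j, ∀ l ≤ k, ∫ x : Fin d → ℝ, x j ^ (2 * l) ∂ν ≤ gaussMoment (s ^ 2) l :=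
    fun j l hl => by
      rw [hν, integral_symmetrizedLaw (by fun_prop) (hint j _ (by omega)) (hint' j _ (by omega))]
      simp only [Pi.neg_apply, Even.neg_pow (even_two_mul l)]
      linarith [hb j l hl]
  have hmom := fun j => integral_pi_sum_pow_le_gaussMoment (sq_nonneg s) (hintν j) (hoddν j)
    (hbν j) N
  have hpow : ∀ ω : Fin N → Fin d → ℝ, ‖∑ i, ω i‖ ^ (2 * k) ≤ ∑ j, (∑ i, ω i j) ^ (2 * k) :=
    fun ω => by simpa using norm_pow_le_sum (∑ i, ω i) hk
  have hsumI : Integrable (fun ω : Fin N → Fin d → ℝ => ∑ j, (∑ i, ω i j) ^ (2 * k)) π :=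
    integrable_finsetSum _ fun j _ => (hmom j).1 (2 * k) le_rfl
  have hnm : Measurable fun ω : Fin N → Fin d → ℝ => ‖∑ i, ω i‖ := by fun_prop
  have hI2k : Integrable (fun ω : Fin N → Fin d → ℝ => ‖∑ i, ω i‖ ^ (2 * k)) π :=
    hsumI.mono' (by fun_prop) (.of_forall fun ω => by
      rw [Real.norm_of_nonneg (by positivity)]; exact hpow ω)
  have hI1 : Integrable (fun ω : Fin N → Fin d → ℝ => ‖∑ i, ω i‖) π := by
    simpa using integrable_pow_of_le hnm (show 1 ≤ 2 * k by omega) hI2k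
  refine ⟨hI1, ?_⟩
  have hJ := (Even.convexOn_pow (𝕜 := ℝ) (even_two_mul k)).map_integral_le
    (μ := π) (f := fun ω : Fin N → Fin d → ℝ => ‖∑ i, ω i‖)
    (by fun_prop) isClosed_univ (.of_forall fun _ => Set.mem_univ _) hI1 hI2k
  -- After Jensen's inequality, 2k-th powers are compared. Summing over coordinates costs d ≤
  -- e^(2k), whose 2k-th root is the factor e in the bound.
  refine le_of_pow_le_pow_left₀ (show 2 * k ≠ 0 by omega) (by positivity) (hJ.trans ?_)
  calc ∫ ω : Fin N → Fin d → ℝ, ‖∑ i, ω i‖ ^ (2 * k) ∂π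
      ≤ ∫ ω : Fin N → Fin d → ℝ, ∑ j, (∑ i, ω i j) ^ (2 * k) ∂π :=
        integral_mono hI2k hsumI hpow
    _ = ∑ j : Fin d, ∫ ω : Fin N → Fin d → ℝ, (∑ i, ω i j) ^ (2 * k) ∂π :=
        integral_finsetSum _ fun j _ => (hmom j).1 (2 * k) le_rfl
    _ ≤ ∑ _j : Fin d, (k * (N * s ^ 2)) ^ k := Finset.sum_le_sum fun j _ =>
        ((hmom j).2 k le_rfl).trans (gaussMoment_le (by positivity) k)
    _ = d * (k * (N * s ^ 2)) ^ k := by simp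
    _ ≤ Real.exp (2 * k) * (k * (N * s ^ 2)) ^ k := by gcongr
    _ = _ := by
        have e1 : (√(k * N) * s) ^ (2 * k) = (k * (N * s ^ 2)) ^ k := by
          rw [pow_mul, mul_pow, Real.sq_sqrt (by positivity), mul_assoc]
        rw [mul_pow (Real.exp 1), e1, ← Real.exp_nat_mul, mul_one]
        push_cast; rfl

/-! ### The small-ball lower bound -/

/-- A Lipschitz minorant of the indicator of `{|s| ≥ κ / 2}` above the indicator of `{|s| ≥ κ}`. -/
noncomputable def clippedSq (κ s : ℝ) : ℝ := min (|s| / κ) 1 ^ 2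

theorem clippedSq_mem_Icc {κ : ℝ} (hκ : 0 < κ) (s : ℝ) : clippedSq κ s ∈ Set.Icc (0 : ℝ) 1 :=
  ⟨sq_nonneg _, pow_le_one₀ (le_min (by positivity) zero_le_one) (min_le_right _ _)⟩

theorem continuous_clippedSq (κ : ℝ) : Continuous (clippedSq κ) := by
  unfold clippedSq; fun_prop

/-- This converts a lower bound on the empirical sum of `clippedSq` into one on the quadratic form;
`clippedSq_eq_one` in turn bounds its expectation below by the small-ball probability. -/
theorem clippedSq_le {κ : ℝ} (hκ : 0 < κ) (s : ℝ) : κ ^ 2 * clippedSq κ s ≤ s ^ 2 := by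
  have h : min (|s| / κ) 1 ^ 2 ≤ (|s| / κ) ^ 2 :=
    pow_le_pow_left₀ (le_min (by positivity) zero_le_one) (min_le_left _ _) 2
  rw [clippedSq]
  calc κ ^ 2 * min (|s| / κ) 1 ^ 2 ≤ κ ^ 2 * (|s| / κ) ^ 2 := by gcongr
    _ = s ^ 2 := by rw [div_pow, sq_abs]; field_simp

theorem clippedSq_eq_one {κ : ℝ} (hκ : 0 < κ) {s : ℝ} (hs : κ ≤ |s|) : clippedSq κ s = 1 := by
  rw [clippedSq, min_eq_right ((one_le_div hκ).2 hs), one_pow]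

theorem abs_clippedSq_sub_le {κ : ℝ} (hκ : 0 < κ) (s t : ℝ) :
    |clippedSq κ s - clippedSq κ t| ≤ 2 / κ * |s - t| := by
  have hs0 : 0 ≤ min (|s| / κ) 1 := le_min (by positivity) zero_le_one
  have ht0 : 0 ≤ min (|t| / κ) 1 := le_min (by positivity) zero_le_one
  have hs1 : min (|s| / κ) 1 ≤ 1 := min_le_right _ _
  have ht1 : min (|t| / κ) 1 ≤ 1 := min_le_right _ _
  have h1 : |min (|s| / κ) 1 - min (|t| / κ) 1| ≤ |s - t| / κ := by
    refine (abs_min_sub_min_le_max _ _ _ _).trans ?_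
    rw [sub_self, abs_zero, ← sub_div, abs_div, abs_of_pos hκ, max_eq_left (by positivity)]
    exact div_le_div_of_nonneg_right (abs_abs_sub_abs_le_abs_sub s t) hκ.le
  rw [clippedSq, clippedSq, sq_sub_sq, abs_mul, abs_of_nonneg (by linarith)]
  calc (min (|s| / κ) 1 + min (|t| / κ) 1) * |min (|s| / κ) 1 - min (|t| / κ) 1|
      ≤ 2 * (|s - t| / κ) := by gcongr; linarith
    _ = _ := by ring

theorem abs_dotProduct_le_norm_mul_ell1 {d : ℕ} (x h : Fin d → ℝ) : |x ⬝ᵥ h| ≤ ‖x‖ * ell1 h := by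
  rw [dotProduct, ell1, Finset.mul_sum]
  refine (Finset.abs_sum_le_sum_abs _ _).trans (Finset.sum_le_sum fun j _ => ?_)
  rw [abs_mul]
  gcongr
  exact norm_le_pi_norm x j

theorem measurable_dotProduct_const {d : ℕ} (h : Fin d → ℝ) :
    Measurable fun x : Fin d → ℝ => x ⬝ᵥ h := by
  unfold dotProduct; fun_prop

/-- The small-ball lower bound, uniformly over a finite class of linear functionals. -/
theorem measureReal_smallBall_finite_le {d : ℕ} {μ : Measure (Fin d → ℝ)}
    [IsProbabilityMeasure μ] {k : ℕ} (hk : 1 ≤ k) {s : ℝ} (hs : 0 < s)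
    (hi : ∀ j, Integrable (fun x : Fin d → ℝ => x j ^ (2 * k)) μ)
    (hb : ∀ j, ∀ l ≤ k, ∫ x : Fin d → ℝ, x j ^ (2 * l) ∂μ ≤ gaussMoment (s ^ 2) l)
    (hd : (d : ℝ) ≤ Real.exp (2 * k)) {N : ℕ} {κ ε ρ : ℝ} (hκ : 0 < κ) (hε : 0 < ε) (hρ : 0 ≤ ρ)
    (hρN : 4 / κ * ρ * (Real.exp 1 * (√(k * N) * s)) ≤ ε / 4 * N)
    {ι : Type*} [Finite ι] [Nonempty ι] {H : ι → Fin d → ℝ} (hH : ∀ h, ell1 (H h) ≤ ρ)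
    (hsb : ∀ h, ε ≤ μ.real {x | κ ≤ |x ⬝ᵥ H h|}) :
    (Measure.pi fun _ : Fin N => μ).real
      {ω | ∃ h, ∑ i, clippedSq κ (ω i ⬝ᵥ H h) < ε / 4 * N} ≤ Real.exp (-(ε ^ 2 * N / 2)) := by
  have ham : ∀ h, Measurable fun x : Fin d → ℝ => x ⬝ᵥ H h := fun h => measurable_dotProduct_const _
  have hai : ∀ h, Integrable (fun x : Fin d → ℝ => x ⬝ᵥ H h) μ := fun h => by
    unfold dotProduct
    refine integrable_finsetSum _ fun j _ => Integrable.mul_const ?_ _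
    simpa using integrable_pow_of_le (measurable_pi_apply j) (show 1 ≤ 2 * k by omega) (hi j)
  have hψm : Measurable (clippedSq κ) := (continuous_clippedSq κ).measurable
  have hψa : ∀ h, Measurable fun x : Fin d → ℝ => clippedSq κ (x ⬝ᵥ H h) := fun h =>
    hψm.comp (ham h)
  have hψi : ∀ h, Integrable (fun x : Fin d → ℝ => clippedSq κ (x ⬝ᵥ H h)) μ := fun h =>
    Integrable.of_mem_Icc 0 1 (hψa h).aemeasurable (.of_forall fun x => clippedSq_mem_Icc hκ _)
  set m : ι → ℝ := fun h => ∫ x, clippedSq κ (x ⬝ᵥ H h) ∂μ with hm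
  have hm1 : ∀ h, m h ∈ Set.Icc (0 : ℝ) 1 := fun h =>
    ⟨integral_nonneg fun x => (clippedSq_mem_Icc hκ _).1, by
      simpa using integral_mono (hψi h) (integrable_const 1) fun x => (clippedSq_mem_Icc hκ _).2⟩
  have hmε : ∀ h, ε ≤ m h := fun h => by
    refine (hsb h).trans ?_
    have hS : MeasurableSet {x : Fin d → ℝ | κ ≤ |x ⬝ᵥ H h|} :=
      measurableSet_le measurable_const (ham h).abs
    rw [← integral_indicator_one hS]
    refine integral_mono ((integrable_const (1 : ℝ)).indicator hS) (hψi h) fun x => ?_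
    by_cases hx : x ∈ {x : Fin d → ℝ | κ ≤ |x ⬝ᵥ H h|}
    · rw [Set.indicator_of_mem hx]; exact (clippedSq_eq_one hκ hx).ge
    · rw [Set.indicator_of_notMem hx]; exact (clippedSq_mem_Icc hκ _).1
  set f : (Fin N → Fin d → ℝ) → ℝ :=
    fun ω => ⨆ h, ∑ i, (m h - clippedSq κ (ω i ⬝ᵥ H h)) with hf
  have hfle : ∀ ω h, ∑ i, (m h - clippedSq κ (ω i ⬝ᵥ H h)) ≤ f ω := fun ω h =>
    le_ciSup_of_finite (fun h => ∑ i, (m h - clippedSq κ (ω i ⬝ᵥ H h))) h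
  have hfm : Measurable f := Measurable.iSup fun h => Finset.measurable_sum _ fun i _ =>
    ((hψa h).comp (measurable_pi_apply i)).const_sub _
  have hterm : ∀ (x : Fin d → ℝ) h, m h - clippedSq κ (x ⬝ᵥ H h) ∈ Set.Icc (-1 : ℝ) 1 :=
    fun x h => by
      have h1 := hm1 h
      have h2 := clippedSq_mem_Icc hκ (x ⬝ᵥ H h)
      exact ⟨by linarith [h1.1, h2.2], by linarith [h1.2, h2.1]⟩
  have hfab : ∀ ω, f ω ∈ Set.Icc (-(N : ℝ)) N := fun ω => by
    constructor
    · obtain ⟨h⟩ := ‹Nonempty ι›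
      refine le_trans ?_ (hfle ω h)
      simpa using Finset.card_nsmul_le_sum Finset.univ
        (fun i => m h - clippedSq κ (ω i ⬝ᵥ H h)) (-1) fun i _ => (hterm _ h).1
    · refine ciSup_le fun h => ?_
      simpa using Finset.sum_le_card_nsmul Finset.univ
        (fun i => m h - clippedSq κ (ω i ⬝ᵥ H h)) 1 fun i _ => (hterm _ h).2
  have hdiff1 : ∀ ω i e, f ω ≤ f (Function.update ω i e) + 1 := fun ω i e => by
    refine ciSup_le fun h => ?_
    have h1 := hfle (Function.update ω i e) h
    have h2 : ∑ i', (m h - clippedSq κ (ω i' ⬝ᵥ H h))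
        - ∑ i', (m h - clippedSq κ (Function.update ω i e i' ⬝ᵥ H h))
        = clippedSq κ (e ⬝ᵥ H h) - clippedSq κ (ω i ⬝ᵥ H h) := by
      rw [← Finset.sum_sub_distrib, Finset.sum_eq_single i]
      · simp
      · intro j _ hj; simp [Function.update_of_ne hj]
      · simp
    have h3 := (clippedSq_mem_Icc hκ (e ⬝ᵥ H h)).2
    have h4 := (clippedSq_mem_Icc hκ (ω i ⬝ᵥ H h)).1
    linarith
  have hdiff : ∀ ω i e, |f ω - f (Function.update ω i e)| ≤ 1 := fun ω i e => by
    rw [abs_le]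
    have h1 := hdiff1 ω i e
    have h2 := hdiff1 (Function.update ω i e) i (ω i)
    rw [Function.update_idem, Function.update_eq_self] at h2
    constructor <;> linarith
  -- The budget for the means, which total at least εN: the expected supremum of the deviations
  -- takes εN/4, its fluctuation εN/2, and εN/4 remains.
  have hmc := measureReal_pi_ge_le_of_bounded_differences (μ := μ) hfm hfab hdiff hε
  have hEf : ∫ ω, f ω ∂(Measure.pi fun _ => μ) ≤ ε / 4 * N := by
    have hsym := integral_pi_ciSup_le_symmetrizedLaw (μ := μ) ham hai
      (fun h x => by simp) hψm (clippedSq_mem_Icc hκ) (abs_clippedSq_sub_le hκ) N (fun _ => 0)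
    simp only [zero_add] at hsym
    obtain ⟨hnI, hnb⟩ := integral_norm_sum_symmetrizedLaw_le hk hs hi hb hd (N := N)
    refine hsym.trans (le_trans ?_ hρN)
    have hpt : ∀ ω : Fin N → Fin d → ℝ, (⨆ h, ∑ i, 2 * (2 / κ) * (ω i ⬝ᵥ H h))
        ≤ 4 / κ * ρ * ‖∑ i, ω i‖ := fun ω => by
      refine ciSup_le fun h => ?_
      rw [← Finset.mul_sum, ← sum_dotProduct]
      have h1 := (le_abs_self _).trans (abs_dotProduct_le_norm_mul_ell1 (∑ i, ω i) (H h))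
      calc 2 * (2 / κ) * ((∑ i, ω i) ⬝ᵥ H h) ≤ 2 * (2 / κ) * (‖∑ i, ω i‖ * ρ) := by
            gcongr
            exact h1.trans (by gcongr; exact hH h)
        _ = _ := by ring
    have hIs : Integrable (fun ω : Fin N → Fin d → ℝ => ⨆ h, ∑ i, 2 * (2 / κ) * (ω i ⬝ᵥ H h))
        (Measure.pi fun _ => symmetrizedLaw μ) :=
      integrable_ciSup (fun h => Finset.measurable_sum _ fun i _ =>
          ((ham h).comp (measurable_pi_apply i)).const_mul _)
        fun h => integrable_finsetSum _ fun i _ => (integrable_comp_eval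
          (μ := fun _ => symmetrizedLaw μ) (i := i) (integrable_symmetrizedLaw (ham h) (hai h)
            (by simp only [neg_dotProduct]; exact (hai h).neg))).const_mul _
    calc _ ≤ ∫ ω : Fin N → Fin d → ℝ, 4 / κ * ρ * ‖∑ i, ω i‖
          ∂(Measure.pi fun _ => symmetrizedLaw μ) := integral_mono hIs (hnI.const_mul _) hpt
      _ ≤ _ := by rw [integral_const_mul]; gcongr
  refine (measureReal_mono ?_ (measure_ne_top _ _)).trans hmc
  rintro ω ⟨h, hω⟩
  have h1 := hfle ω h
  rw [Finset.sum_sub_distrib] at h1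
  simp only [Finset.sum_const, Finset.card_univ, Fintype.card_fin, nsmul_eq_mul] at h1
  have h2 : N * ε ≤ N * m h := by gcongr; exact hmε h
  show _ ≤ f ω
  linarith

/-- The small-ball lower bound, uniformly over a class of linear functionals. -/
theorem measure_smallBall_le {d : ℕ} {μ : Measure (Fin d → ℝ)}
    [IsProbabilityMeasure μ] {k : ℕ} (hk : 1 ≤ k) {s : ℝ} (hs : 0 < s)
    (hi : ∀ j, Integrable (fun x : Fin d → ℝ => x j ^ (2 * k)) μ)
    (hb : ∀ j, ∀ l ≤ k, ∫ x : Fin d → ℝ, x j ^ (2 * l) ∂μ ≤ gaussMoment (s ^ 2) l)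
    (hd : (d : ℝ) ≤ Real.exp (2 * k)) {N : ℕ} {κ ε ρ : ℝ} (hκ : 0 < κ) (hε : 0 < ε) (hρ : 0 ≤ ρ)
    (hρN : 4 / κ * ρ * (Real.exp 1 * (√(k * N) * s)) ≤ ε / 4 * N)
    {H : Set (Fin d → ℝ)} (hH : ∀ h ∈ H, ell1 h ≤ ρ)
    (hsb : ∀ h ∈ H, ε ≤ μ.real {x | κ ≤ |x ⬝ᵥ h|}) :
    MeasurableSet {ω : Fin N → Fin d → ℝ | ∃ h ∈ H, ∑ i, clippedSq κ (ω i ⬝ᵥ h) < ε / 4 * N} ∧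
    (Measure.pi fun _ : Fin N => μ).real
      {ω | ∃ h ∈ H, ∑ i, clippedSq κ (ω i ⬝ᵥ h) < ε / 4 * N} ≤ Real.exp (-(ε ^ 2 * N / 2)) := by
  rcases H.eq_empty_or_nonempty with rfl | hne
  · simp [Real.exp_nonneg]
  have : Nonempty H := hne.to_subtype
  -- The strict inequality is an open condition in h, so a countable dense sequence already
  -- witnesses failure. The failure event is therefore an increasing union of events for finite
  -- classes, which gives both measurability and the same bound.
  set D : ℕ → H := TopologicalSpace.denseSeq H with hD
  have hcont : ∀ ω : Fin N → Fin d → ℝ,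
      Continuous fun h : H => ∑ i, clippedSq κ (ω i ⬝ᵥ (h : Fin d → ℝ)) := fun ω => by
    refine continuous_finsetSum _ fun i _ => (continuous_clippedSq κ).comp ?_
    exact continuous_finsetSum _ fun j _ =>
      continuous_const.mul ((continuous_apply j).comp continuous_subtype_val)
  set B : ℕ → Set (Fin N → Fin d → ℝ) := fun n =>
    {ω | ∃ j : Fin (n + 1), ∑ i, clippedSq κ (ω i ⬝ᵥ (D j : Fin d → ℝ)) < ε / 4 * N} with hB
  have hEq : {ω : Fin N → Fin d → ℝ | ∃ h ∈ H, ∑ i, clippedSq κ (ω i ⬝ᵥ h) < ε / 4 * N}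
      = ⋃ n, B n := by
    ext ω
    simp only [hB, Set.mem_iUnion, Set.mem_ofPred_eq]
    constructor
    · rintro ⟨h, hh, hlt⟩
      have hopen : IsOpen {h : H | ∑ i, clippedSq κ (ω i ⬝ᵥ (h : Fin d → ℝ)) < ε / 4 * N} :=
        isOpen_lt (hcont ω) continuous_const
      obtain ⟨_, ⟨hy1, ⟨n, rfl⟩⟩⟩ := (TopologicalSpace.denseRange_denseSeq H).inter_open_nonempty _
        hopen ⟨⟨h, hh⟩, hlt⟩
      exact ⟨n, ⟨n, Nat.lt_succ_self n⟩, hy1⟩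
    · rintro ⟨n, j, hlt⟩
      exact ⟨D j, (D j).2, hlt⟩
  have hBm : ∀ n, MeasurableSet (B n) := fun n => by
    have : B n = ⋃ j : Fin (n + 1),
        {ω | ∑ i, clippedSq κ (ω i ⬝ᵥ (D j : Fin d → ℝ)) < ε / 4 * N} := by
      ext ω; simp [hB]
    rw [this]
    refine MeasurableSet.iUnion fun j => measurableSet_lt (Finset.measurable_sum _ fun i _ =>
      ((continuous_clippedSq κ).measurable.comp ((measurable_dotProduct_const _).comp
        (measurable_pi_apply i)))) measurable_const
  have hmono : Monotone B := fun n n' hnn ω ⟨j, hj⟩ => ⟨⟨j, by omega⟩, hj⟩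
  rw [hEq]
  refine ⟨MeasurableSet.iUnion hBm, ?_⟩
  have hfin : ∀ n, (Measure.pi fun _ : Fin N => μ) (B n)
      ≤ ENNReal.ofReal (Real.exp (-(ε ^ 2 * N / 2))) := fun n => by
    rw [← ENNReal.ofReal_toReal (measure_ne_top (Measure.pi fun _ : Fin N => μ) (B n))]
    exact ENNReal.ofReal_le_ofReal (measureReal_smallBall_finite_le hk hs hi hb hd hκ hε hρ hρN
      (H := fun j : Fin (n + 1) => (D j : Fin d → ℝ)) (fun j => hH _ (D j).2)
      fun j => hsb _ (D j).2)
  rw [Measure.real, hmono.measure_iUnion]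
  exact ENNReal.toReal_le_of_le_ofReal (Real.exp_nonneg _) (iSup_le hfin)

end

/-! ### Deterministic analysis of the LASSO and the excess risk -/

theorem ell1_nonneg {d : ℕ} (t : Fin d → ℝ) : 0 ≤ ell1 t :=
  Finset.sum_nonneg fun _ _ => abs_nonneg _

theorem ell1_sub_le {d : ℕ} (s t : Fin d → ℝ) : ell1 (s - t) ≤ ell1 s + ell1 t := by
  rw [ell1, ell1, ell1, ← Finset.sum_add_distrib]
  exact Finset.sum_le_sum fun j _ => abs_sub _ _

theorem ell1_smul {d : ℕ} (c : ℝ) (t : Fin d → ℝ) : ell1 (c • t) = |c| * ell1 t := by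
  simp [ell1, abs_mul, Finset.mul_sum]

/-- The basic inequality for the LASSO when the penalty dominates the multiplier process. -/
theorem IsLasso.basic_inequality {N d : ℕ} (hN : 0 < N) {x : Fin N → Fin d → ℝ} {y : Fin N → ℝ}
    {lam : ℝ} (hlam : 0 < lam) {that tstar : Fin d → ℝ} (h : IsLasso x y lam that)
    (hmult : ∀ j, |∑ i, (y i - x i ⬝ᵥ tstar) * x i j| ≤ lam / 4 * N) :
    ell1 (that - tstar) ≤ 4 * ell1 tstar ∧
      ∑ i, (x i ⬝ᵥ (that - tstar)) ^ 2 ≤ 3 / 2 * lam * ell1 tstar * N := by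
  have hN' : (0 : ℝ) < N := by exact_mod_cast hN
  set h' := that - tstar with hh
  have hobj := h tstar
  unfold lassoObjective at hobj
  have e1 : ∀ i, (y i - x i ⬝ᵥ that) ^ 2 = (y i - x i ⬝ᵥ tstar) ^ 2
      - 2 * ((y i - x i ⬝ᵥ tstar) * (x i ⬝ᵥ h')) + (x i ⬝ᵥ h') ^ 2 := fun i => by
    rw [show that = tstar + h' by rw [hh]; abel, dotProduct_add]; ring
  simp only [e1, Finset.sum_add_distrib, Finset.sum_sub_distrib, ← Finset.mul_sum] at hobj
  have e2 : |∑ i, (y i - x i ⬝ᵥ tstar) * (x i ⬝ᵥ h')| ≤ lam / 4 * N * ell1 h' := by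
    have e3 : ∑ i, (y i - x i ⬝ᵥ tstar) * (x i ⬝ᵥ h')
        = ∑ j, (∑ i, (y i - x i ⬝ᵥ tstar) * x i j) * h' j := by
      simp only [dotProduct, Finset.mul_sum, Finset.sum_mul]
      rw [Finset.sum_comm]
      simp only [mul_assoc]
    rw [e3, ell1, Finset.mul_sum]
    refine (Finset.abs_sum_le_sum_abs _ _).trans (Finset.sum_le_sum fun j _ => ?_)
    rw [abs_mul]
    exact mul_le_mul_of_nonneg_right (hmult j) (abs_nonneg _)
  have e4 := (abs_le.1 e2).2
  have e5 := ell1_sub_le that tstar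
  rw [← hh] at e5
  set Q := ∑ i, (x i ⬝ᵥ h') ^ 2 with hQ
  have hQ0 : 0 ≤ Q := Finset.sum_nonneg fun _ _ => sq_nonneg _
  set W := ∑ i, (y i - x i ⬝ᵥ tstar) * (x i ⬝ᵥ h')
  set S := ∑ i, (y i - x i ⬝ᵥ tstar) ^ 2
  have e6 : Q ≤ 2 * W + lam * (ell1 tstar - ell1 that) * N := by
    have e7 : 1 / (N : ℝ) * (S - 2 * W + Q) - 1 / (N : ℝ) * S
        ≤ lam * (ell1 tstar - ell1 that) := by linarith
    have e8 : 1 / (N : ℝ) * (S - 2 * W + Q) - 1 / (N : ℝ) * S = (Q - 2 * W) / N := by ring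
    rw [e8, div_le_iff₀ hN'] at e7
    linarith
  have e9 : lam / 4 * N * ell1 h' ≤ lam / 4 * N * (ell1 that + ell1 tstar) := by gcongr
  have hlN : 0 < lam * N := by positivity
  -- The cross term costs at most (λN/2)(‖t̂‖₁ + ‖t*‖₁). Added to λN(‖t*‖₁ - ‖t̂‖₁), it leaves 3/2
  -- and -1/2, and Q ≥ 0 then bounds ‖t̂‖₁ by 3‖t*‖₁.
  have e10 : Q ≤ lam * N * (3 / 2 * ell1 tstar - 1 / 2 * ell1 that) := by nlinarith
  constructor
  · have : 0 ≤ 3 / 2 * ell1 tstar - 1 / 2 * ell1 that := nonneg_of_mul_nonneg_right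
      (hQ0.trans e10) hlN
    linarith
  · nlinarith [mul_nonneg hlN.le (ell1_nonneg that)]

section Risk

variable {Ω : Type*} [MeasurableSpace Ω] {P : Measure Ω}

theorem normL_two_sq {Z : Ω → ℝ} (hZ : MemLp Z 2 P) : normL P 2 Z ^ 2 = ∫ ω, Z ω ^ 2 ∂P := by
  have h0 : 0 ≤ ∫ ω, Z ω ^ 2 ∂P := integral_nonneg fun _ => sq_nonneg _
  rw [normL, ENNReal.ofReal_ofNat,
    hZ.eLpNorm_eq_integral_rpow_norm (by norm_num) (by norm_num), ENNReal.toReal_ofReal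
      (by positivity)]
  simp only [ENNReal.toReal_ofNat, Real.norm_eq_abs, Real.rpow_ofNat, sq_abs]
  rw [← Real.rpow_natCast, ← Real.rpow_mul h0]
  norm_num

theorem normL_nonneg (p : ℝ) (Z : Ω → ℝ) : 0 ≤ normL P p Z := ENNReal.toReal_nonneg

variable {d : ℕ} {X : Ω → Fin d → ℝ} {Y : Ω → ℝ} {tstar : Fin d → ℝ}

theorem memLp_dotProduct (hX : ∀ j, MemLp (fun ω => X ω j) 2 P) (h : Fin d → ℝ) :
    MemLp (fun ω => X ω ⬝ᵥ h) 2 P := by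
  unfold dotProduct
  exact memLp_finsetSum _ fun j _ => (hX j).mul_const (h j)

theorem risk_add (hX : ∀ j, MemLp (fun ω => X ω j) 2 P) (hξ : MemLp (noise X Y tstar) 2 P)
    (h : Fin d → ℝ) : risk P X Y (tstar + h) - risk P X Y tstar
      = ∫ ω, (X ω ⬝ᵥ h) ^ 2 ∂P - 2 * ∫ ω, noise X Y tstar ω * (X ω ⬝ᵥ h) ∂P := by
  have hXh := memLp_dotProduct hX h
  have i1 : Integrable (fun ω => noise X Y tstar ω ^ 2) P := hξ.integrable_sq
  have i2 : Integrable (fun ω => noise X Y tstar ω * (X ω ⬝ᵥ h)) P := hξ.integrable_mul hXh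
  have i3 : Integrable (fun ω => (X ω ⬝ᵥ h) ^ 2) P := hXh.integrable_sq
  have e1 : ∀ ω, (Y ω - X ω ⬝ᵥ (tstar + h)) ^ 2 = noise X Y tstar ω ^ 2
      + ((X ω ⬝ᵥ h) ^ 2 - 2 * (noise X Y tstar ω * (X ω ⬝ᵥ h))) := fun ω => by
    rw [noise, dotProduct_add]; ring
  have i4 : Integrable (fun ω => (X ω ⬝ᵥ h) ^ 2 - 2 * (noise X Y tstar ω * (X ω ⬝ᵥ h))) P :=
    i3.sub (i2.const_mul 2)
  rw [risk, risk]
  simp only [e1]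
  rw [integral_add i1 i4, integral_sub i3 (i2.const_mul 2), integral_const_mul]
  simp only [noise]
  ring

/-- The first-order condition at the minimizer: the risk increment along s • h is s²b - 2sa, and its
nonnegativity for all s forces a = 0. The test value s = a/(b + 1) also covers b = 0. -/
theorem integral_noise_mul_eq_zero (hmin : ∀ t, risk P X Y tstar ≤ risk P X Y t)
    (hX : ∀ j, MemLp (fun ω => X ω j) 2 P) (hξ : MemLp (noise X Y tstar) 2 P)
    (h : Fin d → ℝ) : ∫ ω, noise X Y tstar ω * (X ω ⬝ᵥ h) ∂P = 0 := by
  set a := ∫ ω, noise X Y tstar ω * (X ω ⬝ᵥ h) ∂P with ha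
  set b := ∫ ω, (X ω ⬝ᵥ h) ^ 2 ∂P with hb
  have hb0 : 0 ≤ b := integral_nonneg fun _ => sq_nonneg _
  have key : ∀ s : ℝ, 0 ≤ s ^ 2 * b - 2 * (s * a) := fun s => by
    have h1 := risk_add hX hξ (s • h)
    have h2 := hmin (tstar + s • h)
    have e1 : ∀ ω, (X ω ⬝ᵥ (s • h)) ^ 2 = s ^ 2 * (X ω ⬝ᵥ h) ^ 2 := fun ω => by
      rw [dotProduct_smul, smul_eq_mul]; ring
    have e2 : ∀ ω, noise X Y tstar ω * (X ω ⬝ᵥ (s • h))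
        = s * (noise X Y tstar ω * (X ω ⬝ᵥ h)) := fun ω => by
      rw [dotProduct_smul, smul_eq_mul]; ring
    simp only [e1, e2, integral_const_mul] at h1
    linarith
  have h1 := key (a / (b + 1))
  have hb1 : 0 < b + 1 := by linarith
  have e : (a / (b + 1)) ^ 2 * b - 2 * (a / (b + 1) * a) = -(a ^ 2 * (b + 2)) / (b + 1) ^ 2 := by
    field_simp; ring
  rw [e] at h1
  have h2 : 0 ≤ -(a ^ 2 * (b + 2)) := by
    by_contra hneg
    exact absurd h1 (not_le.2 (div_neg_of_neg_of_pos (not_le.1 hneg) (by positivity)))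
  have h3 : a ^ 2 = 0 := by nlinarith [sq_nonneg a]
  exact pow_eq_zero_iff two_ne_zero |>.1 h3

theorem risk_sub_eq_normL_sq (hmin : ∀ t, risk P X Y tstar ≤ risk P X Y t)
    (hX : ∀ j, MemLp (fun ω => X ω j) 2 P) (hξ : MemLp (noise X Y tstar) 2 P)
    (t : Fin d → ℝ) :
    risk P X Y t - risk P X Y tstar = normL P 2 (fun η => X η ⬝ᵥ (t - tstar)) ^ 2 := by
  have h := risk_add hX hξ (t - tstar)
  rw [integral_noise_mul_eq_zero hmin hX hξ, add_sub_cancel] at h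
  rw [h, normL_two_sq (memLp_dotProduct hX _)]
  ring

end Risk

/-! ### The probabilistic bounds in terms of moment norms -/

/-- Hölder's inequality puts ξx in L₂ when ξ is in L_q and x is in L_r with r = 2q/(q - 2). The
normalized x has L_r norm at most √r, so the same number serves as moment order and as variance
bound. -/
theorem holderTriple_multVar {q : ℝ} (hq : 2 < q) :
    ENNReal.HolderTriple (ENNReal.ofReal q) (ENNReal.ofReal (multVar q)) 2 := by
  have hq2 : 0 < q - 2 := by linarith
  have hq0 : 0 < q := by linarith
  have hv : 0 < multVar q := by unfold multVar; positivity
  constructor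
  rw [← ENNReal.ofReal_inv_of_pos hq0, ← ENNReal.ofReal_inv_of_pos hv,
    ← ENNReal.ofReal_add (by positivity) (by positivity), ← ENNReal.ofReal_ofNat 2,
    ← ENNReal.ofReal_inv_of_pos (by norm_num)]
  congr 1
  unfold multVar
  field_simp
  ring

theorem eLpNorm_div_le {E : Type*} [MeasurableSpace E] {μ : Measure E} {Z : E → ℝ} {r : ENNReal}
    {a b c : ℝ} (hb : 0 < b) (h : eLpNorm Z r μ ≤ ENNReal.ofReal a) (hab : a / b ≤ c) :
    eLpNorm (fun e => Z e / b) r μ ≤ ENNReal.ofReal c := by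
  have e1 : (fun e => Z e / b) = b⁻¹ • Z := by
    ext e; simp [div_eq_inv_mul]
  rw [e1, eLpNorm_const_smul, Real.enorm_eq_ofReal (by positivity)]
  calc ENNReal.ofReal b⁻¹ * eLpNorm Z r μ ≤ ENNReal.ofReal b⁻¹ * ENNReal.ofReal a := by gcongr
    _ = ENNReal.ofReal (a / b) := by
        rw [← ENNReal.ofReal_mul (by positivity), div_eq_inv_mul]
    _ ≤ _ := ENNReal.ofReal_le_ofReal hab

/-- A deviation bound for the multiplier process, in terms of `L_p` norms. -/
theorem measureReal_multiplier_le_of_eLpNorm_le {E : Type*} [MeasurableSpace E] {μ : Measure E}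
    [IsProbabilityMeasure μ] {d : ℕ} {ξ : E → ℝ} {x : Fin d → E → ℝ} (hξm : Measurable ξ)
    (hxm : ∀ j, Measurable (x j)) {q : ℝ} (hq : 2 < q) {σ M κ₀ : ℝ} (hσ : 0 ≤ σ) (hM : 0 < M)
    (hκ₀ : 0 < κ₀) (hξ : eLpNorm ξ (ENNReal.ofReal q) μ ≤ ENNReal.ofReal σ)
    {p u w : ℝ} (hp : 8 ≤ p)
    (hx : ∀ j, ∀ r, 2 ≤ r → r ≤ 2 * p →
      eLpNorm (x j) (ENNReal.ofReal r) μ ≤ ENNReal.ofReal (κ₀ * √r * M))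
    (hmean : ∀ j, ∫ e, ξ e * x j e ∂μ = 0) (hqp : multVar q ≤ 2 * p)
    {N : ℕ} (hN : 2 ≤ N) (hNp : Real.log N ≤ p) (hdp : (d : ℝ) ≤ Real.exp (p / 2))
    (hu : 1 ≤ u) (hw : 2 ≤ w) :
    (Measure.pi fun _ : Fin N => μ).real
      {ω | ∃ j, multConst q * (u * w) * √(N * p) * (κ₀ * M * σ) < |∑ i, ξ (ω i) * x j (ω i)|}
      ≤ Real.exp (-p / 2) / u ^ (2 * p)
        + 4 * Real.exp (-p / 2) / u ^ (1 / 2 * (p / Real.log (Real.exp 1 * N / p)))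
        + (1 + 2 ^ q) * Real.log N ^ q / (w ^ q * (N : ℝ) ^ (q / 2 - 1)) := by
  have hu0 : 0 < u := by linarith
  have hw0 : 0 < w := by linarith
  -- With σ = 0 the noise cannot be normalized, but then it vanishes almost surely and so does the
  -- process.
  rcases hσ.eq_or_lt with rfl | hσ0
  · have h0 : eLpNorm ξ (ENNReal.ofReal q) μ = 0 := by simpa using hξ
    rw [eLpNorm_eq_zero_iff hξm.aestronglyMeasurable
      (by simp; linarith)] at h0
    have hS : MeasurableSet {e | ξ e ≠ 0} := (hξm (measurableSet_singleton 0)).compl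
    have h1 : μ.real {e | ξ e ≠ 0} = 0 := by
      rw [Measure.real, ENNReal.toReal_eq_zero_iff]; exact Or.inl h0
    have h2 := measureReal_pi_exists_le (N := N) (μ := μ) hS
    rw [h1, mul_zero] at h2
    have hlog : 0 ≤ Real.log N := Real.log_natCast_nonneg N
    refine (measureReal_mono ?_ (measure_ne_top _ _)).trans (h2.trans (by positivity))
    rintro ω ⟨j, hj⟩
    by_contra hcon
    have hcon' : ∀ i, ξ (ω i) = 0 := fun i => by
      by_contra h; exact hcon ⟨i, h⟩
    simp [hcon'] at hj
  · have hκM : 0 < κ₀ * M := by positivity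
    have hξ1 : eLpNorm (fun e => ξ e / σ) (ENNReal.ofReal q) μ ≤ ENNReal.ofReal 1 :=
      eLpNorm_div_le hσ0 hξ (div_self hσ0.ne').le
    have hξ'm : Measurable fun e => ξ e / σ := hξm.div_const _
    have hx'm : ∀ j, Measurable fun e => x j e / (κ₀ * M) := fun j => (hxm j).div_const _
    have hx1 : ∀ j, ∀ r, 2 ≤ r → r ≤ 2 * p →
        eLpNorm (fun e => x j e / (κ₀ * M)) (ENNReal.ofReal r) μ ≤ ENNReal.ofReal √r :=
      fun j r h1 h2 => eLpNorm_div_le hκM (hx j r h1 h2) (by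
        rw [div_le_iff₀ hκM]; exact le_of_eq (by ring))
    have hmom : ∀ j, SubgaussianMoments μ (fun e => x j e / (κ₀ * M)) (2 * p) :=
      fun j r h1 h2 => by
        have := integrable_rpow_and_integral_le_of_eLpNorm_le (hx'm j).aestronglyMeasurable
          (by linarith) (Real.sqrt_nonneg r) (hx1 j r h1 h2)
        rwa [Real.sqrt_eq_rpow, ← Real.rpow_mul (by linarith),
          show 1 / 2 * r = r / 2 by ring] at this
    have hξq := integrable_rpow_and_integral_le_of_eLpNorm_le hξ'm.aestronglyMeasurable
      (by linarith) zero_le_one hξ1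
    rw [Real.one_rpow] at hξq
    have hξ2 := integrable_rpow_and_integral_le_of_eLpNorm_le hξ'm.aestronglyMeasurable
      (r := 2) (by norm_num) zero_le_one ((eLpNorm_le_eLpNorm_of_exponent_le
        (ENNReal.ofReal_le_ofReal hq.le) hξ'm.aestronglyMeasurable).trans hξ1)
    simp only [Real.rpow_ofNat, sq_abs, one_pow] at hξ2
    have hv2 : 2 ≤ multVar q := by
      unfold multVar; rw [le_div_iff₀ (by linarith)]; linarith
    have hprod : ∀ j, Integrable (fun e => (ξ e / σ * (x j e / (κ₀ * M))) ^ 2) μ ∧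
        ∫ e, (ξ e / σ * (x j e / (κ₀ * M))) ^ 2 ∂μ ≤ multVar q := fun j => by
      have := holderTriple_multVar hq
      have hH := eLpNorm_smul_le_mul_eLpNorm (p := ENNReal.ofReal q)
        (q := ENNReal.ofReal (multVar q)) (r := 2) (hx'm j).aestronglyMeasurable
        (μ := μ) hξ'm.aestronglyMeasurable
      have hH2 : eLpNorm (fun e => ξ e / σ * (x j e / (κ₀ * M))) (ENNReal.ofReal 2) μ
          ≤ ENNReal.ofReal √(multVar q) := by
        rw [ENNReal.ofReal_ofNat]
        calc _ ≤ _ := hH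
          _ ≤ ENNReal.ofReal 1 * ENNReal.ofReal √(multVar q) := by
              gcongr; exact hx1 j _ hv2 hqp
          _ = _ := by simp
      have h3 := integrable_rpow_and_integral_le_of_eLpNorm_le
        (hξ'm.mul (hx'm j)).aestronglyMeasurable (r := 2) (by norm_num) (Real.sqrt_nonneg _) hH2
      simp only [Real.rpow_ofNat, sq_abs, Real.sq_sqrt (by linarith : 0 ≤ multVar q)] at h3
      exact h3
    have hmean' : ∀ j, ∫ e, ξ e / σ * (x j e / (κ₀ * M)) ∂μ = 0 := fun j => by
      have e1 : ∀ e, ξ e / σ * (x j e / (κ₀ * M)) = ξ e * x j e / (σ * (κ₀ * M)) := fun e => by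
        field_simp
      simp only [e1, integral_div, hmean j, zero_div]
    have h := measureReal_multiplier_le hξ'm hx'm hq hξq.1 hξq.2 hξ2.1 hξ2.2 hp hmom
      (fun j => (hprod j).1) (fun j => (hprod j).2) hmean' hN hNp hdp hu hw
    refine (measureReal_mono ?_ (measure_ne_top _ _)).trans h
    rintro ω ⟨j, hj⟩
    refine ⟨j, ?_⟩
    have e1 : ∀ i, ξ (ω i) / σ * (x j (ω i) / (κ₀ * M))
        = ξ (ω i) * x j (ω i) / (κ₀ * M * σ) := fun i => by field_simp
    simp only [e1]
    rw [← Finset.sum_div, abs_div, abs_of_pos (by positivity : 0 < κ₀ * M * σ),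
      lt_div_iff₀ (by positivity)]
    exact hj

/-- The small-ball lower bound for the design, in terms of `L_p` norms. -/
theorem measure_smallBall_le_of_eLpNorm_le {d : ℕ} {μ : Measure (Fin d → ℝ)}
    [IsProbabilityMeasure μ] {κ₀ M p₀ : ℝ} (hκ₀ : 0 < κ₀) (hM : 0 < M) (hd2 : 2 ≤ d)
    (hp₀ : 4 * Real.log d ≤ p₀)
    (hx : ∀ j : Fin d, ∀ r, 2 ≤ r → r ≤ p₀ →
      eLpNorm (fun x : Fin d → ℝ => x j) (ENNReal.ofReal r) μ ≤ ENNReal.ofReal (κ₀ * √r * M))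
    {N : ℕ} (hN : 0 < N) {κ ε : ℝ} (hκ : 0 < κ) (hε : 0 < ε)
    {H : Set (Fin d → ℝ)} (hH : ∀ h ∈ H, ell1 h ≤ κ * ε / (128 * κ₀ * M * √(Real.log d / N)))
    (hsb : ∀ h ∈ H, ε ≤ μ.real {x | κ ≤ |x ⬝ᵥ h|}) :
    MeasurableSet {ω : Fin N → Fin d → ℝ | ∃ h ∈ H, ∑ i, clippedSq κ (ω i ⬝ᵥ h) < ε / 4 * N} ∧
    (Measure.pi fun _ : Fin N => μ).real
      {ω | ∃ h ∈ H, ∑ i, clippedSq κ (ω i ⬝ᵥ h) < ε / 4 * N} ≤ Real.exp (-(ε ^ 2 * N / 2)) := by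
  have hN' : (0 : ℝ) < N := by exact_mod_cast hN
  have hd2' : (2 : ℝ) ≤ d := by exact_mod_cast hd2
  have hlog : 2 / 3 ≤ Real.log d :=
    le_trans (by linarith [Real.log_two_gt_d9]) (Real.log_le_log (by norm_num) hd2')
  -- The smallest natural number k with d ≤ e^(2k); the required moment order 2k is at most 4 log d
  -- because log d ≥ 2/3.
  set k := ⌈Real.log d / 2⌉₊ with hk
  have hk1 : 1 ≤ k := Nat.one_le_ceil_iff.2 (by linarith)
  have hkl : Real.log d / 2 ≤ k := Nat.le_ceil _
  have hku : (k : ℝ) ≤ 2 * Real.log d := by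
    have := Nat.ceil_lt_add_one (show 0 ≤ Real.log d / 2 by linarith)
    linarith
  have hmomr : ∀ j : Fin d, ∀ l : ℕ, 1 ≤ l → l ≤ k →
      Integrable (fun x : Fin d → ℝ => x j ^ (2 * l)) μ ∧
      ∫ x : Fin d → ℝ, x j ^ (2 * l) ∂μ ≤ (2 * l * (κ₀ * M) ^ 2) ^ l := fun j l h1 h2 => by
    have h1' : (1 : ℝ) ≤ l := by exact_mod_cast h1
    have h2' : (l : ℝ) ≤ k := by exact_mod_cast h2
    have h3 := integrable_rpow_and_integral_le_of_eLpNorm_le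
      (measurable_pi_apply j).aestronglyMeasurable (by linarith) (by positivity)
      (hx j (2 * l) (by linarith) (by linarith))
    have e1 : ∀ y : ℝ, |y| ^ (2 * (l : ℝ)) = y ^ (2 * l) := fun y => by
      rw [show (2 * (l : ℝ)) = ((2 * l : ℕ) : ℝ) by push_cast; ring, Real.rpow_natCast,
        pow_mul, sq_abs, pow_mul]
    have e2 : (κ₀ * √(2 * l) * M) ^ (2 * (l : ℝ)) = (2 * l * (κ₀ * M) ^ 2) ^ l := by
      have e3 : (κ₀ * √(2 * l) * M) ^ 2 = 2 * l * (κ₀ * M) ^ 2 := by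
        rw [mul_pow, mul_pow, Real.sq_sqrt (by positivity)]; ring
      rw [← abs_of_nonneg (show 0 ≤ κ₀ * √(2 * l) * M by positivity), e1, pow_mul, e3]
    simp only [e1, e2] at h3
    exact h3
  have hs2 : (2 * (κ₀ * M)) ^ 2 = 4 * (κ₀ * M) ^ 2 := by ring
  have hb : ∀ j : Fin d, ∀ l ≤ k, ∫ x : Fin d → ℝ, x j ^ (2 * l) ∂μ
      ≤ gaussMoment ((2 * (κ₀ * M)) ^ 2) l := fun j l hl => by
    rw [hs2]
    refine le_trans ?_ (le_gaussMoment (sq_nonneg (κ₀ * M)) l)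
    rcases Nat.eq_zero_or_pos l with rfl | hl0
    · simp
    · exact (hmomr j l hl0 hl).2
  have hR0 : 0 < √(Real.log d / N) := Real.sqrt_pos.2 (by positivity)
  refine measure_smallBall_le hk1 (show 0 < 2 * (κ₀ * M) by positivity)
    (fun j => (hmomr j k hk1 le_rfl).1) hb ?_ hκ hε
    (show 0 ≤ κ * ε / (128 * κ₀ * M * √(Real.log d / N)) by positivity) ?_ hH hsb
  · rw [← Real.exp_log (by linarith : (0 : ℝ) < d)]
    exact Real.exp_le_exp.2 (by linarith)
  · have h1 : √(k * N) ≤ √2 * (√(Real.log d / N) * N) := by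
      have e1 : √2 * (√(Real.log d / N) * N) = √(2 * Real.log d * N) := by
        rw [← Real.sqrt_sq hN'.le, ← Real.sqrt_mul (by positivity), ← Real.sqrt_mul (by norm_num),
          Real.sqrt_sq hN'.le]
        congr 1; field_simp
      rw [e1]
      exact Real.sqrt_le_sqrt (by gcongr)
    have h2 : √2 ≤ 1.415 := Real.sqrt_le_iff.2 ⟨by norm_num, by norm_num⟩
    have h3 : Real.exp 1 ≤ 2.719 := by linarith [Real.exp_one_lt_d9]
    set R := √(Real.log d / N) with hR
    -- The constant 128 in the radius is chosen here: 8e√2/128 is below 1/4.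
    calc _ ≤ 4 / κ * (κ * ε / (128 * κ₀ * M * R)) * (2.719 * (1.415 * (R * N) * (2 * (κ₀ * M)))) := by
          gcongr
          exact h1.trans (by gcongr)
      _ = ε * N * (8 * 2.719 * 1.415 / 128) := by field_simp; norm_num
      _ ≤ ε * N * (1 / 4) := mul_le_mul_of_nonneg_left (by norm_num) (by positivity)
      _ = _ := by ring

/-! ### Passage to the sample and conclusion -/

theorem map_sample_eq_pi {Ω Ω' E : Type*} [MeasurableSpace Ω] [MeasurableSpace Ω']
    [MeasurableSpace E] {P : Measure Ω} {P' : Measure Ω'} [IsProbabilityMeasure P'] {N : ℕ}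
    {Zs : Fin N → Ω' → E} {Z : Ω → E} (hind : iIndepFun Zs P')
    (hid : ∀ i, IdentDistrib (Zs i) Z P' P) :
    P'.map (fun ω i => Zs i ω) = Measure.pi fun _ => P.map Z := by
  rw [hind.map_fun_eq_pi_map fun i => (hid i).aemeasurable_fst]
  simp only [fun i => (hid i).map_eq]

theorem measureReal_sample_preimage {Ω' E : Type*} [MeasurableSpace Ω']
    [MeasurableSpace E] {P' : Measure Ω'} {N : ℕ} {Zs : Fin N → Ω' → E}
    (hm : ∀ i, AEMeasurable (Zs i) P') {S : Set (Fin N → E)} (hS : MeasurableSet S) :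
    P'.real {ω | (fun i => Zs i ω) ∈ S} = (P'.map fun ω i => Zs i ω).real S := by
  rw [Measure.real, Measure.real, Measure.map_apply_of_aemeasurable (aemeasurable_pi_lambda _ hm) hS]
  rfl

/-- Here ρ is the radius of the small-ball bound and τ is meant to be the L₂ norm of ⟨X, h⟩. Either
h/τ lies inside the ℓ₁ ball and the quadratic form bounds τ², or it lies outside and τ < ‖h‖₁/ρ. -/
theorem sq_le_max_of_clippedSq {N d : ℕ} (hN : 0 < N) {x : Fin N → Fin d → ℝ}
    {κ ε τ ρ a lam : ℝ} (hκ : 0 < κ) (hε : 0 < ε) (hτ : 0 < τ) (hρ : 0 < ρ) {h : Fin d → ℝ}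
    (hsb : ell1 (τ⁻¹ • h) ≤ ρ → ε / 4 * N ≤ ∑ i, clippedSq κ (x i ⬝ᵥ (τ⁻¹ • h)))
    (h1 : ell1 h ≤ 4 * a) (h2 : ∑ i, (x i ⬝ᵥ h) ^ 2 ≤ 3 / 2 * lam * a * N) :
    τ ^ 2 ≤ max ((4 * a / ρ) ^ 2) (6 * (lam / (κ ^ 2 * ε) * a)) := by
  have hN' : (0 : ℝ) < N := by exact_mod_cast hN
  by_cases hc : ell1 (τ⁻¹ • h) ≤ ρ
  · refine le_max_of_le_right ?_
    have h3 : κ ^ 2 * (ε / 4 * N) ≤ ∑ i, (x i ⬝ᵥ (τ⁻¹ • h)) ^ 2 :=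
      calc _ ≤ κ ^ 2 * ∑ i, clippedSq κ (x i ⬝ᵥ (τ⁻¹ • h)) := by gcongr; exact hsb hc
        _ ≤ _ := by
          rw [Finset.mul_sum]
          exact Finset.sum_le_sum fun i _ => clippedSq_le hκ _
    have h4 : ∑ i, (x i ⬝ᵥ (τ⁻¹ • h)) ^ 2 = (τ⁻¹) ^ 2 * ∑ i, (x i ⬝ᵥ h) ^ 2 := by
      rw [Finset.mul_sum]
      exact Finset.sum_congr rfl fun i _ => by rw [dotProduct_smul, smul_eq_mul, mul_pow]
    rw [h4] at h3
    have h5 : τ ^ 2 * (κ ^ 2 * (ε / 4 * N)) ≤ 3 / 2 * lam * a * N :=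
      calc _ ≤ τ ^ 2 * ((τ⁻¹) ^ 2 * ∑ i, (x i ⬝ᵥ h) ^ 2) := by gcongr
        _ = ∑ i, (x i ⬝ᵥ h) ^ 2 := by field_simp
        _ ≤ _ := h2
    rw [show 6 * (lam / (κ ^ 2 * ε) * a) = 3 / 2 * lam * a * N / (κ ^ 2 * (ε / 4 * N)) by
      field_simp; ring, le_div_iff₀ (by positivity)]
    exact h5
  · refine le_max_of_le_left ?_
    rw [ell1_smul, abs_of_pos (by positivity), not_le, ← div_eq_inv_mul, lt_div_iff₀ hτ] at hc
    gcongr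
    rw [le_div_iff₀ hρ]
    linarith

/-- Markov's inequality for Z² at the small-ball level. The relation between κ and ε is what later
rules out the regime in which N is at least (32/(κε))² d. -/
theorem le_sq_of_smallBall {Ω : Type*} [MeasurableSpace Ω] {P : Measure Ω} [IsProbabilityMeasure P]
    {Z : Ω → ℝ} (hZ : MemLp Z 2 P) (hpos : 0 < normL P 2 Z) {κ ε : ℝ} (hκ : 0 < κ)
    (h : ε ≤ P.real {ω | κ * normL P 2 Z ≤ |Z ω|}) : κ ^ 2 * ε ≤ 1 := by
  have h1 := mul_meas_ge_le_integral_of_nonneg (μ := P) (f := fun ω => Z ω ^ 2)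
    (Filter.Eventually.of_forall fun _ => sq_nonneg _) hZ.integrable_sq ((κ * normL P 2 Z) ^ 2)
  have e : {ω | (κ * normL P 2 Z) ^ 2 ≤ Z ω ^ 2} = {ω | κ * normL P 2 Z ≤ |Z ω|} := by
    ext ω
    simp only [Set.mem_ofPred_eq]
    rw [← sq_abs (Z ω), sq_le_sq₀ (by positivity) (abs_nonneg _)]
  rw [e, ← normL_two_sq hZ] at h1
  have h2 : (κ * normL P 2 Z) ^ 2 * ε ≤ normL P 2 Z ^ 2 := le_trans (by gcongr) h1
  have h3 : 0 < normL P 2 Z ^ 2 := by positivity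
  rw [mul_pow] at h2
  nlinarith

/-- Numerical consequences of the sample-size condition of the LASSO theorem. -/
theorem lasso_parameter_bounds {q a₂ : ℝ} (hq : 2 < q) (ha₂ : 4 ≤ a₂) {N d : ℕ} (hNd : N ≤ d)
    (h : 8 * rConj q ≤ a₂ * Real.log N) :
    2 ≤ N ∧ 8 ≤ a₂ / 2 * Real.log d ∧ multVar q ≤ 2 * (a₂ / 2 * Real.log d) ∧
      Real.log N ≤ a₂ / 2 * Real.log d ∧ (d : ℝ) ≤ Real.exp (a₂ / 2 * Real.log d / 2) := by
  have hr2 : rExp q ≤ 2 := min_le_right _ _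
  have hrq : rExp q ≤ 1 / 2 + q / 4 := min_le_left _ _
  have hr1 : 1 < rExp q := lt_min (by linarith) (by norm_num)
  have hc2 : 2 ≤ rConj q := by
    rw [rConj, le_div_iff₀ (by linarith)]; linarith
  -- Through this, the sample-size condition puts the order 2q/(q - 2) of Hölder's inequality within
  -- the available moments.
  have hcv : multVar q ≤ 8 * rConj q := by
    unfold rConj multVar
    rw [mul_div_assoc', div_le_div_iff₀ (by linarith) (by linarith)]
    nlinarith
  have hlogN : 0 < Real.log N := by
    by_contra hn
    nlinarith
  have hN2 : 2 ≤ N := by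
    by_contra hn
    have : N = 0 ∨ N = 1 := by omega
    rcases this with rfl | rfl <;> simp at hlogN
  have hN0 : (0 : ℝ) < N := by positivity
  have hNd' : (N : ℝ) ≤ d := by exact_mod_cast hNd
  have hll : Real.log N ≤ Real.log d := Real.log_le_log hN0 hNd'
  have hal : a₂ * Real.log N ≤ a₂ * Real.log d := by gcongr
  refine ⟨hN2, by linarith, by linarith, by nlinarith, ?_⟩
  calc (d : ℝ) = Real.exp (Real.log d) := (Real.exp_log (by linarith)).symm
    _ ≤ _ := Real.exp_le_exp.2 (by nlinarith)

section Sample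

variable {Ω Ω' : Type*} [MeasurableSpace Ω] [MeasurableSpace Ω'] {P : Measure Ω}
  [IsProbabilityMeasure P] {P' : Measure Ω'} [IsProbabilityMeasure P'] {N d : ℕ}
  {X : Ω → Fin d → ℝ} {Y : Ω → ℝ} {tstar : Fin d → ℝ} {Xs : Fin N → Ω' → Fin d → ℝ}
  {Ys : Fin N → Ω' → ℝ}

/-- The sample is transported to a product of copies of the law of (X, Y), on which ξ and the
coordinates are genuinely measurable functions. Centring comes from the first-order condition tested
on basis vectors. -/
theorem measureReal_sample_multiplier_le
    (hind : iIndepFun (fun i ω => (Xs i ω, Ys i ω)) P')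
    (hid : ∀ i, IdentDistrib (fun ω => (Xs i ω, Ys i ω)) (fun ω => (X ω, Y ω)) P' P)
    (hmin : ∀ t, risk P X Y tstar ≤ risk P X Y t)
    (hX : ∀ j, MemLp (fun ω => X ω j) 2 P) {q : ℝ} (hq : 2 < q)
    (hξ : MemLp (noise X Y tstar) (ENNReal.ofReal q) P) {M κ₀ : ℝ} (hM : 0 < M) (hκ₀ : 0 < κ₀)
    {p u w : ℝ} (hp : 8 ≤ p)
    (hx : ∀ j, ∀ r, 2 ≤ r → r ≤ 2 * p →
      eLpNorm (fun ω => X ω j) (ENNReal.ofReal r) P ≤ ENNReal.ofReal (κ₀ * √r * M))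
    (hqp : multVar q ≤ 2 * p) (hN : 2 ≤ N) (hNp : Real.log N ≤ p)
    (hdp : (d : ℝ) ≤ Real.exp (p / 2)) (hu : 1 ≤ u) (hw : 2 ≤ w) :
    P'.real {ω | ∃ j, multConst q * (u * w) * √(N * p) *
        (κ₀ * M * normL P q (noise X Y tstar))
          < |∑ i, (Ys i ω - Xs i ω ⬝ᵥ tstar) * Xs i ω j|}
      ≤ Real.exp (-p / 2) / u ^ (2 * p)
        + 4 * Real.exp (-p / 2) / u ^ (1 / 2 * (p / Real.log (Real.exp 1 * N / p)))
        + (1 + 2 ^ q) * Real.log N ^ q / (w ^ q * (N : ℝ) ^ (q / 2 - 1)) := by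
  have hXY : AEMeasurable (fun ω => (X ω, Y ω)) P := (hid ⟨0, by omega⟩).aemeasurable_snd
  set μ := P.map fun ω => (X ω, Y ω) with hμ
  have : IsProbabilityMeasure μ := Measure.isProbabilityMeasure_map hXY
  set ξ : (Fin d → ℝ) × ℝ → ℝ := fun e => e.2 - e.1 ⬝ᵥ tstar with hξdef
  set x : Fin d → (Fin d → ℝ) × ℝ → ℝ := fun j e => e.1 j with hxdef
  have hxm : ∀ j, Measurable (x j) := fun j => (measurable_pi_apply j).comp measurable_fst
  have hξm : Measurable ξ := measurable_snd.sub
    ((measurable_dotProduct_const tstar).comp measurable_fst)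
  have hξ2 : MemLp (noise X Y tstar) 2 P := hξ.mono_exponent (by
    rw [← ENNReal.ofReal_ofNat]; exact ENNReal.ofReal_le_ofReal hq.le)
  have hξσ : eLpNorm ξ (ENNReal.ofReal q) μ ≤ ENNReal.ofReal (normL P q (noise X Y tstar)) := by
    rw [hμ, eLpNorm_map_measure hξm.aestronglyMeasurable hXY, normL,
      ENNReal.ofReal_toReal hξ.eLpNorm_ne_top]
    rfl
  have hx' : ∀ j, ∀ r, 2 ≤ r → r ≤ 2 * p →
      eLpNorm (x j) (ENNReal.ofReal r) μ ≤ ENNReal.ofReal (κ₀ * √r * M) := fun j r h1 h2 => by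
    rw [hμ, eLpNorm_map_measure (hxm j).aestronglyMeasurable hXY]
    exact hx j r h1 h2
  have hmean : ∀ j, ∫ e, ξ e * x j e ∂μ = 0 := fun j => by
    rw [hμ, integral_map (f := fun e => ξ e * x j e) hXY (hξm.mul (hxm j)).aestronglyMeasurable,
      ← integral_noise_mul_eq_zero hmin hX hξ2 (Pi.single j 1)]
    simp [hξdef, hxdef, noise]
  have h := measureReal_multiplier_le_of_eLpNorm_le hξm hxm hq (normL_nonneg _ _) hM hκ₀ hξσ hp
    hx' hmean hqp hN hNp hdp hu hw
  refine le_trans (le_of_eq ?_) h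
  rw [hμ, ← map_sample_eq_pi hind hid, ← measureReal_sample_preimage
    (fun i => (hid i).aemeasurable_fst)]
  · rfl
  · rw [Set.ofPred_exists]
    refine MeasurableSet.iUnion fun j => measurableSet_lt measurable_const ?_
    exact (Finset.measurable_sum _ fun i _ => (hξm.mul (hxm j)).comp
      (measurable_pi_apply i)).abs

theorem measureReal_sample_smallBall_le
    (hind : iIndepFun (fun i ω => (Xs i ω, Ys i ω)) P')
    (hid : ∀ i, IdentDistrib (fun ω => (Xs i ω, Ys i ω)) (fun ω => (X ω, Y ω)) P' P)
    {κ₀ M p₀ : ℝ} (hκ₀ : 0 < κ₀) (hM : 0 < M) (hd2 : 2 ≤ d) (hp₀ : 4 * Real.log d ≤ p₀)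
    (hx : ∀ j, ∀ r, 2 ≤ r → r ≤ p₀ →
      eLpNorm (fun ω => X ω j) (ENNReal.ofReal r) P ≤ ENNReal.ofReal (κ₀ * √r * M))
    (hN : 0 < N) {κ ε : ℝ} (hκ : 0 < κ) (hε : 0 < ε)
    (hsb : ∀ t, ε ≤ P.real {ω | κ * normL P 2 (fun ω' => X ω' ⬝ᵥ t) ≤ |X ω ⬝ᵥ t|}) :
    P'.real {ω | ∃ h, normL P 2 (fun η => X η ⬝ᵥ h) = 1 ∧
        ell1 h ≤ κ * ε / (128 * κ₀ * M * √(Real.log d / N)) ∧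
        ∑ i, clippedSq κ (Xs i ω ⬝ᵥ h) < ε / 4 * N} ≤ Real.exp (-(ε ^ 2 * N / 2)) := by
  have hidX : ∀ i, IdentDistrib (Xs i) X P' P := fun i => (hid i).comp measurable_fst
  have hindX : iIndepFun Xs P' := hind.comp (fun _ => Prod.fst) fun _ => measurable_fst
  have hXm : AEMeasurable X P := (hidX ⟨0, hN⟩).aemeasurable_snd
  have : IsProbabilityMeasure (P.map X) := Measure.isProbabilityMeasure_map hXm
  set H : Set (Fin d → ℝ) := {h | normL P 2 (fun η => X η ⬝ᵥ h) = 1 ∧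
    ell1 h ≤ κ * ε / (128 * κ₀ * M * √(Real.log d / N))} with hH
  have h := measure_smallBall_le_of_eLpNorm_le (μ := P.map X) hκ₀ hM hd2 hp₀
    (fun j r h1 h2 => by
      rw [eLpNorm_map_measure (measurable_pi_apply j).aestronglyMeasurable hXm]
      exact hx j r h1 h2) hN hκ hε (H := H) (fun h hh => hh.2) (fun h hh => by
        refine (hsb h).trans (le_of_eq ?_)
        rw [hh.1, mul_one, Measure.real, Measure.real, Measure.map_apply_of_aemeasurable hXm]
        · rfl
        · exact measurableSet_le measurable_const (measurable_dotProduct_const h).abs)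
  refine le_trans (le_of_eq ?_) h.2
  rw [← map_sample_eq_pi hindX hidX, ← measureReal_sample_preimage
    (fun i => (hidX i).aemeasurable_fst) h.1]
  simp only [hH, Set.mem_ofPred_eq, and_assoc]

end Sample

theorem normL_two_dotProduct_eq_zero {Ω : Type*} [MeasurableSpace Ω] {P : Measure Ω} {d : ℕ}
    {X : Ω → Fin d → ℝ} (hX : ∀ j, MemLp (fun ω => X ω j) 2 P)
    (h0 : ∀ j, normL P 2 (fun ω => X ω j) = 0) (h : Fin d → ℝ) :
    normL P 2 (fun ω => X ω ⬝ᵥ h) = 0 := by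
  have h1 : ∀ j, ∀ᵐ ω ∂P, X ω j = 0 := fun j => by
    have h2 := h0 j
    rw [normL, ENNReal.toReal_eq_zero_iff, ENNReal.ofReal_ofNat,
      or_iff_left (hX j).eLpNorm_ne_top,
      eLpNorm_eq_zero_iff (hX j).aestronglyMeasurable (by norm_num)] at h2
    exact h2
  have h3 : (fun ω => X ω ⬝ᵥ h) =ᵐ[P] 0 := by
    filter_upwards [ae_all_iff.2 h1] with ω hω
    simp [dotProduct, hω]
  rw [normL, eLpNorm_congr_ae h3]
  simp

theorem normL_le_maxCoordNorm {Ω : Type*} [MeasurableSpace Ω] (P : Measure Ω) {d : ℕ}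
    (X : Ω → Fin d → ℝ) (j : Fin d) : normL P 2 (fun ω => X ω j) ≤ maxCoordNorm P X :=
  le_ciSup (f := fun j => normL P 2 fun ω => X ω j) (Set.finite_range _).bddAbove j

theorem DesignNoise.eLpNorm_coord_le {Ω : Type*} [MeasurableSpace Ω] {P : Measure Ω} {d : ℕ}
    {X : Ω → Fin d → ℝ} {ξ : Ω → ℝ} {p₀ q κ₀ κ ε : ℝ} (hD : DesignNoise P X ξ p₀ q κ₀ κ ε)
    (hκ₀ : 0 ≤ κ₀) (j : Fin d) {r : ℝ} (h2 : 2 ≤ r) (hr : r ≤ p₀) :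
    eLpNorm (fun ω => X ω j) (ENNReal.ofReal r) P
      ≤ ENNReal.ofReal (κ₀ * √r * maxCoordNorm P X) := by
  rw [ENNReal.ofReal_mul (by positivity)]
  refine (hD.moments j r h2 hr).trans ?_
  gcongr
  rw [← ENNReal.ofReal_toReal (hD.memLp_coord j).eLpNorm_ne_top]
  refine ENNReal.ofReal_le_ofReal ?_
  have := normL_le_maxCoordNorm P X j
  rwa [normL, ENNReal.ofReal_ofNat] at this

theorem DesignNoise.sq_mul_le_one {Ω : Type*} [MeasurableSpace Ω] {P : Measure Ω}
    [IsProbabilityMeasure P] {d : ℕ} {X : Ω → Fin d → ℝ} {ξ : Ω → ℝ} {p₀ q κ₀ κ ε : ℝ}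
    (hD : DesignNoise P X ξ p₀ q κ₀ κ ε) (hκ : 0 < κ) (hM : 0 < maxCoordNorm P X) :
    κ ^ 2 * ε ≤ 1 := by
  obtain ⟨j, hj⟩ : ∃ j, 0 < normL P 2 fun ω => X ω j := by
    by_contra! h
    exact hM.not_ge (Real.iSup_nonpos h)
  refine le_sq_of_smallBall (hD.memLp_coord j) hj hκ ?_
  simpa using hD.small_ball (Pi.single j 1)

/-- As N ≤ d, ε ≤ 1 and κ²ε ≤ 1, the second branch of `rateSq` applies, so the rate dominates
κ²Λ²(a). The first entry on the left equals 512² κ²Λ²(a). -/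
theorem max_le_mul_max_rateSq {κ₀ κ ε M σ u v w lam a : ℝ} {N d : ℕ} (hκ : 0 < κ) (hε : 0 < ε)
    (hε1 : ε ≤ 1) (hκ₀ : 0 < κ₀) (hM : 0 < M) (hκε : κ ^ 2 * ε ≤ 1) (hN : 0 < N) (hNd : N ≤ d)
    (hlogd : 0 < Real.log d) (hrhs : 0 ≤ lam / (κ ^ 2 * ε) * a) :
    max ((4 * a / (κ * ε / (128 * κ₀ * M * √(Real.log d / N)))) ^ 2)
        (6 * (lam / (κ ^ 2 * ε) * a))
      ≤ 512 ^ 2 * max (rateSq 1 u v w κ₀ κ ε M σ N d a) (lam / (κ ^ 2 * ε) * a) := by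
  have hN' : (0 : ℝ) < N := by exact_mod_cast hN
  have hNd' : (N : ℝ) ≤ d := by exact_mod_cast hNd
  have hR : 0 < √(Real.log d / N) := Real.sqrt_pos.2 (by positivity)
  refine max_le ?_ ?_
  · have hcond : ¬ (32 / (κ * ε)) ^ 2 * (d : ℝ) ≤ N := fun hle => by
      have h1 : (κ * ε) ^ 2 ≤ 1 := by
        rw [show (κ * ε) ^ 2 = κ ^ 2 * ε * ε by ring]
        exact mul_le_one₀ hκε hε.le hε1
      have h2 : 1 < (32 / (κ * ε)) ^ 2 := by
        rw [div_pow, one_lt_div (by positivity)]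
        linarith
      nlinarith
    have hL : (4 * a / (κ * ε / (128 * κ₀ * M * √(Real.log d / N)))) ^ 2
        = 512 ^ 2 * (κ ^ 2 * Lam κ₀ κ ε M N d a ^ 2) := by
      rw [Lam]
      generalize √(Real.log d / N) = R at *
      field_simp; ring
    rw [hL]
    refine mul_le_mul_of_nonneg_left (le_max_of_le_left ?_) (by norm_num)
    rw [rateSq, if_neg hcond, one_mul (max _ _)]
    exact le_max_right _ _
  · calc 6 * (lam / (κ ^ 2 * ε) * a) ≤ 512 ^ 2 * (lam / (κ ^ 2 * ε) * a) :=
          mul_le_mul_of_nonneg_right (by norm_num) hrhs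
      _ ≤ _ := mul_le_mul_of_nonneg_left (le_max_right _ _) (by norm_num)

theorem theorem4p3 :
    ∃ a₀ : ℝ, 0 < a₀ ∧ ∃ a₁ : ℝ, 0 < a₁ ∧
    -- `C` is the implicit constant in `a₂ log d ≲ N`
    ∀ C : ℝ, 0 < C →
    ∃ c₀ c₂ c₅ c₆ : ℝ, 0 < c₀ ∧ 0 < c₂ ∧ 0 < c₅ ∧ 0 < c₆ ∧
    ∀ q : ℝ, 2 < q → ∃ c₁ : ℝ, 0 < c₁ ∧
    ∀ a₂ : ℝ, 4 ≤ a₂ → ∃ c₄ : ℝ, 0 < c₄ ∧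
    ∀ (N d : ℕ), N ≤ d →
      2 ≤ a₂ * Real.log d →
      a₂ * Real.log d ≤ C * N →
      4 * rConj q * max 2 (1 + a₀ / a₁) ≤ a₂ * Real.log N →
    ∀ (κ₀ κ ε : ℝ), 0 < κ₀ → 0 < κ → 0 < ε → ε ≤ 1 →
    -- the random pair `(X, Y)` and a minimizer `tstar` of the risk
    ∀ (Ω : Type*) [MeasurableSpace Ω] (P : Measure Ω) [IsProbabilityMeasure P]
      (X : Ω → Fin d → ℝ) (Y : Ω → ℝ) (tstar : Fin d → ℝ),
      (∀ t, risk P X Y tstar ≤ risk P X Y t) →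
      DesignNoise P X (noise X Y tstar) (a₂ * Real.log d) q κ₀ κ ε →
    -- the sample: independent copies `(Xs i, Ys i)` of `(X, Y)`
    ∀ (Ω' : Type*) [MeasurableSpace Ω'] (P' : Measure Ω') [IsProbabilityMeasure P']
      (Xs : Fin N → Ω' → Fin d → ℝ) (Ys : Fin N → Ω' → ℝ),
      iIndepFun (fun i ω => (Xs i ω, Ys i ω)) P' →
      (∀ i, IdentDistrib (fun ω => (Xs i ω, Ys i ω)) (fun ω => (X ω, Y ω)) P' P) →
    ∀ (u v w : ℝ), 2 < u → 0 < v → 2 ≤ w →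
    ∀ lam : ℝ,
      c₄ * (u * w + u ^ 2 * v) * κ₀ * normL P q (noise X Y tstar) * maxCoordNorm P X
        * √(Real.log d / N) < lam →
    ∃ A : Set Ω', MeasurableSet A ∧
      1 - 5 * confLevel c₀ c₁ a₂ q u v w N d - 2 * Real.exp (-(ε ^ 2 * N / 2)) ≤ P'.real A ∧
      ∀ ω ∈ A, ∀ that : Fin d → ℝ,
        IsLasso (fun i => Xs i ω) (fun i => Ys i ω) lam that →
        risk P X Y that - risk P X Y tstar = normL P 2 (fun η => X η ⬝ᵥ (that - tstar)) ^ 2 ∧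
        normL P 2 (fun η => X η ⬝ᵥ (that - tstar)) ^ 2 ≤
          c₅ * max
            (rateSq c₂ u v w κ₀ κ ε (maxCoordNorm P X) (normL P q (noise X Y tstar)) N d
              (c₆ * ell1 tstar))
            (lam / (κ ^ 2 * ε) * ell1 tstar) := by
  -- Taking a₀ = a₁ = 1 makes the maximum in the sample-size condition equal to 2. The exponent c₀ =
  -- 1/2 and c₁ come from the multiplier bound. In c₄, the 4 matches the threshold λ/4 and √(a₂/2)
  -- converts √(Np) into N√(log d / N), as p = (a₂/2) log d.
  refine ⟨1, one_pos, 1, one_pos, fun C _ => ⟨1 / 2, 1, 512 ^ 2, 1, by norm_num, one_pos,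
    by norm_num, one_pos, fun q hq => ⟨1 + 2 ^ q, by positivity, fun a₂ ha₂ =>
    ⟨4 * multConst q * √(a₂ / 2), ?_, ?_⟩⟩⟩⟩
  · have := multConst_pos hq
    have : 0 < √(a₂ / 2) := Real.sqrt_pos.2 (by linarith)
    positivity
  intro N d hNd _ _ hr κ₀ κ ε hκ₀ hκ hε hε1 Ω _ P _ X Y tstar hmin hD Ω' _ P' _ Xs Ys hind hid
    u v w hu hv hw lam hlam
  have hr' : 8 * rConj q ≤ a₂ * Real.log N := by norm_num at hr; linarith
  obtain ⟨hN2, hp8, hqp, hNp, hdp⟩ := lasso_parameter_bounds hq ha₂ hNd hr'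
  have hN0 : 0 < N := by omega
  have hN' : (0 : ℝ) < N := by exact_mod_cast hN0
  have hd2 : 2 ≤ d := hN2.trans hNd
  have hlogd : 0 < Real.log d := Real.log_pos (by exact_mod_cast hd2)
  have hmc := multConst_pos hq
  set M := maxCoordNorm P X with hMdef
  set σ := normL P q (noise X Y tstar) with hσdef
  set R := √(Real.log d / N) with hRdef
  have hR0 : 0 < R := Real.sqrt_pos.2 (by positivity)
  have hσ0 : 0 ≤ σ := normL_nonneg _ _
  have hM0 : 0 ≤ M := Real.iSup_nonneg fun _ => normL_nonneg _ _
  have hlam0 : 0 < lam := lt_of_le_of_lt (by positivity) hlam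
  have ha0 : 0 ≤ ell1 tstar := ell1_nonneg _
  have hξ2 : MemLp (noise X Y tstar) 2 P := hD.noise_memLp.mono_exponent (by
    rw [← ENNReal.ofReal_ofNat]; exact ENNReal.ofReal_le_ofReal hq.le)
  set p := a₂ / 2 * Real.log d with hpdef
  set T1 := Real.exp (-p / 2) / u ^ (2 * p) with hT1
  set T2 := 4 * Real.exp (-p / 2) / u ^ (1 / 2 * (p / Real.log (Real.exp 1 * N / p))) with hT2
  set T3 := (1 + 2 ^ q) * Real.log N ^ q / (w ^ q * (N : ℝ) ^ (q / 2 - 1)) with hT3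
  have hT10 : 0 ≤ T1 := by positivity
  have hT20 : 0 ≤ T2 := by positivity
  have hT30 : 0 ≤ T3 := by
    have := Real.log_natCast_nonneg N
    positivity
  have hconf : confLevel (1 / 2) (1 + 2 ^ q) a₂ q u v w N d
      = T1 + T2 + T3 + 2 * Real.exp (-(v ^ 2 * a₂ * Real.log d)) := rfl
  have hexp := Real.exp_pos (-(v ^ 2 * a₂ * Real.log d))
  have hexp' := Real.exp_pos (-(ε ^ 2 * N / 2))
  -- If M = 0, all linear functionals of X vanish almost surely and the estimate is trivial; the
  -- radius ρ would be meaningless.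
  rcases hM0.eq_or_lt with hM0' | hMpos
  · have h0 : ∀ j, normL P 2 (fun ω => X ω j) = 0 := fun j =>
      le_antisymm ((normL_le_maxCoordNorm P X j).trans hM0'.ge) (normL_nonneg _ _)
    refine ⟨Set.univ, .univ, ?_, fun ω _ that _ =>
      ⟨risk_sub_eq_normL_sq hmin hD.memLp_coord hξ2 that, ?_⟩⟩
    · rw [probReal_univ, hconf]; linarith
    · rw [normL_two_dotProduct_eq_zero hD.memLp_coord h0, zero_pow two_ne_zero]
      exact mul_nonneg (by norm_num) (le_max_of_le_right (by positivity))
  have hp2 : 2 * p = a₂ * Real.log d := by rw [hpdef]; ring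
  have hx : ∀ j, ∀ r, 2 ≤ r → r ≤ 2 * p → eLpNorm (fun ω => X ω j) (ENNReal.ofReal r) P
      ≤ ENNReal.ofReal (κ₀ * √r * M) := fun j r h1 h2 =>
    hD.eLpNorm_coord_le hκ₀.le j h1 (h2.trans hp2.le)
  have hmult := measureReal_sample_multiplier_le hind hid hmin hD.memLp_coord hq hD.noise_memLp
    hMpos hκ₀ hp8 hx hqp hN2 hNp hdp (by linarith : 1 ≤ u) hw
  have hsmall := measureReal_sample_smallBall_le hind hid hκ₀ hMpos hd2
    (by rw [hp2]; gcongr) hx hN0 hκ hε hD.small_ball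
  set B1 := {ω | ∃ j, multConst q * (u * w) * √(N * p) * (κ₀ * M * σ)
    < |∑ i, (Ys i ω - Xs i ω ⬝ᵥ tstar) * Xs i ω j|} with hB1
  set B2 := {ω | ∃ h, normL P 2 (fun η => X η ⬝ᵥ h) = 1 ∧
        ell1 h ≤ κ * ε / (128 * κ₀ * M * R) ∧
        ∑ i, clippedSq κ (Xs i ω ⬝ᵥ h) < ε / 4 * N} with hB2
  -- The sample maps are only almost everywhere measurable, so the bad set is enlarged to a
  -- measurable set of the same measure.
  have hbad : P'.real (toMeasurable P' (B1 ∪ B2)) ≤ T1 + T2 + T3 + Real.exp (-(ε ^ 2 * N / 2)) := by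
    rw [Measure.real, measure_toMeasurable]
    exact (measureReal_union_le B1 B2).trans (add_le_add hmult hsmall)
  refine ⟨(toMeasurable P' (B1 ∪ B2))ᶜ, (measurableSet_toMeasurable _ _).compl, ?_,
    fun ω hω that hthat => ⟨risk_sub_eq_normL_sq hmin hD.memLp_coord hξ2 that, ?_⟩⟩
  · rw [probReal_compl_eq_one_sub (measurableSet_toMeasurable _ _), hconf]
    linarith
  have hω' : ω ∉ B1 ∪ B2 := fun h => hω (subset_toMeasurable _ _ h)
  have hω1 : ∀ j, |∑ i, (Ys i ω - Xs i ω ⬝ᵥ tstar) * Xs i ω j| ≤ lam / 4 * N := fun j => by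
    refine le_trans (not_lt.1 fun h => hω' (Or.inl ⟨j, h⟩)) ?_
    have e1 : √(N * p) = N * (√(a₂ / 2) * R) := by
      rw [hRdef, ← Real.sqrt_mul (by linarith), ← Real.sqrt_sq hN'.le,
        ← Real.sqrt_mul (by positivity), Real.sqrt_sq hN'.le, hpdef]
      congr 1; field_simp
    have e2 : multConst q * (u * w) * √(N * p) * (κ₀ * M * σ)
        = 4 * multConst q * √(a₂ / 2) * (u * w) * κ₀ * σ * M * R / 4 * N := by rw [e1]; ring
    rw [e2]
    gcongr
    refine le_trans ?_ hlam.le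
    gcongr
    -- The multiplier bound only needs λ above a multiple of uw; the summand u²v is nonnegative and
    -- is dropped.
    nlinarith [mul_pos (pow_pos (by linarith : 0 < u) 2) hv]
  obtain ⟨hl1, hl2⟩ := hthat.basic_inequality hN0 hlam0 hω1
  set τ := normL P 2 (fun η => X η ⬝ᵥ (that - tstar)) with hτ
  have hrhs : 0 ≤ lam / (κ ^ 2 * ε) * ell1 tstar := by positivity
  rcases (normL_nonneg (P := P) 2 (fun η => X η ⬝ᵥ (that - tstar))).eq_or_lt with h0 | hτ0
  · rw [hτ, ← h0, zero_pow two_ne_zero]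
    exact mul_nonneg (by norm_num) (le_max_of_le_right hrhs)
  have hnorm : normL P 2 (fun η => X η ⬝ᵥ (τ⁻¹ • (that - tstar))) = 1 := by
    have e : (fun η => X η ⬝ᵥ (τ⁻¹ • (that - tstar)))
        = τ⁻¹ • fun η => X η ⬝ᵥ (that - tstar) := by
      ext η; simp [dotProduct_smul]
    rw [e, normL, eLpNorm_const_smul, ENNReal.toReal_mul, toReal_enorm,
      Real.norm_of_nonneg (inv_nonneg.2 hτ0.le)]
    exact inv_mul_cancel₀ hτ0.ne'
  have hfin := sq_le_max_of_clippedSq hN0 hκ hε hτ0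
    (show 0 < κ * ε / (128 * κ₀ * M * R) by positivity)
    (fun hρ => not_lt.1 fun hlt => hω' (Or.inr ⟨_, hnorm, hρ, hlt⟩)) hl1 hl2
  have hdet := max_le_mul_max_rateSq (u := u) (v := v) (w := w) (σ := σ) hκ hε hε1 hκ₀ hMpos
    (hD.sq_mul_le_one hκ hMpos) hN0 hNd hlogd hrhs
  rw [one_mul]
  exact hfin.trans hdet
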